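/- Let $q$ be an odd prime power, let $c\in\mathbb F_q$ be a non-square, $K=\mathbb F_q(t)$, and let $D$ be the quaternion algebra over $K$ generated by $Z,F$ with $Z^2=c$, $F^2=t$, $FZ=-ZF$. Write $\mathbb F_q[Z]\cong\mathbb F_{q^2}$ for the quadratic extension of $\mathbb F_q$ generated by $Z$, with conjugation $\alpha\mapsto\bar\alpha$ and norm $N(\alpha)=\alpha\bar\alpha$; write $[g]$ for the class of $g\in D^\times$ in $D^\times/K^\times$, and for $\alpha,\beta\in\mathbb F_q[Z]^\times$ with $N(\alpha)\ne N(\beta)$ put $\zeta_\alpha(\beta)=\frac{1+\alpha/\beta}{1+\bar\alpha/\bar\beta}$. Let $S\subseteq\mathbb P^1(\mathbb F_q)$ contain $0$ and $\infty$, and let $S_0=S\setminus\{0,\infty\}\subseteq\mathbb F_q^\times$. Let $\Gamma_S\subseteq D^\times/K^\times$ be the subgroup generated by the classes $[1+\alpha F]$ with $\alpha\in\mathbb F_q[Z]$ and $N(\alpha)^{-1}\in S_0$. It acts on the product of trees $Z_{S_0}=\prod_{\tau\in S_0}T_\tau$, where $T_\tau$ is the Bruhat--Tits tree of $D_\tau^\times/K_\tau^\times\cong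 \mathrm{PGL}_2(K_\tau)$ with $K_\tau=\mathbb F_q((t-\tau))$, $D_\tau=D\otimes_KK_\tau$; the standard vertex of $T_\tau$ is the one given by the maximal order of $D_\tau$ with basis $1,Z,F,ZF$ over $\mathbb F_q[[t-\tau]]$, and $\star$ is the vertex of $Z_{S_0}$ whose components are the standard vertices. Let $X_S=\Gamma_S\backslash Z_{S_0}$. The double of $X_S$ is defined as follows, in terms of cubical sets (presheaves on the category of the cubes $\{-1,1\}^n$, $n\ge0$, with the maps that are composed of signed permutations of the coordinates and of insertions of signs). The folding $T_\tau\to\square^1$ onto the one-edge graph with vertices $\pm1$ sends a vertex at distance $k$ from the standard vertex to $(-1)^k$; together the foldings give $Z_{S_0}\to\square^{S_0}$, the cube of dimension $\#S_0$, and a type homomorphism $\Gamma_S\to\{\pm1\}^{S_0}$ with kernel $\Gamma_{S,0}$. With $Y_S=\Gamma_{S,0}\backslash Z_{S_0}\to\square^{S_0}$ and the degreewise fibre product, the double is $$\mathscr D(X_S)=(\Gamma_S/\Gamma_{S,0})\backslash\big(Y_S\boxtimes_{\square^{S_0}}Y_S\big),$$ where $\Gamma_S/\Gamma_{S,0}$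 acts diagonally. Its fundamental group is that of its geometric realization. Then $\mathscr D(X_S)$ is a cube complex of dimension $\#S_0$ (pure of dimension $\#S_0$, with the signed permutations of coordinates acting freely on parametrized cubes) with exactly one vertex, its universal covering space is a product of $\#S_0$ trees, and $\pi_1(\mathscr D(X_S))$ (with concatenation of loops as multiplication) has the following presentation. 1. The generators are the pairs $([1+\alpha F],[1+\alpha'F])$ with $N(\alpha)^{-1}=N(\alpha')^{-1}\in S_0$; such a pair $(g,g')$ is the class of the loop along the oriented edge that is the image of the pair of edges of $Z_{S_0}$ from $\star$ to $g\star$ and from $\star$ to $g'\star$. 2. Relations for inverses, for every generator: $([1+\alpha F],[1+\alpha'F])\cdot([1-\alpha F],[1-\alpha'F])=1$. 3. Relations from squares: for all $\tau\ne\sigma$ in $S_0$, all $\alpha,\alpha'$ with $N(\alpha)^{-1}=N(\alpha')^{-1}=\tau$ and all $\beta,\beta'$ with $N(\beta)^{-1}=N(\beta')^{-1}=\sigma$, $$([1+\alpha F],[1+\alpha'F])\cdot([1+\beta F],[1+\beta'F])=([1+\zeta_\alpha(\beta)\beta F],[1+\zeta_{\alpha'}(\beta')\beta'F])\cdot([1+\zeta_\beta(\alpha)\alpha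 F],[1+\zeta_{\beta'}(\alpha')\alpha'F]).$$ -/

import Mathlib

open scoped Quaternion LaurentSeries PowerSeries

noncomputable section

namespace CubeDouble

universe u v w

/-! ## The cube category -/

/-- A morphism `{-1,1}^α → {-1,1}^β` of the cube category, given by an injection `σ` of the
directions and a vector of signs `ε`; the object `[n]` is the index set `Fin n`. The underlying map
of cubes is `CubeHom.app`, and it determines `σ` and `ε`. -/
@[ext]
structure CubeHom (α : Type*) (β : Type*) where
  σ : α ↪ β
  ε : β → ℤˣ

namespace CubeHom

variable {α : Type*} {β : Type*} {γ : Type*}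

/-- `(a_i)_i ↦ (ε_j a_{σ⁻¹(j)})_j`, where `a_{σ⁻¹(j)} = 1` for `j` outside the image of `σ`. -/
def app (f : CubeHom α β) (a : α → ℤˣ) : β → ℤˣ :=
  fun j => f.ε j * Function.extend f.σ a 1 j

/-- The identity of `{-1,1}^α`. -/
def id (α : Type*) : CubeHom α α := ⟨Function.Embedding.refl α, 1⟩

/-- Composition of maps of cubes (`g` after `f`), see `app_comp`. -/
def comp (g : CubeHom β γ) (f : CubeHom α β) : CubeHom α γ :=
  ⟨f.σ.trans g.σ, g.app f.ε⟩

theorem app_id (a : α → ℤˣ) : (CubeHom.id α).app a = a := by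
  funext j
  have h : Function.extend (CubeHom.id α).σ a 1 j = a j :=
    (CubeHom.id α).σ.injective.extend_apply a 1 j
  simp only [app, h]
  simp [CubeHom.id]

theorem app_comp (g : CubeHom β γ) (f : CubeHom α β) (a : α → ℤˣ) :
    (g.comp f).app a = g.app (f.app a) := by
  funext j
  by_cases hj : ∃ k, g.σ k = j
  · obtain ⟨k, rfl⟩ := hj
    by_cases hk : ∃ i, f.σ i = k
    · obtain ⟨i, rfl⟩ := hk
      have h1 : Function.extend (g.comp f).σ a 1 (g.σ (f.σ i)) = a i :=
        (g.comp f).σ.injective.extend_apply a 1 i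
      simp only [app, h1, g.σ.injective.extend_apply, f.σ.injective.extend_apply]
      simp [comp, app, g.σ.injective.extend_apply, mul_assoc]
    · have h1 : Function.extend (g.comp f).σ a 1 (g.σ k) = 1 := by
        rw [Function.extend_apply' _ _ _ ?_]
        · rfl
        · rintro ⟨i, hi⟩
          exact hk ⟨i, g.σ.injective hi⟩
      have h2 : Function.extend f.σ a 1 k = 1 := by
        rw [Function.extend_apply' _ _ _ hk]; rfl
      simp only [app, h1, h2, g.σ.injective.extend_apply]
      simp [comp, app, g.σ.injective.extend_apply]
  · have h1 : Function.extend (g.comp f).σ a 1 j = 1 := by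
      rw [Function.extend_apply' _ _ _ ?_]
      · rfl
      · rintro ⟨i, hi⟩
        exact hj ⟨f.σ i, hi⟩
    simp only [app, h1, Function.extend_apply' _ _ _ hj]
    simp [comp, app, Function.extend_apply' _ _ _ hj]

/-- The face map `δ_i^ε : [n] → [n+1]`, inserting the sign `ε` in position `i`. -/
def face {n : ℕ} (i : Fin (n + 1)) (ε : ℤˣ) : CubeHom (Fin n) (Fin (n + 1)) :=
  ⟨Fin.succAboveEmb i, fun j => if j = i then ε else 1⟩

/-- The real interval `[-1,1]`. -/
abbrev I₁ : Type := Set.Icc (-1 : ℝ) 1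

/-- The affine extension `f_I : [-1,1]^α → [-1,1]^β` of a map of cubes. -/
def appReal (f : CubeHom α β) (t : α → I₁) : β → I₁ := fun j =>
  ⟨((f.ε j : ℤ) : ℝ) * (Function.extend f.σ t (fun _ => ⟨1, by norm_num⟩) j : I₁).1, by
    have h := (Function.extend f.σ t (fun _ => (⟨1, by norm_num⟩ : I₁)) j).2
    rcases Int.units_eq_one_or (f.ε j) with h1 | h1
    · simp only [h1, Set.mem_Icc] at h ⊢
      push_cast
      constructor <;> linarith [h.1, h.2]
    · simp only [h1, Set.mem_Icc] at h ⊢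
      push_cast
      constructor <;> linarith [h.1, h.2]⟩

end CubeHom

/-! ## Cubical sets and cube complexes -/

/-- A cubical set: a contravariant functor from the cube category to sets. -/
structure CubicalSet where
  obj : ℕ → Type u
  map : ∀ {n m : ℕ}, CubeHom (Fin n) (Fin m) → obj m → obj n
  map_id : ∀ (n : ℕ) (x : obj n), map (CubeHom.id (Fin n)) x = x
  map_comp : ∀ {n m k : ℕ} (g : CubeHom (Fin m) (Fin k)) (f : CubeHom (Fin n) (Fin m)) (x : obj k),
    map (g.comp f) x = map f (map g x)

namespace CubicalSet

/-- A morphism of cubical sets: a natural transformation. -/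
@[ext]
structure Hom (X : CubicalSet.{u}) (Y : CubicalSet.{v}) where
  app : ∀ n, X.obj n → Y.obj n
  naturality : ∀ {n m : ℕ} (f : CubeHom (Fin n) (Fin m)) (x : X.obj m),
    app n (X.map f x) = Y.map f (app m x)

/-- A cube complex of dimension `d`: a cubical set that is pure of dimension `d` and on whose
parametrized `m`-cubes the signed permutations, i.e. the (auto)morphisms `[m] → [m]`, act freely. -/
structure IsCubeComplex (X : CubicalSet.{u}) (d : ℕ) : Prop where
  isEmpty : ∀ m, d < m → IsEmpty (X.obj m)
  exists_face : ∀ m, m < d → ∀ y : X.obj m,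
    ∃ (x : X.obj (m + 1)) (i : Fin (m + 1)) (ε : ℤˣ), y = X.map (CubeHom.face i ε) x
  free : ∀ m, m ≤ d → ∀ (g : CubeHom (Fin m) (Fin m)) (x : X.obj m),
    X.map g x = x → g = CubeHom.id (Fin m)

/-- The (degreewise) cartesian fibre product `X ⊠_S Y`. -/
def fibreProduct {X : CubicalSet.{u}} {Y : CubicalSet.{v}} {S : CubicalSet.{w}}
    (f : Hom X S) (g : Hom Y S) : CubicalSet.{max u v} where
  obj n := {p : X.obj n × Y.obj n // f.app n p.1 = g.app n p.2}
  map h p := ⟨(X.map h p.1.1, Y.map h p.1.2), by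
    rw [f.naturality, g.naturality, p.2]⟩
  map_id n p := by
    apply Subtype.ext
    exact Prod.ext (X.map_id n _) (Y.map_id n _)
  map_comp g f p := by
    apply Subtype.ext
    exact Prod.ext (X.map_comp g f _) (Y.map_comp g f _)

/-- The quotient (degreewise) of `X` by a group `G` acting on `X` through `a`. -/
def quotient (X : CubicalSet.{u}) {G : Type*} (a : G → Hom X X) : CubicalSet.{u} where
  obj n := Quot (fun x y : X.obj n => ∃ g : G, (a g).app n x = y)
  map f := Quot.map (X.map f) (by
    rintro x y ⟨g, rfl⟩
    exact ⟨g, (a g).naturality f x⟩)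
  map_id n := by
    rintro ⟨x⟩
    exact congrArg _ (X.map_id n x)
  map_comp g f := by
    rintro ⟨x⟩
    exact congrArg _ (X.map_comp g f x)

/-! ### Geometric realization -/

/-- The disjoint union of a cube `[-1,1]^n` for every parametrized `n`-cube of `X`. -/
abbrev Cells (X : CubicalSet.{u}) : Type u := Σ c : (Σ n, X.obj n), (Fin c.1 → CubeHom.I₁)

/-- The gluing relation `(f^* x, t) ∼ (x, f_I t)`. -/
inductive Glue (X : CubicalSet.{u}) : X.Cells → X.Cells → Prop
  | glue {n m : ℕ} (f : CubeHom (Fin n) (Fin m)) (x : X.obj m) (t : Fin n → CubeHom.I₁) :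
      Glue X ⟨⟨n, X.map f x⟩, t⟩ ⟨⟨m, x⟩, f.appReal t⟩

/-- The geometric realization `|X|`, with the quotient topology of the disjoint union of cubes. -/
def Realization (X : CubicalSet.{u}) : Type u := Quot (Glue X)

instance (X : CubicalSet.{u}) : TopologicalSpace X.Realization :=
  inferInstanceAs (TopologicalSpace (Quot (Glue X)))

/-- The point of `|X|` with coordinates `t` in the cube `x`. -/
def point (X : CubicalSet.{u}) {n : ℕ} (x : X.obj n) (t : Fin n → CubeHom.I₁) : X.Realization :=
  Quot.mk _ ⟨⟨n, x⟩, t⟩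

/-- The vertex `x` as a point of `|X|`. -/
def vertex (X : CubicalSet.{u}) (x : X.obj 0) : X.Realization := X.point x Fin.elim0

/-- The continuous map on realizations that a morphism of cubical sets induces. -/
def Hom.realize {X : CubicalSet.{u}} {Y : CubicalSet.{v}} (p : Hom X Y) :
    X.Realization → Y.Realization :=
  Quot.map (fun c => ⟨⟨c.1.1, p.app c.1.1 c.1.2⟩, c.2⟩) (by
    rintro _ _ ⟨f, x, t⟩
    dsimp only
    rw [p.naturality f x]
    exact Glue.glue f (p.app _ x) t)

/-- `p` exhibits `|X|` as the universal covering space of `|Y|`. -/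
structure Hom.IsUniversalCovering {X : CubicalSet.{u}} {Y : CubicalSet.{v}} (p : Hom X Y) : Prop where
  simplyConnected : SimplyConnectedSpace X.Realization
  isCoveringMap : IsCoveringMap p.realize
  surjective : Function.Surjective p.realize

/-- `γ` runs at constant speed through the (oriented) edge `e` of `X`, from its end `-1` to its
end `1`. -/
def IsEdgePath (X : CubicalSet.{u}) (e : X.obj 1) {x y : X.Realization} (γ : Path x y) : Prop :=
  ∀ t : unitInterval, γ t = X.point e (fun _ => ⟨2 * (t : ℝ) - 1, by
    constructor <;> linarith [t.2.1, t.2.2]⟩)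

end CubicalSet

/-! ## Products of trees as cube complexes, and foldings -/

section Products

variable {ι : Type u} {V : ι → Type v} {W : ι → Type w}

/-- `c : {-1,1}^n → ∏ V i` is a parametrized `n`-cube in the product of the graphs `T i`: there are
`n` different directions `σ 1, …, σ n`, an oriented edge `e i` (from `e i (-1)` to `e i 1`) of `T i`
for each direction `i` among them, and a vertex `e i 1` of `T i` for each other direction `i`. -/
def IsProductCube (T : ∀ i, SimpleGraph (V i)) {n : ℕ} (c : (Fin n → ℤˣ) → ∀ i, V i) : Prop :=
  ∃ (σ : Fin n ↪ ι) (e : ∀ i, ℤˣ → V i), (∀ k, (T (σ k)).Adj (e (σ k) (-1)) (e (σ k) 1)) ∧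
    ∀ a i, c a i = e i (Function.extend σ a 1 i)

theorem IsProductCube.precomp {T : ∀ i, SimpleGraph (V i)} {n m : ℕ}
    {c : (Fin m → ℤˣ) → ∀ i, V i} (hc : IsProductCube T c) (f : CubeHom (Fin n) (Fin m)) :
    IsProductCube T (fun a => c (f.app a)) := by
  obtain ⟨σ, e, he, h⟩ := hc
  refine ⟨f.σ.trans σ, fun i s => e i (Function.extend σ f.ε 1 i * s), ?_, ?_⟩
  · intro k
    have hk := he (f.σ k)
    have h1 : Function.extend σ f.ε 1 ((f.σ.trans σ) k) = f.ε (f.σ k) :=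
      σ.injective.extend_apply f.ε 1 (f.σ k)
    simp only [h1]
    rcases Int.units_eq_one_or (f.ε (f.σ k)) with h2 | h2
    · rw [h2, one_mul, one_mul]
      exact hk
    · rw [h2, neg_one_mul, neg_one_mul, neg_neg]
      exact hk.symm
  · intro a i
    refine (h (f.app a) i).trans (congrArg (e i) ?_)
    by_cases hi : ∃ k, σ k = i
    · obtain ⟨k, rfl⟩ := hi
      simp only [σ.injective.extend_apply, CubeHom.app]
      congr 1
      by_cases hk : ∃ l, f.σ l = k
      · obtain ⟨l, rfl⟩ := hk
        rw [f.σ.injective.extend_apply]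
        exact ((f.σ.trans σ).injective.extend_apply a 1 l).symm
      · rw [Function.extend_apply' _ _ _ hk, Function.extend_apply' _ _ _ ?_]
        · rfl
        · rintro ⟨l, hl⟩
          exact hk ⟨l, σ.injective hl⟩
    · rw [Function.extend_apply' _ _ _ hi, Function.extend_apply' _ _ _ hi,
        Function.extend_apply' _ _ _ ?_]
      · rfl
      · rintro ⟨l, hl⟩
        exact hi ⟨f.σ l, hl⟩

/-- The parametrized `n`-cubes of the product of the graphs `T i`. -/
abbrev ProductCube (T : ∀ i, SimpleGraph (V i)) (n : ℕ) : Type (max u v) :=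
  {c : (Fin n → ℤˣ) → ∀ i, V i // IsProductCube T c}

/-- The (topological) product of the graphs `T i`, a cubical set. Its cubes are determined by their
corners since the `T i` are simple graphs; the face maps are restriction to the corners of the
face. A single tree is the case of one factor. -/
def productComplex (T : ∀ i, SimpleGraph (V i)) : CubicalSet.{max u v} where
  obj n := ProductCube T n
  map f c := ⟨fun a => c.1 (f.app a), c.2.precomp f⟩
  map_id n c := by
    apply Subtype.ext
    funext a
    exact congrArg c.1 (CubeHom.app_id a)
  map_comp g f c := by
    apply Subtype.ext
    funext a
    exact congrArg c.1 (CubeHom.app_comp g f a)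

/-- Graph homomorphisms `T i → T' i` induce a map of products. -/
def productMap {T : ∀ i, SimpleGraph (V i)} {T' : ∀ i, SimpleGraph (W i)} (f : ∀ i, T i →g T' i) :
    CubicalSet.Hom (productComplex T) (productComplex T') where
  app n c := ⟨fun a i => f i (c.1 a i), by
    obtain ⟨σ, e, he, h⟩ := c.2
    exact ⟨σ, fun i s => f i (e i s), fun k => (f (σ k)).map_adj (he k), fun a i => congrArg (f i) (h a i)⟩⟩
  naturality _ _ := rfl

/-- The `1`-dimensional cube `□¹` as a graph: one edge with the two vertices `1` and `-1`. -/
abbrev unitEdge : SimpleGraph ℤˣ := ⊤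

/-- The standard cube `□^ι = ∏_{i ∈ ι} □¹`. -/
abbrev standardCube (ι : Type u) : CubicalSet.{u} := productComplex (fun _ : ι => unitEdge)

end Products

section Folding

variable {V : Type v} {T : SimpleGraph V}

theorem neg_one_pow_dist_ne (hT : T.IsTree) (x : V) {y z : V} (h : T.Adj y z) :
    (-1 : ℤˣ) ^ T.dist x y ≠ (-1) ^ T.dist x z := by
  rcases hT.dist_eq_dist_add_one_of_adj x h with h1 | h1
  · rw [h1, pow_succ]
    rcases Int.units_eq_one_or ((-1 : ℤˣ) ^ T.dist x z) with h2 | h2 <;> rw [h2] <;> decide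
  · rw [h1, pow_succ]
    rcases Int.units_eq_one_or ((-1 : ℤˣ) ^ T.dist x y) with h2 | h2 <;> rw [h2] <;> decide

/-- The folding `T → □¹` of a tree that maps the vertex `x` to `1`. -/
def folding (hT : T.IsTree) (x : V) : T →g unitEdge where
  toFun y := (-1) ^ T.dist x y
  map_rel' h := neg_one_pow_dist_ne hT x h

theorem folding_self (hT : T.IsTree) (x : V) : folding hT x x = 1 := by
  simp [folding]

/-- A tree automorphism covers an automorphism `± 1` of `□¹`. -/
theorem folding_apply_iso (hT : T.IsTree) (x : V) (f : T ≃g T) (y : V) :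
    folding hT x (f y) = folding hT x (f x) * folding hT x y := by
  have key : ∀ a b r t s : ℤˣ, a ≠ r → b ≠ t → r = s * t → a = s * b := by decide
  have hw : ∀ y z : V, T.Walk y z →
      folding hT x (f z) = folding hT x (f x) * folding hT x z →
      folding hT x (f y) = folding hT x (f x) * folding hT x y := by
    intro y z p hz
    induction p with
    | nil => exact hz
    | cons h p ih =>
      exact key _ _ _ _ _ ((folding hT x).map_adj (f.map_adj_iff.2 h))
        ((folding hT x).map_adj h) (ih hz)
  obtain ⟨p⟩ := hT.connected.preconnected y x
  exact hw y x p (by rw [folding_self, mul_one])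

/-- The type `τ : Aut(T) → Aut(□¹) = {± 1}` of automorphisms of a tree; the automorphism `τ(f)` is
the one that satisfies `folding ∘ f = τ(f) ∘ folding`, see `folding_apply_iso`. -/
def typeHom (hT : T.IsTree) (x : V) : (T ≃g T) →* ℤˣ where
  toFun f := folding hT x (f x)
  map_one' := folding_self hT x
  map_mul' f g := folding_apply_iso hT x f (g x)

end Folding

/-! ## The double of a quotient of a product of trees -/

section Double

open CubicalSet

variable {ι : Type u} {V : ι → Type v} {T : ∀ i, SimpleGraph (V i)} {Γ : Type w} [Group Γ]
variable (hT : ∀ i, (T i).IsTree) (x : ∀ i, V i) (ρ : Γ →* ∀ i, T i ≃g T i)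

/-- The action of `Γ` on the product of the `T i` through automorphisms of the factors. -/
def act (g : Γ) : Hom (productComplex T) (productComplex T) :=
  productMap (fun i => ((ρ g i : T i ≃g T i) : T i →g T i))

/-- The type homomorphism `Γ → {± 1}^ι`. -/
def typeMap : Γ →* (ι → ℤˣ) :=
  MonoidHom.mk' (fun g i => typeHom (hT i) (x i) (ρ g i)) (by
    intro g h
    funext i
    simp)

/-- The type preserving subgroup `Γ₀` of `Γ`. -/
def typeKernel : Subgroup Γ := (typeMap hT x ρ).ker

/-- The folding `∏ T i → □^ι` that maps `x` to `(1, …, 1)`. -/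
def productFolding : Hom (productComplex T) (standardCube ι) :=
  productMap (fun i => folding (hT i) (x i))

theorem folding_act (g : Γ) (i : ι) (y : V i) :
    folding (hT i) (x i) (ρ g i y) = typeMap hT x ρ g i * folding (hT i) (x i) y :=
  folding_apply_iso (hT i) (x i) (ρ g i) y

/-- `Y = Γ₀ \ ∏ T i`, the type trivializing cover of `X = Γ \ ∏ T i`. -/
def typeCover : CubicalSet.{max u v} :=
  (productComplex T).quotient (fun g : typeKernel hT x ρ => act ρ (g : Γ))

/-- The map `Y → □^ι` induced by the folding. -/
def typeCoverFolding : Hom (typeCover hT x ρ) (productComplex (fun _ : ι => unitEdge)) where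
  app n := Quot.lift (fun c => (productFolding hT x).app n c) (by
    rintro c _ ⟨⟨g, hg⟩, rfl⟩
    apply Subtype.ext
    funext a i
    have h : typeMap hT x ρ g = 1 := hg
    refine Eq.symm ((folding_act hT x ρ g i (c.1 a i)).trans ?_)
    rw [h]
    exact one_mul _)
  naturality f := by
    rintro ⟨c⟩
    rfl

/-- The action of `Γ`, hence of `Γ/Γ₀`, on `Y`. -/
def typeCoverAct (g : Γ) : Hom (typeCover hT x ρ) (typeCover hT x ρ) where
  app n := Quot.map ((act ρ g).app n) (by
    rintro c _ ⟨⟨h, hh⟩, rfl⟩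
    refine ⟨⟨g * h * g⁻¹, (MonoidHom.normal_ker _).conj_mem h hh g⟩, ?_⟩
    apply Subtype.ext
    funext a i
    simp [act, productMap])
  naturality f := by
    rintro ⟨c⟩
    rfl

/-- The diagonal action of `Γ`, hence of `Γ/Γ₀`, on `Y ⊠_{□^ι} Y`. -/
def fibreProductAct (g : Γ) :
    Hom (fibreProduct (typeCoverFolding hT x ρ) (typeCoverFolding hT x ρ))
      (fibreProduct (typeCoverFolding hT x ρ) (typeCoverFolding hT x ρ)) where
  app n p := ⟨((typeCoverAct hT x ρ g).app n p.1.1, (typeCoverAct hT x ρ g).app n p.1.2), by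
    obtain ⟨⟨⟨c⟩, ⟨c'⟩⟩, h⟩ := p
    apply Subtype.ext
    funext a i
    have h1 : folding (hT i) (x i) (c.1 a i) = folding (hT i) (x i) (c'.1 a i) :=
      congrFun (congrFun (congrArg Subtype.val h) a) i
    refine (folding_act hT x ρ g i (c.1 a i)).trans ?_
    rw [h1]
    exact (folding_act hT x ρ g i (c'.1 a i)).symm⟩
  naturality f p := by
    apply Subtype.ext
    exact Prod.ext ((typeCoverAct hT x ρ g).naturality f _)
      ((typeCoverAct hT x ρ g).naturality f _)

/-- The double `(Γ/Γ₀) \ (Y ⊠_{□^ι} Y)` of `X = Γ \ ∏ T i`, where `Γ/Γ₀` acts diagonally. -/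
def double : CubicalSet.{max u v} :=
  (fibreProduct (typeCoverFolding hT x ρ) (typeCoverFolding hT x ρ)).quotient
    (fibreProductAct hT x ρ)

/-- The cube `y` of the double is the image of the pair `(c, c')` of cubes of `∏ T i`. -/
def IsImageOfPair {n : ℕ} (y : (double hT x ρ).obj n) (c c' : (productComplex T).obj n) : Prop :=
  ∃ h, y = Quot.mk _ ⟨(Quot.mk _ c, Quot.mk _ c'), h⟩

end Double

/-! ## The quaternion algebra and its projective groups -/

section Quaternion

/-- The scalar units `Rˣ` in `Aˣ`. -/
def scalarUnits (R : Type u) (A : Type v) [CommRing R] [Ring A] [Algebra R A] : Subgroup Aˣ :=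
  (Units.map (algebraMap R A : R →* A)).range

instance (R : Type u) (A : Type v) [CommRing R] [Ring A] [Algebra R A] :
    (scalarUnits R A).Normal where
  conj_mem := by
    rintro _ ⟨r, rfl⟩ g
    refine ⟨r, ?_⟩
    apply Units.ext
    simp only [Units.val_mul, Units.coe_map, MonoidHom.coe_coe]
    rw [← Algebra.commutes, mul_assoc, Units.mul_inv, mul_one]

/-- The projective unit group `Aˣ / Rˣ`. -/
abbrev PUnits (R : Type u) (A : Type v) [CommRing R] [Ring A] [Algebra R A] : Type v :=
  Aˣ ⧸ scalarUnits R A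

variable {R : Type u} {R' : Type v} [CommRing R] [CommRing R'] {c t : R} {c' t' : R'}

/-- Base change of quaternion algebras along `f : R → R'`. -/
def quaternionMap (f : R →+* R') (hc : f c = c') (ht : f t = t') : ℍ[R,c,t] →+* ℍ[R',c',t'] where
  toFun a := ⟨f a.re, f a.imI, f a.imJ, f a.imK⟩
  map_zero' := by ext <;> simp
  map_one' := by ext <;> simp
  map_add' a b := by ext <;> simp
  map_mul' a b := by ext <;> simp [hc, ht]

/-- The homomorphism `ℍ[R,c,t]ˣ / Rˣ → ℍ[R',c',t']ˣ / R'ˣ` induced by base change. -/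
def pUnitsMap (f : R →+* R') (hc : f c = c') (ht : f t = t') :
    PUnits R ℍ[R,c,t] →* PUnits R' ℍ[R',c',t'] :=
  QuotientGroup.map _ _ (Units.map (quaternionMap f hc ht : ℍ[R,c,t] →* ℍ[R',c',t'])) (by
    rintro _ ⟨r, rfl⟩
    refine ⟨Units.map (f : R →* R') r, ?_⟩
    apply Units.ext
    ext <;> simp [quaternionMap, QuaternionAlgebra.algebraMap_eq])

/-- The reduced norm `a ā`, an element of the centre `R`. -/
def nrd (a : ℍ[R,c,t]) : R := (a * star a).re

end Quaternion

variable {F : Type u} [Field F]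

/-- The quaternion algebra `D = (c, t)` over `K = F(t)`: it has a basis `1, Z, F, ZF` with `Z² = c`,
`F² = t` and `FZ = -ZF`. -/
abbrev Quat (c : F) : Type u := ℍ[RatFunc F, RatFunc.C c, RatFunc.X]

/-! ### The Bruhat-Tits tree at a rational place `t = τ` -/

/-- The embedding `F(t) → F((s))`, `t ↦ τ + s` of `K` into its completion at the place `t = τ`. -/
def localization (τ : F) : RatFunc F →+* F⸨X⸩ :=
  RatFunc.liftRingHom
    ((algebraMap F⟦X⟧ F⸨X⸩).comp (Polynomial.coeToPowerSeries.ringHom.comp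
      (Polynomial.taylorAlgHom τ : Polynomial F →+* Polynomial F)))
    (nonZeroDivisors_le_comap_nonZeroDivisors_of_injective _ (by
      intro p q h
      exact Polynomial.taylor_injective τ (Polynomial.coe_injective F
        (IsFractionRing.injective F⟦X⟧ F⸨X⸩ h))))

theorem localization_C (τ c : F) :
    localization τ (RatFunc.C c) = algebraMap F⟦X⟧ F⸨X⸩ (PowerSeries.C c) := by
  rw [← RatFunc.algebraMap_C]
  simp [localization]

theorem localization_X (τ : F) :
    localization τ RatFunc.X = algebraMap F⟦X⟧ F⸨X⸩ (PowerSeries.C τ + PowerSeries.X) := by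
  rw [← RatFunc.algebraMap_X]
  simp [localization, add_comm]

/-- The completion at `t = τ` of the sheaf of maximal orders `O ⊕ OZ ⊕ O(-∞)F ⊕ O(-∞)FZ`. -/
abbrev LocalOrder (c τ : F) : Type u := ℍ[F⟦X⟧, PowerSeries.C c, PowerSeries.C τ + PowerSeries.X]

/-- The completion of `D` at `t = τ`. -/
abbrev LocalQuat (c τ : F) : Type u :=
  ℍ[F⸨X⸩, algebraMap F⟦X⟧ F⸨X⸩ (PowerSeries.C c),
    algebraMap F⟦X⟧ F⸨X⸩ (PowerSeries.C τ + PowerSeries.X)]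

/-- `PGL₁(D_τ) = D_τˣ / K_τˣ`, isomorphic to `PGL₂(K_τ)` for `τ ≠ 0`. -/
abbrev LocalPGL (c τ : F) : Type u := PUnits F⸨X⸩ (LocalQuat c τ)

/-- The maximal compact subgroup of `PGL₁(D_τ)` that is the image of the units of the order. -/
def localStabilizer (c τ : F) : Subgroup (LocalPGL c τ) :=
  (pUnitsMap (algebraMap F⟦X⟧ F⸨X⸩) rfl rfl : PUnits F⟦X⟧ (LocalOrder c τ) →* LocalPGL c τ).range

/-- The vertices of the Bruhat-Tits tree of `PGL₁(D_τ)`. -/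
abbrev BTVertex (c τ : F) : Type u := LocalPGL c τ ⧸ localStabilizer c τ

/-- The standard vertex of the Bruhat-Tits tree. -/
def stdVertex (c τ : F) : BTVertex c τ := QuotientGroup.mk 1

/-- `h` is the class of an element of the order whose reduced norm is a uniformizer. -/
def IsUniformizerClass {c τ : F} (h : LocalPGL c τ) : Prop :=
  ∃ (y : LocalOrder c τ) (z : (LocalQuat c τ)ˣ), (nrd y).order = 1 ∧
    (z : LocalQuat c τ) = quaternionMap (algebraMap F⟦X⟧ F⸨X⸩) rfl rfl y ∧ h = QuotientGroup.mk z

/-- The Bruhat-Tits tree of `PGL₁(D_τ)`: the neighbours of the vertex `g` are the vertices `gh` with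
`h` the class of an element of the order whose reduced norm is a uniformizer. -/
def btGraph (c τ : F) : SimpleGraph (BTVertex c τ) :=
  SimpleGraph.fromRel (fun a b => ∃ g h : LocalPGL c τ, IsUniformizerClass h ∧
    a = QuotientGroup.mk g ∧ b = QuotientGroup.mk (g * h))

/-- Left multiplication by an element of `PGL₁(D_τ)` on the Bruhat-Tits tree. -/
def btTranslate (c τ : F) : LocalPGL c τ →* (btGraph c τ ≃g btGraph c τ) where
  toFun k :=
    { toEquiv := MulAction.toPerm k
      map_rel_iff' := by
        have key : ∀ (k : LocalPGL c τ) (a b : BTVertex c τ),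
            (btGraph c τ).Adj a b → (btGraph c τ).Adj (k • a) (k • b) := by
          intro k a b h
          rw [btGraph, SimpleGraph.fromRel_adj] at h ⊢
          refine ⟨fun h1 => h.1 (MulAction.injective k h1), ?_⟩
          obtain ⟨-, ⟨g, l, hl, rfl, rfl⟩ | ⟨g, l, hl, rfl, rfl⟩⟩ := h
          · exact Or.inl ⟨k * g, l, hl, rfl, by rw [mul_assoc]; rfl⟩
          · exact Or.inr ⟨k * g, l, hl, rfl, by rw [mul_assoc]; rfl⟩
        intro a b
        refine ⟨fun h => ?_, key k a b⟩
        have h1 := key k⁻¹ _ _ h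
        simpa using h1 }
  map_one' := by
    ext a
    exact one_smul (LocalPGL c τ) a
  map_mul' k l := by
    ext a
    exact mul_smul k l a

/-! ### The lattice -/

/-- `PGL₁(D) = Dˣ / Kˣ`. -/
abbrev PGLQuat (c : F) : Type u := PUnits (RatFunc F) (Quat c)

/-- The diagonal action of `PGL₁(D)` on the Bruhat-Tits trees at the places `τ ∈ S₀`. -/
def globalAct (c : F) (S₀ : Finset Fˣ) :
    PGLQuat c →* ∀ τ : S₀, (btGraph c (τ : Fˣ) ≃g btGraph c (τ : Fˣ)) :=
  MonoidHom.pi (fun τ => (btTranslate c (τ : Fˣ)).comp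
    (pUnitsMap (localization ((τ : Fˣ) : F)) (localization_C _ c) (localization_X _)))

/-- The quadratic extension `F_q[Z]` of `F = F_q`, with `Z² = c`. -/
abbrev QuadExt (c : F) : Type u := QuadraticAlgebra F c 0

/-- The inclusion `F_q[Z] ⊆ D`. -/
def QuadExt.toQuat {c : F} (α : QuadExt c) : Quat c := ⟨RatFunc.C α.re, RatFunc.C α.im, 0, 0⟩

/-- The element `F` of `D`. -/
def quatF (c : F) : Quat c := ⟨0, 0, 1, 0⟩

theorem one_sub_norm_ne_zero {c : F} (α : QuadExt c) :
    (1 - RatFunc.C (QuadraticAlgebra.norm α) * RatFunc.X : RatFunc F) ≠ 0 := by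
  intro h
  have h1 : algebraMap (Polynomial F) (RatFunc F)
      (1 - Polynomial.C (QuadraticAlgebra.norm α) * Polynomial.X) = 0 := by
    simpa using h
  have h2 := (map_eq_zero_iff _ (RatFunc.algebraMap_injective F)).1 h1
  simpa using congrArg (fun p => Polynomial.coeff p 0) h2

theorem one_add_mul_one_sub {c : F} (α : QuadExt c) :
    (1 + α.toQuat * quatF c) * (1 - α.toQuat * quatF c) =
      algebraMap (RatFunc F) (Quat c)
        (1 - RatFunc.C (QuadraticAlgebra.norm α) * RatFunc.X) := by
  ext <;> simp [QuadExt.toQuat, quatF, QuadraticAlgebra.norm_def, QuaternionAlgebra.algebraMap_eq] <;> ring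

theorem one_sub_mul_one_add {c : F} (α : QuadExt c) :
    (1 - α.toQuat * quatF c) * (1 + α.toQuat * quatF c) =
      algebraMap (RatFunc F) (Quat c)
        (1 - RatFunc.C (QuadraticAlgebra.norm α) * RatFunc.X) := by
  rw [← one_add_mul_one_sub]
  noncomm_ring

/-- The unit `1 + αF` of `D`. -/
def oneAdd {c : F} (α : QuadExt c) : (Quat c)ˣ where
  val := 1 + α.toQuat * quatF c
  inv := (1 - RatFunc.C (QuadraticAlgebra.norm α) * RatFunc.X : RatFunc F)⁻¹ •
    (1 - α.toQuat * quatF c)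
  val_inv := by
    rw [mul_smul_comm, one_add_mul_one_sub, Algebra.smul_def, ← map_mul,
      inv_mul_cancel₀ (one_sub_norm_ne_zero α), map_one]
  inv_val := by
    rw [smul_mul_assoc, one_sub_mul_one_add, Algebra.smul_def, ← map_mul,
      inv_mul_cancel₀ (one_sub_norm_ne_zero α), map_one]

/-- The class `[1 + αF]` in `Dˣ / Kˣ`. -/
def cls {c : F} (α : QuadExt c) : PGLQuat c := QuotientGroup.mk (oneAdd α)

/-- `PA_τ`, the set of the classes `[1 + αF]` with `N(α)⁻¹ = τ`. -/
def PA (c : F) (τ : Fˣ) : Set (PGLQuat c) :=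
  {g | ∃ α : QuadExt c, (QuadraticAlgebra.norm α)⁻¹ = (τ : F) ∧ g = cls α}

/-- The lattice `Γ_S`, generated by the sets `PA_τ` with `τ ∈ S₀ = S \ {0, ∞}`, as a subgroup of
`Dˣ / Kˣ`, which contains the units modulo scalars of the order over the `S`-integers. -/
def latticeΓ (c : F) (S₀ : Finset Fˣ) : Subgroup (PGLQuat c) :=
  Subgroup.closure (⋃ τ ∈ S₀, PA c τ)

/-- The action of `Γ_S` on the product of the trees at the places in `S₀`. -/
def latticeAct (c : F) (S₀ : Finset Fˣ) :
    latticeΓ c S₀ →* ∀ τ : S₀, (btGraph c (τ : Fˣ) ≃g btGraph c (τ : Fˣ)) :=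
  (globalAct c S₀).comp (latticeΓ c S₀).subtype

/-- The standard vertex of the product of trees. -/
def stdPoint (c : F) (S₀ : Finset Fˣ) (τ : S₀) : BTVertex c ((τ : Fˣ) : F) := stdVertex c (τ : Fˣ)

/-- The double of `X_S = Γ_S \ ∏ T_τ`. -/
def arithmeticDouble (c : F) (S₀ : Finset Fˣ)
    (hT : ∀ τ : S₀, (btGraph c ((τ : Fˣ) : F)).IsTree) : CubicalSet.{u} :=
  double hT (stdPoint c S₀) (latticeAct c S₀)

/-! ### The presentation -/

/-- `ζ_α(β) = (1 + α/β) / (1 + ᾱ/β̄)`. -/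
def zeta {c : F} (α β : QuadExt c) : QuadExt c := (1 + α / β) / (1 + star α / star β)

/-- The generators: the pairs `([1 + αF], [1 + α'F])` with `N(α)⁻¹ = N(α')⁻¹ ∈ S₀`. -/
def Gen (c : F) (S₀ : Finset Fˣ) : Type u :=
  {p : PGLQuat c × PGLQuat c // ∃ τ ∈ S₀, p.1 ∈ PA c τ ∧ p.2 ∈ PA c τ}

/-- The generator `x` is the pair `([1 + αF], [1 + α'F])`. -/
def Gen.IsPair {c : F} {S₀ : Finset Fˣ} (x : Gen c S₀) (α α' : QuadExt c) : Prop :=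
  x.1 = (cls α, cls α')

/-- The relations `([1+αF], [1+α'F]) ⬝ ([1-αF], [1-α'F]) = 1`. -/
def inverseRels (c : F) (S₀ : Finset Fˣ) : Set (FreeGroup (Gen c S₀)) :=
  {r | ∃ (α α' : QuadExt c) (x y : Gen c S₀), x.IsPair α α' ∧ y.IsPair (-α) (-α') ∧
    r = FreeGroup.of x * FreeGroup.of y}

/-- The relations `([1+αF], [1+α'F]) ⬝ ([1+βF], [1+β'F]) =
([1+ζ_α(β)βF], [1+ζ_α'(β')β'F]) ⬝ ([1+ζ_β(α)αF], [1+ζ_β'(α')α'F])` for `N(α)⁻¹ = N(α')⁻¹ = τ` and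
`N(β)⁻¹ = N(β')⁻¹ = σ` with `τ ≠ σ` in `S₀`. -/
def squareRels (c : F) (S₀ : Finset Fˣ) : Set (FreeGroup (Gen c S₀)) :=
  {r | ∃ τ ∈ S₀, ∃ σ ∈ S₀, τ ≠ σ ∧ ∃ α α' β β' : QuadExt c,
    (QuadraticAlgebra.norm α)⁻¹ = (τ : F) ∧ (QuadraticAlgebra.norm α')⁻¹ = (τ : F) ∧
    (QuadraticAlgebra.norm β)⁻¹ = (σ : F) ∧ (QuadraticAlgebra.norm β')⁻¹ = (σ : F) ∧
    ∃ x y y₁ x₁ : Gen c S₀, x.IsPair α α' ∧ y.IsPair β β' ∧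
      y₁.IsPair (zeta α β * β) (zeta α' β' * β') ∧ x₁.IsPair (zeta β α * α) (zeta β' α' * α') ∧
      r = (FreeGroup.of x * FreeGroup.of y) * (FreeGroup.of y₁ * FreeGroup.of x₁)⁻¹}

/-- The group with the generators `Gen` and the two families of relations. -/
abbrev DoubleGroup (c : F) (S₀ : Finset Fˣ) : Type u :=
  PresentedGroup (inverseRels c S₀ ∪ squareRels c S₀)

/-- The edge `e` of the double belongs to the generator `x = (g, g')`: it is the image of a pair
`(E, E')` of oriented edges of the product of trees that start in the standard vertex `⋆` and end
in `g⋆` and `g'⋆`. -/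
def IsGenEdge {c : F} {S₀ : Finset Fˣ} (hT : ∀ τ : S₀, (btGraph c ((τ : Fˣ) : F)).IsTree)
    (x : Gen c S₀) (e : (arithmeticDouble c S₀ hT).obj 1) : Prop :=
  ∃ E E' : ProductCube (fun τ : S₀ => btGraph c ((τ : Fˣ) : F)) 1,
    E.1 (fun _ => -1) = stdPoint c S₀ ∧ E'.1 (fun _ => -1) = stdPoint c S₀ ∧
    (∀ τ, E.1 (fun _ => 1) τ = globalAct c S₀ x.1.1 τ (stdPoint c S₀ τ)) ∧
    (∀ τ, E'.1 (fun _ => 1) τ = globalAct c S₀ x.1.2 τ (stdPoint c S₀ τ)) ∧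
    IsImageOfPair hT (stdPoint c S₀) (latticeAct c S₀) e E E'

end CubeDouble

end

open CubeDouble

/-! The fundamental group is not computed by gluing 2-cells. A group with the stated presentation is
made to act on a product of trees built from its own generators, and the double is shown to be the
quotient.

Arithmetic. At the place t = τ, the elements 1 + αF with N(α)τ = 1 have a uniformizer as reduced
norm. A primitive non-unit of the local order has such a left factor (`exists_localLetter_mul`), and
a product of them without adjacent factors 1 + αF, 1 - αF stays primitive
(`reduction_prod_localLetter`). So the Bruhat-Tits graph is the tree of reduced words in these
letters. At the other places of S₀ the letters have unit reduced norm and fix the standard vertex.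
Letters of different places are exchanged by (1 + αF)(1 + βF) = (1 + β'F)(1 + α'F), with β' and α'
given by ζ (`cls_mul_cls`). Sorting words by place then shows that Γ_S is simply transitive on the
vertices of the product of the trees. It has no 2-torsion, because its elements have representatives
with nonzero trace (`eq_one_of_mul_self`). All this is collected in `simpleData`.

The double. Two pairs of cubes with equal foldings have the same image in the double exactly if
their members are Γ_S-equivalent separately (`doubleMk_eq_iff`); the two translating elements
automatically have the same type. Hence the double is a quotient of pairs of cubes by Γ_S × Γ_S. It
has one vertex, and its oriented edges are the pairs of letters of the same place, which are the
generators.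

The covering. Let such pairs be the new letters. For each place they give a rooted tree of reduced
words. A letter acts on the words of its own place by multiplication from the left, and on the words
of another place by being pushed through the word with the exchange rule (`push`). The exchanged
letters are unique, because letters of one place are separated by the stabilizer of the base vertex;
hence this action satisfies the relations of the presentation (`letterIso_mul_inv`, `letterIso_mul`)
and the presented group G acts on the product of the word trees. The action is simply transitive on
vertices (`Lift.eq_one_of_root`, `Lift.exists_root`). The two projections of words to Γ_S-orbits
give a map from the product to the double that is surjective on cubes and whose fibres are the
G-orbits (`covering_surjective`, `covering_eq_iff`). Without 2-torsion no nontrivial element of G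
preserves a cube, so the map of realizations is a covering with group G (`isQuotientCoveringMap`). A
product of finitely many locally finite trees is contractible (`contractibleSpace_treeProduct`), so
the covering is universal and G is the fundamental group, up to passing to the opposite group. -/

noncomputable section

namespace CubeDouble

universe u v w

/-! ## Rooted trees -/

/-- A rooted tree, given by its parent function. -/
structure RootedTree (W : Type v) where
  root : W
  parent : W → W
  depth : W → ℕ
  depth_root : depth root = 0
  parent_root : parent root = root
  depth_parent : ∀ x, x ≠ root → depth x = depth (parent x) + 1

namespace RootedTree

variable {W : Type v} (R : RootedTree W)

/-- The graph of a rooted tree: the edges join the vertices to their parents. -/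
def graph : SimpleGraph W where
  Adj x y := (y ≠ R.root ∧ x = R.parent y) ∨ (x ≠ R.root ∧ y = R.parent x)
  symm := ⟨fun _ _ h => h.symm⟩
  loopless := ⟨fun x h => by
    rcases h with ⟨h, h'⟩ | ⟨h, h'⟩ <;>
    · have := R.depth_parent x h
      rw [← h'] at this
      omega⟩

theorem adj_iff {x y : W} :
    R.graph.Adj x y ↔ (y ≠ R.root ∧ x = R.parent y) ∨ (x ≠ R.root ∧ y = R.parent x) := Iff.rfl

theorem adj_parent {x : W} (h : x ≠ R.root) : R.graph.Adj (R.parent x) x := Or.inl ⟨h, rfl⟩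

/-- `x` is an ancestor of `y`, or `y` itself. -/
def Anc (x y : W) : Prop := ∃ k : ℕ, R.parent^[k] y = x

theorem anc_refl (x : W) : R.Anc x x := ⟨0, rfl⟩

theorem anc_iff (x y : W) : R.Anc x y ↔ x = y ∨ R.Anc x (R.parent y) := by
  constructor
  · rintro ⟨k, hk⟩
    cases k with
    | zero => exact Or.inl hk.symm
    | succ k => exact Or.inr ⟨k, hk⟩
  · rintro (rfl | ⟨k, hk⟩)
    · exact R.anc_refl x
    · exact ⟨k + 1, hk⟩

theorem anc_root {x : W} : R.Anc x R.root ↔ x = R.root := by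
  constructor
  · rintro ⟨k, hk⟩
    rw [Function.iterate_fixed R.parent_root] at hk
    exact hk.symm
  · rintro rfl
    exact R.anc_refl _

theorem depth_parent_le (x : W) : R.depth (R.parent x) ≤ R.depth x := by
  by_cases h : x = R.root
  · rw [h, R.parent_root]
  · have := R.depth_parent x h
    omega

theorem Anc.depth_le {R : RootedTree W} {x y : W} (h : R.Anc x y) : R.depth x ≤ R.depth y := by
  obtain ⟨k, rfl⟩ := h
  induction k generalizing y with
  | zero => rfl
  | succ k ih => exact (ih (y := R.parent y)).trans (R.depth_parent_le y)

theorem root_of_depth {x : W} (h : R.depth x = 0) : x = R.root := by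
  by_contra hx
  have := R.depth_parent x hx
  omega

theorem exists_anc {y : W} {n : ℕ} (h : n ≤ R.depth y) : ∃ x, R.Anc x y ∧ R.depth x = n := by
  induction hd : R.depth y generalizing y with
  | zero => exact ⟨y, R.anc_refl y, by omega⟩
  | succ d ih =>
    by_cases hn : n = d + 1
    · exact ⟨y, R.anc_refl y, by omega⟩
    · have hy : y ≠ R.root := by
        rintro rfl
        rw [R.depth_root] at hd
        omega
      have h1 := R.depth_parent y hy
      obtain ⟨x, hx, hx'⟩ := ih (y := R.parent y) (by omega) (by omega)
      exact ⟨x, (R.anc_iff x y).2 (Or.inr hx), hx'⟩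

theorem reachable_root (x : W) : R.graph.Reachable R.root x := by
  induction hd : R.depth x generalizing x with
  | zero => rw [R.root_of_depth hd]
  | succ d ih =>
    have hx : x ≠ R.root := by
      rintro rfl
      rw [R.depth_root] at hd
      omega
    have h1 := R.depth_parent x hx
    exact (ih (R.parent x) (by omega)).trans (R.adj_parent hx).reachable

/-- Every edge is a bridge: once the edge from x to its parent is removed, no walk leaves the set of
descendants of x. -/
theorem isTree : R.graph.IsTree := by
  have : Nonempty W := ⟨R.root⟩
  refine ⟨⟨fun x y => (R.reachable_root x).symm.trans (R.reachable_root y)⟩, ?_⟩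
  rw [SimpleGraph.isAcyclic_iff_forall_adj_isBridge]
  have key : ∀ x, x ≠ R.root → ¬ (R.graph \ SimpleGraph.fromEdgeSet {s(x, R.parent x)}).Reachable
      x (R.parent x) := by
    rintro x hx ⟨p⟩
    have hp : ∀ y z, (R.graph \ SimpleGraph.fromEdgeSet {s(x, R.parent x)}).Walk y z →
        R.Anc x y → R.Anc x z := by
      intro y z p
      induction p with
      | nil => exact id
      | @cons a b d h p ih =>
        intro hy
        apply ih
        rw [SimpleGraph.sdiff_adj, SimpleGraph.fromEdgeSet_adj] at h
        obtain ⟨h1 | h1, h2⟩ := h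
        · rw [R.anc_iff, ← h1.2]
          exact Or.inr hy
        · rcases (R.anc_iff x a).1 hy with rfl | h3
          · exact absurd ⟨by rw [h1.2]; rfl, by
              rintro rfl
              have := R.depth_parent x hx
              rw [← h1.2] at this
              omega⟩ h2
          · rw [h1.2]
            exact h3
    have h1 := (hp _ _ p (R.anc_refl x)).depth_le
    have := R.depth_parent x hx
    omega
  intro x y h
  rcases h with ⟨h1, rfl⟩ | ⟨h1, rfl⟩
  · rw [SimpleGraph.isBridge_iff]
    intro h2
    apply key y h1
    rw [Sym2.eq_swap]
    exact h2.symm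
  · rw [SimpleGraph.isBridge_iff]
    exact fun h2 => key x h1 h2

/-! ### Points of a tree -/

end RootedTree

/-- The value at the parameter `s ∈ [-1,1]` of the affine function with the value `a` at `-1` and the
value `b` at `1`. -/
def interp (a b s : ℝ) : ℝ := ((1 + s) * b + (1 - s) * a) / 2

theorem interp_self (a s : ℝ) : interp a a s = a := by unfold interp; ring

namespace RootedTree

variable {W : Type v} (R : RootedTree W)

open Classical in
/-- The indicator function of the set of the descendants of `x`. -/
def ind (x y : W) : ℝ := if R.Anc x y then 1 else 0

theorem ind_nonneg (x y : W) : 0 ≤ R.ind x y := by unfold ind; split_ifs <;> norm_num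

theorem ind_le_one (x y : W) : R.ind x y ≤ 1 := by unfold ind; split_ifs <;> norm_num

theorem ind_self (x : W) : R.ind x x = 1 := if_pos (R.anc_refl x)

theorem ind_parent_self {x : W} (h : x ≠ R.root) : R.ind x (R.parent x) = 0 := by
  refine if_neg fun h1 => ?_
  have := h1.depth_le
  have := R.depth_parent x h
  omega

/-- The point with the parameter `s` on the edge from `lo` to `hi` (or at the vertex `lo = hi`) is
the point above the parent of `y` at height `θ`. -/
def Loc (lo hi : W) (s : ℝ) (y : W) (θ : ℝ) : Prop :=
  (θ = 1 ∧ (lo = hi ∧ hi = y ∨ s = 1 ∧ hi = y ∨ s = -1 ∧ lo = y)) ∨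
  (0 < θ ∧ θ < 1 ∧ y ≠ R.root ∧ (lo = R.parent y ∧ hi = y ∧ s = 2 * θ - 1 ∨
    hi = R.parent y ∧ lo = y ∧ s = 1 - 2 * θ))

theorem exists_loc {lo hi : W} {s : ℝ} (h : lo = hi ∨ R.graph.Adj lo hi) (h1 : -1 ≤ s)
    (h2 : s ≤ 1) : ∃ y θ, R.Loc lo hi s y θ := by
  by_cases h3 : s = 1
  · exact ⟨hi, 1, Or.inl ⟨rfl, Or.inr (Or.inl ⟨h3, rfl⟩)⟩⟩
  by_cases h4 : s = -1
  · exact ⟨lo, 1, Or.inl ⟨rfl, Or.inr (Or.inr ⟨h4, rfl⟩)⟩⟩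
  have h5 : s < 1 := lt_of_le_of_ne h2 h3
  have h6 : -1 < s := lt_of_le_of_ne h1 (Ne.symm h4)
  rcases h with rfl | ⟨h, rfl⟩ | ⟨h, rfl⟩
  · exact ⟨lo, 1, Or.inl ⟨rfl, Or.inl ⟨rfl, rfl⟩⟩⟩
  · exact ⟨hi, (1 + s) / 2, Or.inr ⟨by linarith, by linarith, h, Or.inl ⟨rfl, rfl, by ring⟩⟩⟩
  · exact ⟨lo, (1 - s) / 2, Or.inr ⟨by linarith, by linarith, h, Or.inr ⟨rfl, rfl, by ring⟩⟩⟩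

theorem Loc.pos {R : RootedTree W} {lo hi : W} {s : ℝ} {y : W} {θ : ℝ} (h : R.Loc lo hi s y θ) :
    0 < θ ∧ θ ≤ 1 := by
  rcases h with ⟨rfl, -⟩ | ⟨h1, h2, -⟩
  · norm_num
  · exact ⟨h1, h2.le⟩

/-- An affine function on an edge depends only on the normal form (y, θ) of the point, no longer on
the orientation of the edge or on how a vertex was represented. -/
theorem Loc.interp_eq {R : RootedTree W} {lo hi : W} {s : ℝ} {y : W} {θ : ℝ}
    (h : R.Loc lo hi s y θ) (φ : W → ℝ) :
    interp (φ lo) (φ hi) s = θ * φ y + (1 - θ) * φ (R.parent y) := by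
  unfold interp
  rcases h with ⟨rfl, ⟨rfl, rfl⟩ | ⟨rfl, rfl⟩ | ⟨rfl, rfl⟩⟩ | ⟨-, -, -, ⟨rfl, rfl, rfl⟩ | ⟨rfl, rfl, rfl⟩⟩ <;> ring

/-- Only ancestors of y, including y, can have a nonzero height coordinate. Together with
`eq_of_height_pos` this recovers y as the deepest vertex at which the height coordinate is positive.
-/
theorem depth_le_of_height_pos {x y : W} {θ : ℝ} 
    (h : 0 < θ * R.ind x y + (1 - θ) * R.ind x (R.parent y)) : R.depth x ≤ R.depth y := by
  by_contra h1
  have h2 : ¬ R.Anc x y := fun h2 => h1 h2.depth_le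
  have h3 : ¬ R.Anc x (R.parent y) := fun h3 => h2 ((R.anc_iff x y).2 (Or.inr h3))
  simp [ind, h2, h3] at h

theorem eq_of_height_pos {x y : W} {θ : ℝ} (hd : R.depth y ≤ R.depth x)
    (h : 0 < θ * R.ind x y + (1 - θ) * R.ind x (R.parent y)) : x = y := by
  by_contra hxy
  have h3 : ¬ R.Anc x (R.parent y) := by
    intro h3
    by_cases hy : y = R.root
    · rw [hy, R.parent_root, R.anc_root] at h3
      exact hxy (h3.trans hy.symm)
    · have := h3.depth_le
      have := R.depth_parent y hy
      omega
  have h2 : ¬ R.Anc x y := by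
    rw [R.anc_iff]
    rintro (h4 | h4)
    · exact hxy h4
    · exact h3 h4
  simp [ind, h2, h3] at h

/-- A point of a tree is determined by its height coordinates. -/
theorem loc_unique {y y' : W} {θ θ' : ℝ} (h0 : 0 < θ) (h0' : 0 < θ') (h1 : θ ≤ 1) (h1' : θ' ≤ 1)
    (hr : y = R.root → θ = 1) (hr' : y' = R.root → θ' = 1)
    (h : ∀ x, θ * R.ind x y + (1 - θ) * R.ind x (R.parent y) =
      θ' * R.ind x y' + (1 - θ') * R.ind x (R.parent y')) : y = y' ∧ θ = θ' := by
  have p1 : 0 < θ * R.ind y y + (1 - θ) * R.ind y (R.parent y) := by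
    rw [R.ind_self, mul_one]
    have := mul_nonneg (sub_nonneg.2 h1) (R.ind_nonneg y (R.parent y))
    linarith
  have p2 : 0 < θ' * R.ind y' y' + (1 - θ') * R.ind y' (R.parent y') := by
    rw [R.ind_self, mul_one]
    have := mul_nonneg (sub_nonneg.2 h1') (R.ind_nonneg y' (R.parent y'))
    linarith
  have q1 := p1
  rw [h] at q1
  rw [← h] at p2
  have e : y = y' := R.eq_of_height_pos (R.depth_le_of_height_pos p2) q1
  refine ⟨e, ?_⟩
  subst e
  by_cases hy : y = R.root
  · rw [hr hy, hr' hy]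
  · have := h y
    rw [R.ind_self, R.ind_parent_self hy] at this
    linarith

theorem Loc.unique {R : RootedTree W} {lo hi lo' hi' : W} {s s' : ℝ} {y y' : W} {θ θ' : ℝ}
    (h : R.Loc lo hi s y θ) (h' : R.Loc lo' hi' s' y' θ')
    (e : ∀ x, interp (R.ind x lo) (R.ind x hi) s = interp (R.ind x lo') (R.ind x hi') s') :
    y = y' ∧ θ = θ' := by
  refine R.loc_unique h.pos.1 h'.pos.1 h.pos.2 h'.pos.2 ?_ ?_ ?_
  · rintro rfl
    rcases h with h | h
    · exact h.1
    · exact absurd rfl h.2.2.1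
  · rintro rfl
    rcases h' with h | h
    · exact h.1
    · exact absurd rfl h.2.2.1
  · intro x
    have := e x
    rwa [h.interp_eq (R.ind x), h'.interp_eq (R.ind x)] at this

/-- If a vertex has the same height coordinates as a point on an edge, it is an end of the edge. -/
theorem eq_of_interp_vertex {y lo' hi' : W} {s' : ℝ} (h' : lo' = hi' ∨ R.graph.Adj lo' hi')
    (h1' : -1 ≤ s') (h2' : s' ≤ 1)
    (e : ∀ x, R.ind x y = interp (R.ind x lo') (R.ind x hi') s') :
    (lo' = hi' ∧ hi' = y) ∨ (lo' ≠ hi' ∧ s' = 1 ∧ hi' = y) ∨ (lo' ≠ hi' ∧ s' = -1 ∧ lo' = y) := by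
  obtain ⟨y', θ', hl⟩ := R.exists_loc h' h1' h2'
  have hy : R.Loc y y 0 y 1 := Or.inl ⟨rfl, Or.inl ⟨rfl, rfl⟩⟩
  obtain ⟨rfl, rfl⟩ := hy.unique hl (fun x => by rw [interp_self]; exact e x)
  by_cases hne : lo' = hi'
  · left
    rcases hl with ⟨-, h3 | h3 | h3⟩ | h3
    · exact h3
    · exact ⟨hne, h3.2⟩
    · exact ⟨hne, hne ▸ h3.2⟩
    · exact absurd h3.2.1 (lt_irrefl _)
  · right
    rcases hl with ⟨-, h3 | h3 | h3⟩ | h3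
    · exact absurd h3.1 hne
    · exact Or.inl ⟨hne, h3⟩
    · exact Or.inr ⟨hne, h3⟩
    · exact absurd h3.2.1 (lt_irrefl _)

/-- If an inner point of an edge has the same height coordinates as another point, the edges agree
up to orientation. -/
theorem eq_of_interp_edge {lo hi lo' hi' : W} {s s' : ℝ} (h : R.graph.Adj lo hi)
    (h1 : -1 < s) (h2 : s < 1) (h' : lo' = hi' ∨ R.graph.Adj lo' hi')
    (h1' : -1 ≤ s') (h2' : s' ≤ 1)
    (e : ∀ x, interp (R.ind x lo) (R.ind x hi) s = interp (R.ind x lo') (R.ind x hi') s') :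
    (lo' = lo ∧ hi' = hi ∧ s' = s) ∨ (lo' = hi ∧ hi' = lo ∧ s' = -s) := by
  obtain ⟨y, θ, hl⟩ := R.exists_loc (Or.inr h) h1.le h2.le
  obtain ⟨y', θ', hl'⟩ := R.exists_loc h' h1' h2'
  obtain ⟨rfl, rfl⟩ := hl.unique hl' e
  rcases hl with ⟨-, h3 | h3 | h3⟩ | ⟨-, h3, -, h4⟩
  · exact absurd h3.1 h.ne
  · exact absurd h3.1 h2.ne
  · exact absurd h3.1 h1.ne'
  rcases hl' with h5 | ⟨-, -, -, h5⟩
  · exact absurd h5.1 h3.ne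
  rcases h4 with ⟨rfl, rfl, rfl⟩ | ⟨rfl, rfl, rfl⟩ <;> rcases h5 with ⟨rfl, rfl, rfl⟩ | ⟨rfl, rfl, rfl⟩
  · exact Or.inl ⟨rfl, rfl, rfl⟩
  · exact Or.inr ⟨rfl, rfl, by ring⟩
  · exact Or.inr ⟨rfl, rfl, by ring⟩
  · exact Or.inl ⟨rfl, rfl, rfl⟩

/-- Cutting off a point of the tree at the heights `g`. -/
theorem exists_truncation {g : ℕ → ℝ} (hg : ∀ n, 0 ≤ g n) (hg0 : g 0 = 1)
    (hgs : ∀ n, 0 < g (n + 1) → g n = 1) {lo hi : W} {s : ℝ} (h : lo = hi ∨ R.graph.Adj lo hi)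
    (h1 : -1 ≤ s) (h2 : s ≤ 1) :
    ∃ (lo' hi' : W) (s' : CubeHom.I₁), (lo' = hi' ∨ R.graph.Adj lo' hi') ∧
      ∀ x, interp (R.ind x lo') (R.ind x hi') s' =
        min (interp (R.ind x lo) (R.ind x hi) s) (g (R.depth x)) := by
  have hgm : ∀ n m, n < m → 0 < g m → g n = 1 := by
    intro n m h
    induction h with
    | refl => exact hgs n
    | step h ih => exact fun h3 => ih (by rw [hgs _ h3]; exact one_pos)
  -- Induction on the depth of y. If the level of y is cut at a positive height, all lower levels
  -- are uncut and only θ has to be lowered; if it is cut at height 0, the point drops to the parent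
  -- of y, where the induction hypothesis applies with θ = 1.
  have key : ∀ d y θ, R.depth y = d → 0 ≤ θ → θ ≤ 1 → ∃ (lo' hi' : W) (s' : CubeHom.I₁),
      (lo' = hi' ∨ R.graph.Adj lo' hi') ∧ ∀ x, interp (R.ind x lo') (R.ind x hi') s' =
        min (θ * R.ind x y + (1 - θ) * R.ind x (R.parent y)) (g (R.depth x)) := by
    intro d
    induction d with
    | zero =>
      intro y θ hy h3 h4
      refine ⟨R.root, R.root, ⟨1, by norm_num⟩, Or.inl rfl, fun x => ?_⟩
      rw [interp_self, R.root_of_depth hy, R.parent_root]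
      by_cases hx : R.Anc x R.root
      · rw [R.anc_root] at hx
        rw [hx, R.ind_self, R.depth_root, hg0]
        ring_nf
        simp
      · have h0 : R.ind x R.root = 0 := if_neg hx
        rw [h0]
        simp [hg]
    | succ d ih =>
      intro y θ hy h3 h4
      have hyr : y ≠ R.root := by
        rintro rfl
        rw [R.depth_root] at hy
        omega
      have hp := R.depth_parent y hyr
      by_cases h5 : 0 < g (d + 1)
      · refine ⟨R.parent y, y, ⟨2 * min θ (g (d + 1)) - 1, ?_, ?_⟩, Or.inr (R.adj_parent hyr), ?_⟩
        · have := le_min h3 h5.le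
          linarith
        · have := min_le_left θ (g (d + 1))
          linarith
        · intro x
          have e1 : ∀ a b m : ℝ, interp a b (2 * m - 1) = m * b + (1 - m) * a := by
            intro a b m; unfold interp; ring
          rw [e1]
          by_cases hx : R.Anc x (R.parent y)
          · have h6 : R.ind x (R.parent y) = 1 := if_pos hx
            have h7 : R.ind x y = 1 := if_pos ((R.anc_iff x y).2 (Or.inr hx))
            have h8 := hx.depth_le
            rw [h6, h7, hgm (R.depth x) (d + 1) (by omega) h5]
            ring_nf
            simp
          · have h6 : R.ind x (R.parent y) = 0 := if_neg hx
            by_cases hxy : x = y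
            · subst hxy
              rw [h6, R.ind_self, hy]
              simp
            · have h7 : R.ind x y = 0 := if_neg (by rw [R.anc_iff]; tauto)
              rw [h6, h7]
              simp [hg]
      · have h6 : g (d + 1) = 0 := le_antisymm (not_lt.1 h5) (hg _)
        obtain ⟨lo', hi', s', h7, h8⟩ := ih (R.parent y) 1 (by omega) zero_le_one le_rfl
        refine ⟨lo', hi', s', h7, fun x => ?_⟩
        rw [h8]
        by_cases hxy : x = y
        · subst hxy
          rw [hy, h6, R.ind_parent_self hyr]
          simp only [mul_zero, sub_self, zero_mul, add_zero]
          rw [min_self, min_eq_right]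
          rw [R.ind_self]; linarith
        · have h9 : R.ind x y = R.ind x (R.parent y) := by
            have h10 : R.Anc x y ↔ R.Anc x (R.parent y) := by
              rw [R.anc_iff x y, or_iff_right hxy]
            unfold ind
            by_cases h11 : R.Anc x (R.parent y)
            · rw [if_pos h11, if_pos (h10.2 h11)]
            · rw [if_neg h11, if_neg (mt h10.1 h11)]
          rw [h9]
          ring_nf
  obtain ⟨y, θ, hl⟩ := R.exists_loc h h1 h2
  obtain ⟨lo', hi', s', h3, h4⟩ := key _ y θ rfl hl.pos.1.le hl.pos.2
  refine ⟨lo', hi', s', h3, fun x => ?_⟩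
  rw [h4, hl.interp_eq (R.ind x)]

end RootedTree

open CubicalSet

/-! ## Cubes of a product of graphs -/

theorem extend_one_eq {ι : Type*} {n : ℕ} (σ : Fin n → ι) (i : ι) :
    Function.extend σ (1 : Fin n → ℤˣ) 1 i = 1 := by
  classical
  by_cases h : ∃ k, σ k = i
  · rw [Function.extend_def, dif_pos h]
    rfl
  · rw [Function.extend_apply' _ _ _ h]
    rfl

namespace ProductCube

variable {ι : Type u} {V : ι → Type v} {T : ∀ i, SimpleGraph (V i)} {n m : ℕ}

/-- The directions of a cube. -/
def dir (c : ProductCube T n) : Fin n ↪ ι := c.2.choose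

theorem dir_spec (c : ProductCube T n) : ∃ e : ∀ i, ℤˣ → V i,
    (∀ k, (T (c.dir k)).Adj (e (c.dir k) (-1)) (e (c.dir k) 1)) ∧
      ∀ a i, c.1 a i = e i (Function.extend c.dir a 1 i) := c.2.choose_spec

/-- The corner `(1, …, 1)`. -/
def hi (c : ProductCube T n) (i : ι) : V i := c.1 1 i

/-- The corner `(-1, …, -1)`. -/
def lo (c : ProductCube T n) (i : ι) : V i := c.1 (fun _ => -1) i

theorem apply_of_notMem (c : ProductCube T n) (a : Fin n → ℤˣ) {i : ι} (h : i ∉ Set.range c.dir) :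
    c.1 a i = c.hi i := by
  obtain ⟨e, he, hc⟩ := c.dir_spec
  rw [hi, hc, hc, Function.extend_apply' _ _ _ h, Function.extend_apply' _ _ _ h]

theorem apply_dir (c : ProductCube T n) (a : Fin n → ℤˣ) (k : Fin n) :
    c.1 a (c.dir k) = if a k = 1 then c.hi (c.dir k) else c.lo (c.dir k) := by
  obtain ⟨e, he, hc⟩ := c.dir_spec
  have h1 : ∀ b : Fin n → ℤˣ, c.1 b (c.dir k) = e (c.dir k) (b k) := by
    intro b
    refine (hc b (c.dir k)).trans (congrArg _ ?_)
    exact c.dir.injective.extend_apply b 1 k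
  rw [hi, lo, h1, h1, h1]
  rcases Int.units_eq_one_or (a k) with h | h <;> rw [h]
  · simp
  · rw [if_neg (by decide)]

theorem adj_dir (c : ProductCube T n) (k : Fin n) : (T (c.dir k)).Adj (c.lo (c.dir k)) (c.hi (c.dir k)) := by
  obtain ⟨e, he, hc⟩ := c.dir_spec
  have h1 : ∀ b : Fin n → ℤˣ, c.1 b (c.dir k) = e (c.dir k) (b k) := by
    intro b
    refine (hc b (c.dir k)).trans (congrArg _ ?_)
    exact c.dir.injective.extend_apply b 1 k
  rw [hi, lo, h1, h1]
  exact he k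

theorem lo_of_notMem (c : ProductCube T n) {i : ι} (h : i ∉ Set.range c.dir) : c.lo i = c.hi i :=
  c.apply_of_notMem _ h

theorem mem_range_dir (c : ProductCube T n) {i : ι} : i ∈ Set.range c.dir ↔ c.lo i ≠ c.hi i := by
  constructor
  · rintro ⟨k, rfl⟩
    exact (c.adj_dir k).ne
  · intro h
    by_contra h1
    exact h (c.lo_of_notMem h1)

theorem lo_eq_or_adj (c : ProductCube T n) (i : ι) : c.lo i = c.hi i ∨ (T i).Adj (c.lo i) (c.hi i) := by
  by_cases h : i ∈ Set.range c.dir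
  · obtain ⟨k, rfl⟩ := h
    exact Or.inr (c.adj_dir k)
  · exact Or.inl (c.lo_of_notMem h)

theorem apply_eq (c : ProductCube T n) (a : Fin n → ℤˣ) (i : ι) :
    c.1 a i = if Function.extend c.dir a 1 i = 1 then c.hi i else c.lo i := by
  by_cases h : i ∈ Set.range c.dir
  · obtain ⟨k, rfl⟩ := h
    rw [c.dir.injective.extend_apply, apply_dir]
  · rw [Function.extend_apply' _ _ _ h, c.apply_of_notMem a h]
    simp

theorem apply_eq_hi_or_lo (c : ProductCube T n) (a : Fin n → ℤˣ) (i : ι) :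
    c.1 a i = c.hi i ∨ c.1 a i = c.lo i := by
  rw [c.apply_eq]
  split_ifs <;> simp

/-- The directions of a cube are obtained by choice. They are nevertheless canonical: flipping the
k-th sign changes the component in the k-th direction and no other. This computes `dir` for faces,
images and explicitly given cubes. -/
theorem dir_unique (c : ProductCube T n) (σ : Fin n → ι)
    (h : ∀ k, c.1 (Function.update 1 k (-1)) (σ k) ≠ c.1 1 (σ k)) : σ = c.dir := by
  funext k
  by_contra h1
  apply h k
  by_cases h2 : σ k ∈ Set.range c.dir
  · obtain ⟨l, hl⟩ := h2
    have hlk : l ≠ k := by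
      rintro rfl
      exact h1 hl.symm
    rw [← hl, apply_dir, apply_dir, Function.update_of_ne hlk]
  · rw [c.apply_of_notMem _ h2, c.apply_of_notMem _ h2]

/-- The cube with the directions `σ` and given opposite corners. -/
def mk' (σ : Fin n ↪ ι) (lo hi : ∀ i, V i) (h : ∀ k, (T (σ k)).Adj (lo (σ k)) (hi (σ k))) :
    ProductCube T n :=
  ⟨fun a i => if Function.extend σ a 1 i = 1 then hi i else lo i, σ,
    fun i s => if s = 1 then hi i else lo i, fun k => by
      dsimp only
      rw [if_pos rfl, if_neg (by decide)]
      exact h k, fun a i => rfl⟩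

theorem mk'_hi (σ : Fin n ↪ ι) (lo hi : ∀ i, V i) (h : ∀ k, (T (σ k)).Adj (lo (σ k)) (hi (σ k))) :
    (mk' σ lo hi h).hi = hi := by
  funext i
  exact if_pos (extend_one_eq _ _)

theorem mk'_dir (σ : Fin n ↪ ι) (lo hi : ∀ i, V i) (h : ∀ k, (T (σ k)).Adj (lo (σ k)) (hi (σ k))) :
    (mk' σ lo hi h).dir = σ := by
  apply DFunLike.coe_injective
  symm
  apply dir_unique
  intro k
  simp only [mk', σ.injective.extend_apply]
  simp only [Function.update_self, Pi.one_apply, if_true]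
  rw [if_neg (by decide)]
  exact (h k).ne

theorem mk'_lo (σ : Fin n ↪ ι) (lo hi : ∀ i, V i) (h : ∀ k, (T (σ k)).Adj (lo (σ k)) (hi (σ k)))
    (k : Fin n) : (mk' σ lo hi h).lo (σ k) = lo (σ k) := by
  simp only [ProductCube.lo, mk', σ.injective.extend_apply]
  rw [if_neg (by decide)]

theorem ext_of {c c' : ProductCube T n} (hd : c.dir = c'.dir) (hh : c.hi = c'.hi)
    (hl : ∀ k, c.lo (c.dir k) = c'.lo (c.dir k)) : c = c' := by
  apply Subtype.ext
  funext a i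
  by_cases h : i ∈ Set.range c.dir
  · have h' := h
    obtain ⟨k, rfl⟩ := h
    rw [c.apply_eq, c'.apply_eq, hh, hl, hd]
  · rw [c.apply_of_notMem a h, c'.apply_of_notMem a (hd ▸ h), hh]

theorem dir_map (c : ProductCube T m) (f : CubeHom (Fin n) (Fin m)) :
    ProductCube.dir ((productComplex T).map f c : ProductCube T n) = f.σ.trans c.dir := by
  apply DFunLike.coe_injective
  symm
  apply dir_unique
  intro k
  have hne := (c.adj_dir (f.σ k)).ne
  change c.1 (f.app (Function.update 1 k (-1))) (c.dir (f.σ k)) ≠ c.1 (f.app 1) (c.dir (f.σ k))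
  rw [apply_dir, apply_dir]
  simp only [CubeHom.app, f.σ.injective.extend_apply, Function.update_self, Pi.one_apply]
  rcases Int.units_eq_one_or (f.ε (f.σ k)) with h | h <;> rw [h]
  · rw [if_neg (by decide), if_pos (by decide)]
    exact hne
  · rw [if_pos (by decide), if_neg (by decide)]
    exact hne.symm

theorem card_le [Fintype ι] (c : ProductCube T n) : n ≤ Fintype.card ι := by
  simpa using Fintype.card_le_of_embedding c.dir

end ProductCube

/-! ## Points of the realization -/

namespace CubicalSet

variable (X : CubicalSet.{u})

theorem point_map {n m : ℕ} (f : CubeHom (Fin n) (Fin m)) (x : X.obj m) (t : Fin n → CubeHom.I₁) :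
    X.point (X.map f x) t = X.point x (f.appReal t) :=
  Quot.sound (Glue.glue f x t)

/-- A parameter that equals ±1 puts the point on a face, so a representative of smaller dimension
exists until all parameters are inner. -/
theorem exists_interior (z : X.Realization) : ∃ (n : ℕ) (x : X.obj n) (t : Fin n → CubeHom.I₁),
    z = X.point x t ∧ ∀ k, -1 < (t k : ℝ) ∧ (t k : ℝ) < 1 := by
  obtain ⟨⟨⟨n, x⟩, t⟩, rfl⟩ := Quot.exists_rep z
  induction n with
  | zero => exact ⟨0, x, t, rfl, fun k => k.elim0⟩
  | succ n ih =>
    by_cases h : ∀ k, -1 < (t k : ℝ) ∧ (t k : ℝ) < 1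
    · exact ⟨n + 1, x, t, rfl, h⟩
    · rw [not_forall] at h
      obtain ⟨k, hk⟩ := h
      have h1 : ∃ ε : ℤˣ, (t k : ℝ) = ((ε : ℤ) : ℝ) := by
        by_cases h2 : -1 < (t k : ℝ)
        · exact ⟨1, by
            have h3 : ¬ (t k : ℝ) < 1 := fun h3 => hk ⟨h2, h3⟩
            have h4 := (t k).2.2
            push_cast
            linarith⟩
        · exact ⟨-1, by
            have h4 := (t k).2.1
            push_cast
            linarith⟩
      obtain ⟨ε, hε⟩ := h1
      have h2 : t = (CubeHom.face k ε).appReal (fun j => t (k.succAbove j)) := by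
        funext j
        apply Subtype.ext
        simp only [CubeHom.appReal, CubeHom.face]
        by_cases hj : j = k
        · subst hj
          rw [if_pos rfl, Function.extend_apply', hε]
          · simp
          · rintro ⟨l, hl⟩
            exact Fin.succAbove_ne j l hl
        · rw [if_neg hj]
          obtain ⟨l, rfl⟩ := Fin.exists_succAbove_eq hj
          have : Function.extend (Fin.succAboveEmb k) (fun j => t (k.succAbove j))
              (fun _ => ⟨1, by norm_num⟩) (k.succAbove l) = t (k.succAbove l) :=
            (Fin.succAboveEmb k).injective.extend_apply _ _ l
          rw [this]
          simp
      obtain ⟨n', x', t', h3, h4⟩ := ih (X.map (CubeHom.face k ε) x) (fun j => t (k.succAbove j))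
      refine ⟨n', x', t', ?_, h4⟩
      rw [← h3]
      refine Eq.trans ?_ (X.point_map _ _ _).symm
      rw [← h2]
      rfl

theorem continuous_point {n : ℕ} (x : X.obj n) : Continuous (X.point x) := by
  have : Continuous (fun t => (⟨⟨n, x⟩, t⟩ : X.Cells)) := by
    exact continuous_sigmaMk (σ := fun c : (Σ n, X.obj n) => (Fin c.1 → CubeHom.I₁)) (i := ⟨n, x⟩)
  exact continuous_quot_mk.comp this

theorem continuous_of_point {Z : Type*} [TopologicalSpace Z] {f : X.Realization → Z}
    (h : ∀ n (x : X.obj n), Continuous (fun t => f (X.point x t))) : Continuous f := by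
  refine (isQuotientMap_quot_mk (r := Glue X)).continuous_iff.2 ?_
  exact continuous_sigma fun c => h c.1 c.2

end CubicalSet

/-! ## Coordinate functions -/

section Coordinates

variable {ι : Type u} {V : ι → Type v} {T : ∀ i, SimpleGraph (V i)}

/-- The coordinate of a point of the cube `c` in the factor `i`. -/
def coordParam {n : ℕ} (c : ProductCube T n) (t : Fin n → CubeHom.I₁) (i : ι) : CubeHom.I₁ :=
  Function.extend c.dir t (fun _ => ⟨1, by norm_num⟩) i

theorem coordParam_dir {n : ℕ} (c : ProductCube T n) (t : Fin n → CubeHom.I₁) (k : Fin n) :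
    coordParam c t (c.dir k) = t k := c.dir.injective.extend_apply _ _ k

theorem continuous_coordParam {n : ℕ} (c : ProductCube T n) (i : ι) :
    Continuous (fun t => coordParam c t i) := by
  by_cases h : i ∈ Set.range c.dir
  · obtain ⟨k, rfl⟩ := h
    simp only [coordParam_dir]
    fun_prop
  · simp only [coordParam, Function.extend_apply' _ _ _ h]
    fun_prop

/-- The function on `|∏ T i|` that extends the function `φ` of the vertices of `T i` affinely. -/
def cellCoord (i : ι) (φ : V i → ℝ) (p : (productComplex T).Cells) : ℝ :=
  interp (φ (ProductCube.lo p.1.2 i)) (φ (ProductCube.hi p.1.2 i)) (coordParam p.1.2 p.2 i)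

/-- Compatibility with the gluing. The direction i either survives in the face, possibly with
reversed orientation, or is fixed at one of its two ends, or is not a direction of the cube at all.
-/
theorem cellCoord_map (i : ι) (φ : V i → ℝ) {n m : ℕ} (f : CubeHom (Fin n) (Fin m))
    (c : ProductCube T m) (t : Fin n → CubeHom.I₁) :
    cellCoord i φ ⟨⟨n, (productComplex T).map f c⟩, t⟩ =
      cellCoord (T := T) i φ ⟨⟨m, c⟩, f.appReal t⟩ := by
  let d : ProductCube T n := (productComplex T).map f c
  change interp (φ (d.lo i)) (φ (d.hi i)) (coordParam d t i) =
    interp (φ (c.lo i)) (φ (c.hi i)) (coordParam c (f.appReal t) i)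
  have hd : d.dir = f.σ.trans c.dir := c.dir_map f
  have hh : d.hi i = c.1 (f.app 1) i := rfl
  have hl : d.lo i = c.1 (f.app fun _ => -1) i := rfl
  by_cases h : i ∈ Set.range c.dir
  · obtain ⟨k, rfl⟩ := h
    rw [coordParam_dir]
    by_cases h1 : k ∈ Set.range f.σ
    · obtain ⟨l, rfl⟩ := h1
      have e : coordParam d t (c.dir (f.σ l)) = t l := by
        rw [← coordParam_dir d t l, hd]
        rfl
      have e2 : ((f.appReal t (f.σ l) : CubeHom.I₁) : ℝ) = ((f.ε (f.σ l) : ℤ) : ℝ) * t l := by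
        simp only [CubeHom.appReal, f.σ.injective.extend_apply]
      rw [e, e2, hh, hl, c.apply_dir, c.apply_dir]
      simp only [CubeHom.app, f.σ.injective.extend_apply, Pi.one_apply]
      rcases Int.units_eq_one_or (f.ε (f.σ l)) with h | h <;> rw [h]
      · rw [if_neg (by decide : ¬ (1 : ℤˣ) * -1 = 1), if_pos (by decide : (1 : ℤˣ) * 1 = 1)]
        simp
      · rw [if_pos (by decide : (-1 : ℤˣ) * -1 = 1), if_neg (by decide : ¬ (-1 : ℤˣ) * 1 = 1)]
        unfold interp
        push_cast
        ring
    · have e : c.dir k ∉ Set.range d.dir := by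
        rintro ⟨l, hl⟩
        rw [hd] at hl
        exact h1 ⟨l, c.dir.injective hl⟩
      have e2 : ((f.appReal t k : CubeHom.I₁) : ℝ) = ((f.ε k : ℤ) : ℝ) := by
        simp only [CubeHom.appReal, Function.extend_apply' _ _ _ h1, mul_one]
      rw [d.lo_of_notMem e, interp_self, e2, hh, c.apply_dir]
      simp only [CubeHom.app, Function.extend_apply' _ _ _ h1, Pi.one_apply, mul_one]
      unfold interp
      rcases Int.units_eq_one_or (f.ε k) with h | h <;> rw [h]
      · rw [if_pos rfl]
        push_cast
        ring
      · rw [if_neg (by decide)]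
        push_cast
        ring
  · have e : i ∉ Set.range d.dir := by
      rintro ⟨l, hl⟩
      rw [hd] at hl
      exact h ⟨f.σ l, hl⟩
    rw [d.lo_of_notMem e, c.lo_of_notMem h, interp_self, interp_self, hh, c.apply_of_notMem _ h]

/-- The function on `|∏ T i|` that extends the function `φ` of the vertices of `T i` affinely. -/
def coord (i : ι) (φ : V i → ℝ) : (productComplex T).Realization → ℝ :=
  Quot.lift (cellCoord i φ) (by
    rintro _ _ ⟨f, x, t⟩
    exact cellCoord_map i φ f x t)

theorem coord_point (i : ι) (φ : V i → ℝ) {n : ℕ} (c : ProductCube T n) (t : Fin n → CubeHom.I₁) :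
    coord i φ ((productComplex T).point c t) =
      interp (φ (c.lo i)) (φ (c.hi i)) (coordParam c t i) := rfl

theorem continuous_coord (i : ι) (φ : V i → ℝ) : Continuous (coord (T := T) i φ) := by
  apply continuous_of_point
  intro n c
  change Continuous fun t => interp (φ (ProductCube.lo c i)) (φ (ProductCube.hi c i)) (coordParam c t i)
  unfold interp
  have := continuous_coordParam c i
  fun_prop

/-- A point of `|∏ T i|` with given coordinates in the factors. -/
theorem exists_point [Finite ι] (lo hi : ∀ i, V i) (s : ι → CubeHom.I₁)
    (h : ∀ i, lo i = hi i ∨ (T i).Adj (lo i) (hi i)) :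
    ∃ z : (productComplex T).Realization, ∀ i (φ : V i → ℝ),
      coord i φ z = interp (φ (lo i)) (φ (hi i)) (s i) := by
  classical
  cases nonempty_fintype ι
  -- The directions of the cube are the factors in which the two given ends differ.
  let e := Fintype.equivFin {i // lo i ≠ hi i}
  let σ : Fin (Fintype.card {i // lo i ≠ hi i}) ↪ ι := e.symm.toEmbedding.trans (Function.Embedding.subtype _)
  have hσ : ∀ k, (T (σ k)).Adj (lo (σ k)) (hi (σ k)) := fun k => (h _).resolve_left (e.symm k).2
  let c : ProductCube T _ := ProductCube.mk' σ lo hi hσ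
  refine ⟨(productComplex T).point c (fun k => s (σ k)), fun i φ => ?_⟩
  rw [coord_point]
  by_cases hi' : lo i = hi i
  · have hn : i ∉ Set.range c.dir := by
      rintro ⟨k, rfl⟩
      rw [ProductCube.mk'_dir] at hi'
      exact (hσ k).ne hi'
    rw [c.lo_of_notMem hn, hi', interp_self, interp_self, ProductCube.mk'_hi]
  · obtain ⟨k, rfl⟩ : ∃ k, σ k = i := ⟨e ⟨i, hi'⟩, by simp [σ]⟩
    have hd : c.dir = σ := ProductCube.mk'_dir σ lo hi hσ
    have h1 : coordParam c (fun k => s (σ k)) (σ k) = s (σ k) := by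
      have := coordParam_dir c (fun k => s (σ k)) k
      rwa [hd] at this
    rw [h1, ProductCube.mk'_hi, ProductCube.mk'_lo]

end Coordinates

open Topology

/-! ## Products of rooted trees are contractible -/

/-- If U' is an open neighbourhood of x, the part of K outside U' has a compact, hence closed,
image, which misses f x by injectivity. Removing it from N gives a neighbourhood of f x whose
preimage lies in U'. -/
theorem isEmbedding_of_locally_compact_preimage {X Y : Type*} [TopologicalSpace X]
    [TopologicalSpace Y] [T2Space Y] {f : X → Y} (hf : Continuous f) (hi : Function.Injective f)
    (h : ∀ x, ∃ N ∈ 𝓝 (f x), ∃ K, IsCompact K ∧ f ⁻¹' N ⊆ K) : IsEmbedding f := by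
  refine ⟨isInducing_iff_nhds.2 fun x => le_antisymm (hf.tendsto x).le_comap ?_, hi⟩
  intro U hU
  obtain ⟨U', hU', hU'o, hx⟩ := mem_nhds_iff.1 hU
  obtain ⟨N, hN, K, hK, hNK⟩ := h x
  have hC : IsClosed (f '' (K ∩ U'ᶜ)) := ((hK.inter_right hU'o.isClosed_compl).image hf).isClosed
  refine ⟨N ∩ (f '' (K ∩ U'ᶜ))ᶜ, Filter.inter_mem hN (hC.isOpen_compl.mem_nhds ?_), ?_⟩
  · rintro ⟨y, hy, hyx⟩
    rw [hi hyx] at hy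
    exact hy.2 hx
  · rintro y ⟨hy1, hy2⟩
    by_contra hy
    exact hy2 ⟨y, ⟨hNK hy1, fun h => hy (hU' h)⟩, rfl⟩

/-- The height at which the contraction of a tree cuts off the points above a vertex of depth `n` at the
time `s`. -/
def cutHeight : ℕ → ℝ → ℝ
  | 0, _ => 1
  -- The level n + 1 grows from 0 to 1 while s runs from n/(n+1) to (n+1)/(n+2). A level starts to
  -- grow when the one below is complete, and all levels are complete at s = 1.
  | n + 1, s => max 0 (min 1 ((n + 2) * ((n + 1) * s - n)))

theorem continuous_cutHeight : ∀ n, Continuous (cutHeight n)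
  | 0 => continuous_const
  | n + 1 => by unfold cutHeight; fun_prop

theorem cutHeight_nonneg : ∀ n s, 0 ≤ cutHeight n s
  | 0, _ => zero_le_one
  | _ + 1, _ => le_max_left _ _

theorem cutHeight_succ_pos : ∀ n s, 0 < cutHeight (n + 1) s → cutHeight n s = 1
  | 0, _, _ => rfl
  | n + 1, s, h => by
    simp only [cutHeight, lt_max_iff, lt_min_iff, lt_irrefl, false_or] at h
    have h1 := h.2
    push_cast at h1
    have h0 : (0 : ℝ) ≤ n := n.cast_nonneg
    have h2 : 0 < (n + 1 + 1) * s - (n + 1) := by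
      by_contra h3
      nlinarith
    simp only [cutHeight]
    rw [min_eq_left, max_eq_right zero_le_one]
    nlinarith

theorem cutHeight_one : ∀ n, cutHeight n 1 = 1
  | 0 => rfl
  | n + 1 => by
    have h0 : (0 : ℝ) ≤ n := n.cast_nonneg
    simp only [cutHeight]
    rw [min_eq_left, max_eq_right zero_le_one]
    nlinarith

theorem cutHeight_zero (n : ℕ) : cutHeight (n + 1) 0 = 0 := by
  have h0 : (0 : ℝ) ≤ n := n.cast_nonneg
  simp only [cutHeight]
  rw [max_eq_left]
  exact (min_le_right _ _).trans (by nlinarith)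

section Trees

variable {ι : Type u} {W : ι → Type v} (R : ∀ i, RootedTree (W i))

/-- The product of the rooted trees `R i`. -/
abbrev treeProduct : CubicalSet.{max u v} := productComplex (fun i => (R i).graph)

/-- The height coordinates of a point of a product of rooted trees. -/
def heights (z : (treeProduct R).Realization) (p : Σ i, W i) : ℝ :=
  coord p.1 ((R p.1).ind p.2) z

theorem continuous_heights : Continuous (heights R) :=
  continuous_pi fun _ => continuous_coord _ _

/-- The first point is taken in the interior of a cube c. Then every direction of c is a direction
of c', with the same edge up to orientation, and in the remaining directions of c' the second point
sits at an end. These data are a face map h with h^*c' = c and h_I t = t', so the two points are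
glued. -/
theorem heights_injective : Function.Injective (heights R) := by
  classical
  intro z z' hzz
  obtain ⟨n, c, t, rfl, ht⟩ := CubicalSet.exists_interior _ z
  obtain ⟨⟨⟨n', c'⟩, t'⟩, rfl⟩ := Quot.exists_rep z'
  change heights R ((treeProduct R).point c t) = heights R ((treeProduct R).point c' t') at hzz
  change (treeProduct R).point c t = (treeProduct R).point c' t'
  change ProductCube (fun i => (R i).graph) n at c
  change ProductCube (fun i => (R i).graph) n' at c'
  have e : ∀ i x, interp ((R i).ind x (c.lo i)) ((R i).ind x (c.hi i)) (coordParam c t i) =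
      interp ((R i).ind x (c'.lo i)) ((R i).ind x (c'.hi i)) (coordParam c' t' i) :=
    fun i x => congrFun hzz ⟨i, x⟩
  have hE : ∀ k, (c'.lo (c.dir k) = c.lo (c.dir k) ∧ c'.hi (c.dir k) = c.hi (c.dir k) ∧
      (coordParam c' t' (c.dir k) : ℝ) = t k) ∨ (c'.lo (c.dir k) = c.hi (c.dir k) ∧
      c'.hi (c.dir k) = c.lo (c.dir k) ∧ (coordParam c' t' (c.dir k) : ℝ) = - t k) := by
    intro k
    have := (R (c.dir k)).eq_of_interp_edge (c.adj_dir k) (ht k).1 (ht k).2 (c'.lo_eq_or_adj (c.dir k))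
      (coordParam c' t' (c.dir k)).2.1 (coordParam c' t' (c.dir k)).2.2 (by
        intro x
        rw [← e, coordParam_dir])
    exact this
  have hV : ∀ i, i ∉ Set.range c.dir → (c'.lo i = c'.hi i ∧ c'.hi i = c.hi i) ∨
      (c'.lo i ≠ c'.hi i ∧ (coordParam c' t' i : ℝ) = 1 ∧ c'.hi i = c.hi i) ∨
      (c'.lo i ≠ c'.hi i ∧ (coordParam c' t' i : ℝ) = -1 ∧ c'.lo i = c.hi i) := by
    intro i hi
    refine (R i).eq_of_interp_vertex (c'.lo_eq_or_adj i) (coordParam c' t' i).2.1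
      (coordParam c' t' i).2.2 fun x => ?_
    rw [← e, c.lo_of_notMem hi, interp_self]
  have hκ : ∀ k, ∃ k', c'.dir k' = c.dir k := by
    intro k
    have h1 : c.dir k ∈ Set.range c'.dir := by
      rw [c'.mem_range_dir]
      have := (c.adj_dir k).ne
      rcases hE k with ⟨h1, h2, -⟩ | ⟨h1, h2, -⟩ <;> rw [h1, h2]
      · exact this
      · exact this.symm
    exact h1
  choose κ hκ using hκ
  have hE' : ∀ k, (c'.lo (c'.dir (κ k)) = c.lo (c'.dir (κ k)) ∧
      c'.hi (c'.dir (κ k)) = c.hi (c'.dir (κ k)) ∧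
      (coordParam c' t' (c'.dir (κ k)) : ℝ) = t k) ∨ (c'.lo (c'.dir (κ k)) = c.hi (c'.dir (κ k)) ∧
      c'.hi (c'.dir (κ k)) = c.lo (c'.dir (κ k)) ∧
      (coordParam c' t' (c'.dir (κ k)) : ℝ) = - t k) := by
    intro k
    rw [hκ k]
    exact hE k
  have hκi : Function.Injective κ := fun k l h => c.dir.injective (by rw [← hκ, ← hκ, h])
  -- In a direction of c the sign compares the orientations of the two edges; in any other direction
  -- of c' it tells at which end the vertex of c lies.
  let h : CubeHom (Fin n) (Fin n') :=
    ⟨⟨κ, hκi⟩, fun k' => if c'.hi (c'.dir k') = c.hi (c'.dir k') then 1 else -1⟩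
  have hdir : ∀ k', k' ∉ Set.range κ → c'.dir k' ∉ Set.range c.dir := by
    rintro k' hk ⟨l, hl⟩
    exact hk ⟨l, c'.dir.injective (by rw [hκ, hl])⟩
  have happ : ∀ (a : Fin n → ℤˣ) k, h.app a (κ k) = h.ε (κ k) * a k := by
    intro a k
    have : Function.extend h.σ a 1 (κ k) = a k := h.σ.injective.extend_apply a 1 k
    simp only [CubeHom.app, this]
  have happ' : ∀ (a : Fin n → ℤˣ) k', k' ∉ Set.range κ → h.app a k' = h.ε k' := by
    intro a k' hk'
    have : Function.extend h.σ a 1 k' = 1 := Function.extend_apply' _ _ _ hk'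
    simp only [CubeHom.app, this, mul_one]
  have hmap : (treeProduct R).map h c' = c := by
    apply ProductCube.ext_of (c := (treeProduct R).map h c') (c' := c)
    · rw [ProductCube.dir_map]
      ext k
      exact hκ k
    · funext i
      change c'.1 (h.app 1) i = c.hi i
      by_cases hi : i ∈ Set.range c'.dir
      · obtain ⟨k', rfl⟩ := hi
        rw [c'.apply_dir]
        by_cases hk : k' ∈ Set.range κ
        · obtain ⟨k, rfl⟩ := hk
          rw [happ]
          have h1 := (c'.adj_dir (κ k)).ne
          simp only [h, Pi.one_apply, mul_one] at h1 ⊢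
          rcases hE' k with ⟨h2, h3, -⟩ | ⟨h2, h3, -⟩
          · simp [h3]
          · rw [h2, h3] at h1
            rw [if_neg, h2]
            rw [if_neg (by rw [h3]; exact fun h4 => h1 h4.symm)]
            decide
        · rw [happ' _ _ hk]
          rcases hV _ (hdir k' hk) with ⟨h1, h2⟩ | ⟨h1, h2, h3⟩ | ⟨h1, h2, h3⟩
          · exact absurd h1 (c'.adj_dir k').ne
          · simp [h, h3]
          · rw [h3] at h1
            rw [if_neg, h3]
            simp only [h]
            rw [if_neg (fun h4 => h1 h4.symm)]
            decide
      · rw [c'.apply_of_notMem _ hi]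
        have h0 := c'.lo_of_notMem hi
        have h1 : i ∉ Set.range c.dir := by
          rintro ⟨k, rfl⟩
          exact hi ⟨κ k, hκ k⟩
        rcases hV i h1 with ⟨h1, h2⟩ | ⟨h1, h2, h3⟩ | ⟨h1, h2, h3⟩
        · exact h2
        · exact h3
        · exact absurd h0 h1
    · intro k
      rw [ProductCube.dir_map]
      have h0 : (h.σ.trans c'.dir) k = c.dir k := hκ k
      rw [h0]
      change c'.1 (h.app fun _ => -1) (c.dir k) = c.lo (c.dir k)
      rw [← hκ k, c'.apply_dir, happ]
      have h1 := (c'.adj_dir (κ k)).ne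
      simp only [h] at h1 ⊢
      rcases hE' k with ⟨h2, h3, -⟩ | ⟨h2, h3, -⟩
      · rw [if_neg (by rw [if_pos h3]; decide), h2]
      · rw [h2, h3] at h1
        rw [if_pos (by rw [if_neg (by rw [h3]; exact fun h4 => h1 h4.symm)]; decide), h3]
  have hreal : h.appReal t = t' := by
    funext k'
    apply Subtype.ext
    rw [← coordParam_dir c' t' k']
    by_cases hk : k' ∈ Set.range κ
    · obtain ⟨k, rfl⟩ := hk
      have : Function.extend h.σ t (fun _ => ⟨1, by norm_num⟩) (κ k) = t k :=
        h.σ.injective.extend_apply t _ k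
      simp only [CubeHom.appReal, this]
      have h1 := (c'.adj_dir (κ k)).ne
      simp only [h] at h1 ⊢
      rcases hE' k with ⟨h2, h3, h4⟩ | ⟨h2, h3, h4⟩
      · rw [if_pos h3, h4]
        simp
      · rw [h2, h3] at h1
        rw [if_neg (by rw [h3]; exact fun h4 => h1 h4.symm), h4]
        simp
    · have : Function.extend h.σ t (fun _ => (⟨1, by norm_num⟩ : CubeHom.I₁)) k' = ⟨1, by norm_num⟩ :=
        Function.extend_apply' _ _ _ hk
      simp only [CubeHom.appReal, this, h]
      rcases hV _ (hdir k' hk) with ⟨h1, h2⟩ | ⟨h1, h2, h3⟩ | ⟨h1, h2, h3⟩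
      · exact absurd h1 (c'.adj_dir k').ne
      · rw [if_pos h3, h2]
        simp
      · rw [h3] at h1
        rw [if_neg (fun h4 => h1 h4.symm), h2]
        simp
  exact (congrArg (fun d => (treeProduct R).point d t) hmap.symm).trans
    (((treeProduct R).point_map h c' t).trans (congrArg ((treeProduct R).point c') hreal))

variable [Finite ι] (hfin : ∀ i n, {x | (R i).depth x = n}.Finite)

include hfin

/-- Near a given point all height coordinates at some large depth D are less than 1. This confines
nearby points to cubes with corners of depth at most D, and by local finiteness there are finitely
many of these, with compact union. -/
theorem isEmbedding_heights : IsEmbedding (heights R) := by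
  classical
  cases nonempty_fintype ι
  refine isEmbedding_of_locally_compact_preimage (continuous_heights R) (heights_injective R) ?_
  intro z
  obtain ⟨⟨⟨m, d⟩, s⟩, rfl⟩ := Quot.exists_rep z
  change ProductCube (fun i => (R i).graph) m at d
  obtain ⟨D, hD⟩ : ∃ D, ∀ i, (R i).depth (d.lo i) < D ∧ (R i).depth (d.hi i) < D := by
    obtain ⟨D, hD⟩ := (Set.finite_range fun i => max ((R i).depth (d.lo i)) ((R i).depth (d.hi i))).bddAbove
    refine ⟨D + 1, fun i => ?_⟩
    have := hD ⟨i, rfl⟩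
    simp only [sup_le_iff] at this
    omega
  have hbf : ∀ i n, {x | (R i).depth x ≤ n}.Finite := by
    intro i n
    have : {x | (R i).depth x ≤ n} = ⋃ k ∈ Finset.range (n + 1), {x | (R i).depth x = k} := by
      ext x
      simp
    rw [this]
    exact Set.Finite.biUnion (Finset.finite_toSet _) fun k _ => hfin i k
  let S : ∀ n, Set (ProductCube (fun i => (R i).graph) n) :=
    fun n => {c | ∀ a i, (R i).depth (c.1 a i) ≤ D}
  have hS : ∀ n, (S n).Finite := by
    intro n
    refine Set.Finite.of_finite_image (f := Subtype.val) ?_ Subtype.val_injective.injOn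
    refine Set.Finite.subset (Set.Finite.pi' (fun _ : Fin n → ℤˣ => Set.Finite.pi' fun i => hbf i D)) ?_
    rintro _ ⟨c, hc, rfl⟩ a i
    exact hc a i
  refine ⟨{f | ∀ i, ∀ x ∈ {x | (R i).depth x = D}, f ⟨i, x⟩ < 1}, ?_,
    ⋃ n ∈ Finset.range (Fintype.card ι + 1), ⋃ c ∈ S n, Set.range ((treeProduct R).point c), ?_, ?_⟩
  · have : {f : (Σ i, W i) → ℝ | ∀ i, ∀ x ∈ {x | (R i).depth x = D}, f ⟨i, x⟩ < 1} =
        ⋂ i, ⋂ x ∈ {x | (R i).depth x = D}, {f | f ⟨i, x⟩ < 1} := by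
      ext f
      simp
    rw [this]
    refine IsOpen.mem_nhds (isOpen_iInter_of_finite fun i => (hfin i D).isOpen_biInter fun x _ =>
      isOpen_lt (continuous_apply _) continuous_const) ?_
    simp only [Set.mem_iInter, Set.mem_ofPred_eq]
    intro i x hx
    change interp ((R i).ind x (d.lo i)) ((R i).ind x (d.hi i)) _ < 1
    have h1 : (R i).ind x (d.lo i) = 0 := if_neg fun h => by
      have := h.depth_le
      have := hD i
      omega
    have h2 : (R i).ind x (d.hi i) = 0 := if_neg fun h => by
      have := h.depth_le
      have := hD i
      omega
    rw [h1, h2, interp_self]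
    exact one_pos
  · refine (Finset.finite_toSet _).isCompact_biUnion fun n _ => (hS n).isCompact_biUnion fun c _ => ?_
    exact isCompact_range (f := (treeProduct R).point (n := n) c) ((treeProduct R).continuous_point (n := n) c)
  · intro y hy
    obtain ⟨n, c, t, rfl, ht⟩ := CubicalSet.exists_interior _ y
    change ProductCube (fun i => (R i).graph) n at c
    have hn := c.card_le
    simp only [Set.mem_iUnion, Finset.mem_range]
    refine ⟨n, by omega, c, ?_, Set.mem_range_self _⟩
    have hy' : ∀ i x, (R i).depth x = D →
      interp ((R i).ind x (c.lo i)) ((R i).ind x (c.hi i)) (coordParam c t i) < 1 := hy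
    have key : ∀ i, (R i).depth (c.lo i) ≤ D ∧ (R i).depth (c.hi i) ≤ D := by
      intro i
      by_cases hi : i ∈ Set.range c.dir
      -- An edge with an end of depth greater than D has both ends among the descendants of a vertex
      -- of depth D, at which the height coordinate is then 1.
      · have hone : ∀ {x y : W i}, x ≠ (R i).root → y = (R i).parent x → D < (R i).depth x →
            ∃ w, (R i).depth w = D ∧ (R i).ind w x = 1 ∧ (R i).ind w y = 1 := by
          rintro x y hx rfl hd
          have h1 := (R i).depth_parent x hx
          obtain ⟨w, hw, hwD⟩ := (R i).exists_anc (y := (R i).parent x) (n := D) (by omega)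
          exact ⟨w, hwD, if_pos (((R i).anc_iff w x).2 (Or.inr hw)), if_pos hw⟩
        obtain ⟨k, rfl⟩ := hi
        by_contra hcon
        have : ∃ w, (R (c.dir k)).depth w = D ∧ (R (c.dir k)).ind w (c.hi (c.dir k)) = 1 ∧
            (R (c.dir k)).ind w (c.lo (c.dir k)) = 1 := by
          rcases c.adj_dir k with ⟨h1, h2⟩ | ⟨h1, h2⟩
          · have h3 := (R (c.dir k)).depth_parent_le (c.hi (c.dir k))
            rw [← h2] at h3
            exact hone h1 h2 (by omega)
          · have h3 := (R (c.dir k)).depth_parent_le (c.lo (c.dir k))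
            rw [← h2] at h3
            obtain ⟨w, hw1, hw2, hw3⟩ := hone h1 h2 (by omega)
            exact ⟨w, hw1, hw3, hw2⟩
        obtain ⟨w, hw1, hw2, hw3⟩ := this
        have := hy' _ w hw1
        rw [hw2, hw3, interp_self] at this
        exact lt_irrefl _ this
      · have h0 := c.lo_of_notMem hi
        rw [h0, and_self]
        by_contra hcon
        obtain ⟨w, hw, hwD⟩ := (R i).exists_anc (y := c.hi i) (n := D) (by omega)
        have := hy' _ w hwD
        rw [h0, interp_self, RootedTree.ind, if_pos hw] at this
        exact lt_irrefl _ this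
    intro a i
    rcases c.apply_eq_hi_or_lo a i with h | h <;> rw [h]
    · exact (key i).2
    · exact (key i).1

/-- The contraction cuts the height coordinates off at `cutHeight`, with time reversed: it starts
with the identity and ends at the point given by the roots. Because `heights` is an embedding, joint
continuity in time and point can be checked coordinate by coordinate. -/
theorem contractibleSpace_treeProduct : ContractibleSpace (treeProduct R).Realization := by
  have hemb := isEmbedding_heights R hfin
  have hex : ∀ (z : (treeProduct R).Realization) (s : unitInterval),
      ∃ z', ∀ p, heights R z' p = min (heights R z p) (cutHeight ((R p.1).depth p.2) s) := by
    intro z s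
    obtain ⟨⟨⟨n, c⟩, t⟩, rfl⟩ := Quot.exists_rep z
    change ProductCube (fun i => (R i).graph) n at c
    have := fun i => (R i).exists_truncation (g := fun n => cutHeight n s) (fun n => cutHeight_nonneg n s)
      rfl (fun n => cutHeight_succ_pos n s) (c.lo_eq_or_adj i)
      (coordParam c t i).2.1 (coordParam c t i).2.2
    choose lo hi s' h1 h2 using this
    obtain ⟨z', hz'⟩ := exists_point lo hi s' h1
    exact ⟨z', fun p => (hz' p.1 _).trans (h2 p.1 p.2)⟩
  choose H hH using hex
  have hcont : Continuous fun p : unitInterval × (treeProduct R).Realization =>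
      H p.2 (unitInterval.symm p.1) := by
    rw [hemb.continuous_iff]
    refine continuous_pi fun p => ?_
    simp only [Function.comp_apply, hH]
    refine Continuous.min ((continuous_apply p).comp ((continuous_heights R).comp continuous_snd)) ?_
    exact (continuous_cutHeight _).comp
      (continuous_subtype_val.comp (unitInterval.continuous_symm.comp continuous_fst))
  let z₀ : (treeProduct R).Realization := (treeProduct R).point (n := 0)
    (ProductCube.mk' ⟨Fin.elim0, fun k => k.elim0⟩ (fun i => (R i).root) (fun i => (R i).root)
      (fun k => k.elim0)) Fin.elim0
  rw [contractible_iff_id_nullhomotopic]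
  refine ⟨H z₀ 0, ⟨⟨⟨_, hcont⟩, fun z => ?_, fun z => ?_⟩⟩⟩
  · apply heights_injective R
    funext p
    simp only [hH, unitInterval.symm_zero, ContinuousMap.id_apply]
    rw [min_eq_left]
    rw [Set.Icc.coe_one, cutHeight_one]
    obtain ⟨⟨⟨n, c⟩, t⟩, rfl⟩ := Quot.exists_rep z
    change ProductCube (fun i => (R i).graph) n at c
    change interp ((R p.1).ind p.2 (c.lo p.1)) ((R p.1).ind p.2 (c.hi p.1)) (coordParam c t p.1) ≤ 1
    have h1 := (coordParam c t p.1).2.1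
    have h2 := (coordParam c t p.1).2.2
    have h3 := (R p.1).ind_le_one p.2 (c.lo p.1)
    have h4 := (R p.1).ind_le_one p.2 (c.hi p.1)
    unfold interp
    nlinarith
  · apply heights_injective R
    funext p
    simp only [hH, unitInterval.symm_one, ContinuousMap.const_apply]
    have hnn : ∀ z, 0 ≤ heights R z p := by
      intro z
      obtain ⟨⟨⟨n, c⟩, t⟩, rfl⟩ := Quot.exists_rep z
      change ProductCube (fun i => (R i).graph) n at c
      change 0 ≤ interp ((R p.1).ind p.2 (c.lo p.1)) ((R p.1).ind p.2 (c.hi p.1)) (coordParam c t p.1)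
      have h1 := (coordParam c t p.1).2.1
      have h2 := (coordParam c t p.1).2.2
      have h3 := mul_nonneg (by linarith : (0:ℝ) ≤ 1 + coordParam c t p.1) ((R p.1).ind_nonneg p.2 (c.hi p.1))
      have h4 := mul_nonneg (by linarith : (0:ℝ) ≤ 1 - coordParam c t p.1) ((R p.1).ind_nonneg p.2 (c.lo p.1))
      unfold interp
      linarith
    rw [Set.Icc.coe_zero]
    rcases hd : (R p.1).depth p.2 with _ | n
    · have hp := (R p.1).root_of_depth hd
      have hone : ∀ z, heights R z p = 1 := by
        intro z
        obtain ⟨⟨⟨n, c⟩, t⟩, rfl⟩ := Quot.exists_rep z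
        change ProductCube (fun i => (R i).graph) n at c
        change interp ((R p.1).ind p.2 (c.lo p.1)) ((R p.1).ind p.2 (c.hi p.1)) (coordParam c t p.1) = 1
        have h1 : ∀ y, (R p.1).ind p.2 y = 1 := by
          intro y
          refine if_pos ?_
          obtain ⟨x, hx, hx'⟩ := (R p.1).exists_anc (y := y) (n := 0) (Nat.zero_le _)
          rw [hp]
          rwa [(R p.1).root_of_depth hx'] at hx
        rw [h1, h1, interp_self]
      rw [hone, hone]
    · rw [cutHeight_zero, min_eq_right (hnn _), min_eq_right (hnn _)]

end Trees

/-! ## Quotients of cubical sets by groups and coverings -/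

namespace CubicalSet

section Covering

variable {X : CubicalSet.{u}} {Y : CubicalSet.{v}} {G : Type w} [Group G] (a : G → Hom X X)
variable (ha1 : ∀ n x, (a 1).app n x = x)
variable (ham : ∀ g h n x, (a (g * h)).app n x = (a g).app n ((a h).app n x))

theorem Hom.realize_point (p : Hom X Y) {n : ℕ} (x : X.obj n) (t : Fin n → CubeHom.I₁) :
    p.realize (X.point x t) = Y.point (p.app n x) t := rfl

theorem Hom.continuous_realize (p : Hom X Y) : Continuous p.realize :=
  continuous_of_point X fun _ x => Y.continuous_point (p.app _ x)

/-- The action of a group on the realization of a cubical set on which it acts. -/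
@[reducible]
def realizeAction : MulAction G X.Realization where
  smul g z := (a g).realize z
  one_smul z := by
    obtain ⟨⟨⟨n, x⟩, t⟩, rfl⟩ := Quot.exists_rep z
    exact congrArg (fun y => X.point y t) (ha1 n x)
  mul_smul g h z := by
    obtain ⟨⟨⟨n, x⟩, t⟩, rfl⟩ := Quot.exists_rep z
    exact congrArg (fun y => X.point y t) (ham g h n x)

variable {p : Hom X Y} (hs : ∀ n, Function.Surjective (p.app n))
variable (hp : ∀ n x x', p.app n x = p.app n x' ↔ ∃ g, (a g).app n x = x')

include hs hp ha1 ham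

theorem isQuotientCoveringMap_realize
    (hd : ∀ z, ∃ U ∈ 𝓝 z, ∀ g, (∃ y ∈ U, (a g).realize y ∈ U) → g = 1) :
    letI := realizeAction a ha1 ham
    IsQuotientCoveringMap p.realize G := by
  let := realizeAction a ha1 ham
  choose s hsp using hs
  -- A choice of preimages of cubes gives a map from |Y| to the orbit space of |X|. It is compatible
  -- with the gluing since two preimages of a cube differ by a group element; it shows that points
  -- of |X| with the same image lie in one orbit.
  let q : Y.Realization → MulAction.orbitRel.Quotient G X.Realization :=
    Quot.lift (fun c => Quotient.mk _ (X.point (s c.1.1 c.1.2) c.2)) (by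
      rintro _ _ ⟨f, y, t⟩
      dsimp only
      have h1 : p.app _ (X.map f (s _ y)) = p.app _ (s _ (Y.map f y)) := by
        rw [p.naturality, hsp, hsp]
      obtain ⟨g, hg⟩ := (hp _ _ _).1 h1
      rw [← hg, ← X.point_map]
      apply Quotient.sound
      exact ⟨g, rfl⟩)
  have hq : ∀ z, q (p.realize z) = Quotient.mk _ z := by
    intro z
    obtain ⟨⟨⟨n, x⟩, t⟩, rfl⟩ := Quot.exists_rep z
    have h1 : p.app n x = p.app n (s n (p.app n x)) := (hsp n _).symm
    obtain ⟨g, hg⟩ := (hp _ _ _).1 h1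
    change Quotient.mk _ (X.point (s n (p.app n x)) t) = Quotient.mk _ (X.point x t)
    rw [← hg]
    apply Quotient.sound
    exact ⟨g, rfl⟩
  have hinv : ∀ g z, p.realize ((a g).realize z) = p.realize z := by
    intro g z
    obtain ⟨⟨⟨n, x⟩, t⟩, rfl⟩ := Quot.exists_rep z
    exact congrArg (fun y => Y.point y t) ((hp n x _).2 ⟨g, rfl⟩).symm
  -- Openness is tested on the cubes of Y, each of which lifts to X.
  have hquot : IsQuotientMap p.realize := by
    rw [isQuotientMap_iff, isCoinducing_iff, and_comm]
    refine ⟨fun z => ?_, fun U => ⟨fun h => ?_, fun h => h.preimage p.continuous_realize⟩⟩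
    · obtain ⟨⟨⟨n, y⟩, t⟩, rfl⟩ := Quot.exists_rep z
      refine ⟨X.point (s n y) t, ?_⟩
      rw [Hom.realize_point, hsp]
      rfl
    · refine (isQuotientMap_quot_mk (r := Glue Y)).isOpen_preimage.1 ?_
      rw [isOpen_sigma_iff]
      rintro ⟨n, y⟩
      have h1 := h.preimage (X.continuous_point (s n y))
      have h2 : X.point (s n y) ⁻¹' (p.realize ⁻¹' U) = Y.point y ⁻¹' U := by
        ext t
        rw [Set.mem_preimage, Set.mem_preimage, Hom.realize_point, hsp, Set.mem_preimage]
      rw [h2] at h1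
      exact h1
  refine { toIsQuotientMap := hquot, continuous_const_smul := ?_,
           apply_eq_iff_mem_orbit := ?_, disjoint := ?_ }
  · exact fun g => (a g).continuous_realize
  · intro z z'
    constructor
    · intro h
      have := congrArg q h
      rw [hq, hq] at this
      exact Quotient.exact this
    · rintro ⟨g, rfl⟩
      exact hinv g z'
  · intro z
    obtain ⟨U, hU, hU'⟩ := hd z
    refine ⟨U, hU, fun g => ?_⟩
    rintro ⟨_, ⟨y, hy, rfl⟩, hy'⟩
    exact hU' g ⟨y, hy, hy'⟩

end Covering

end CubicalSet

/-! ## Actions on products of trees -/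

section Maps

variable {ι : Type u} {V : ι → Type v} {V' : ι → Type w} {T : ∀ i, SimpleGraph (V i)}
  {T' : ∀ i, SimpleGraph (V' i)}

theorem ProductCube.dir_productMap (f : ∀ i, T i →g T' i) {n : ℕ} (c : ProductCube T n) :
    ProductCube.dir ((productMap f).app n c : ProductCube T' n) = c.dir := by
  apply DFunLike.coe_injective
  symm
  apply dir_unique
  intro k
  change f _ (c.1 _ _) ≠ f _ (c.1 _ _)
  rw [c.apply_dir, c.apply_dir, Function.update_self, if_neg (by decide), Pi.one_apply, if_pos rfl]
  exact ((f _).map_adj (c.adj_dir k)).ne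

theorem coord_realize_productMap (f : ∀ i, T i →g T' i) (i : ι) (φ : V' i → ℝ)
    (z : (productComplex T).Realization) :
    coord i φ ((productMap f).realize z) = coord i (fun y => φ (f i y)) z := by
  obtain ⟨⟨⟨n, c⟩, t⟩, rfl⟩ := Quot.exists_rep z
  change ProductCube T n at c
  change interp (φ (f i (c.lo i))) (φ (f i (c.hi i)))
    (coordParam ((productMap f).app n c : ProductCube T' n) t i) =
    interp (φ (f i (c.lo i))) (φ (f i (c.hi i))) (coordParam c t i)
  simp only [coordParam, ProductCube.dir_productMap]

open Classical in
/-- The barycentric coordinate of points of `∏ T i` at a vertex of `T i`. -/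
def bary (i : ι) (x : V i) : (productComplex T).Realization → ℝ :=
  coord i (fun y => if y = x then 1 else 0)

theorem continuous_bary (i : ι) (x : V i) : Continuous (bary (T := T) i x) := continuous_coord _ _

theorem bary_point (i : ι) (x : V i) {n : ℕ} (c : ProductCube T n) (t : Fin n → CubeHom.I₁) :
    open Classical in bary i x ((productComplex T).point c t) =
      interp (if c.lo i = x then 1 else 0) (if c.hi i = x then 1 else 0) (coordParam c t i) := rfl

theorem bary_realize (f : ∀ i, T i ≃g T i) (i : ι) (x : V i) (z : (productComplex T).Realization) :
    bary i (f i x) ((productMap fun i => (f i : T i →g T i)).realize z) = bary i x z := by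
  unfold bary
  rw [coord_realize_productMap]
  congr 1
  funext y
  by_cases h : y = x
  · subst h
    exact (if_pos rfl).trans (if_pos rfl).symm
  · exact (if_neg fun e => h ((f i).injective e)).trans (if_neg h).symm

/-- The barycentric coordinates of a point in one factor have sum 1, so at most one of them exceeds
1/2. -/
theorem eq_of_half_lt_bary {i : ι} {x y : V i} {z : (productComplex T).Realization}
    (hx : 1 / 2 < bary i x z) (hy : 1 / 2 < bary i y z) : x = y := by
  obtain ⟨⟨⟨n, c⟩, t⟩, rfl⟩ := Quot.exists_rep z
  change ProductCube T n at c
  change 1 / 2 < bary i x ((productComplex T).point c t) at hx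
  change 1 / 2 < bary i y ((productComplex T).point c t) at hy
  rw [bary_point] at hx hy
  by_contra h
  have h1 := (coordParam c t i).2.1
  have h2 := (coordParam c t i).2.2
  unfold interp at hx hy
  split_ifs at hx hy <;> first | linarith | simp_all

/-- The vertices at which a point has positive barycentric coordinates are the ends of an edge. -/
theorem exists_ends_of_bary (i : ι) (z : (productComplex T).Realization) :
    ∃ lo hi : V i, (lo = hi ∨ (T i).Adj lo hi) ∧ (∀ x, 0 < bary i x z → x = lo ∨ x = hi) ∧
      (lo ≠ hi → bary i lo z + bary i hi z = 1) ∧ (lo = hi → bary i lo z = 1) := by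
  obtain ⟨⟨⟨n, c⟩, t⟩, rfl⟩ := Quot.exists_rep z
  change ProductCube T n at c
  refine ⟨c.lo i, c.hi i, c.lo_eq_or_adj i, fun x hx => ?_, fun h => ?_, fun h => ?_⟩
  · change 0 < bary i x ((productComplex T).point c t) at hx
    rw [bary_point] at hx
    by_contra hcon
    rw [not_or] at hcon
    rw [if_neg (Ne.symm hcon.1), if_neg (Ne.symm hcon.2), interp_self] at hx
    exact lt_irrefl _ hx
  · change bary i _ ((productComplex T).point c t) + bary i _ ((productComplex T).point c t) = 1
    rw [bary_point, bary_point]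
    simp only [if_true, if_neg h, if_neg h.symm, interp]
    ring
  · change bary i _ ((productComplex T).point c t) = 1
    rw [bary_point]
    simp only [if_true, h, interp_self]

/-- If an automorphism group of a product of graphs contains no nontrivial element that preserves a
cube, its action on the realization is properly discontinuous. -/
theorem exists_disjoint_nhds [Finite ι] {G : Type*} [One G] (ρ : G → ∀ i, T i ≃g T i)
    (hstab : ∀ g, (∀ i, ∃ x y, (x = y ∨ (T i).Adj x y) ∧
      ((ρ g i x = x ∧ ρ g i y = y) ∨ (ρ g i x = y ∧ ρ g i y = x))) → g = 1)
    (z : (productComplex T).Realization) : ∃ U ∈ 𝓝 z, ∀ g,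
      (∃ y ∈ U, (productMap fun i => (ρ g i : T i →g T i)).realize y ∈ U) → g = 1 := by
  -- In each factor, either a vertex has coordinate greater than 1/2 and is fixed by every element
  -- that returns a point of the neighbourhood to it, or the point is the midpoint of an edge, and
  -- then this edge is preserved.
  have hloc : ∀ i, ∃ U ∈ 𝓝 z, ∀ g,
      (∃ y ∈ U, (productMap fun i => (ρ g i : T i →g T i)).realize y ∈ U) →
      ∃ x y, (x = y ∨ (T i).Adj x y) ∧
        ((ρ g i x = x ∧ ρ g i y = y) ∨ (ρ g i x = y ∧ ρ g i y = x)) := by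
    intro i
    have hbig : ∀ x, 1 / 2 < bary i x z → ∃ U ∈ 𝓝 z, ∀ g,
        (∃ y ∈ U, (productMap fun i => (ρ g i : T i →g T i)).realize y ∈ U) →
        ∃ x y, (x = y ∨ (T i).Adj x y) ∧
        ((ρ g i x = x ∧ ρ g i y = y) ∨ (ρ g i x = y ∧ ρ g i y = x)) := by
      intro x hx
      refine ⟨{z | 1 / 2 < bary i x z},
        (isOpen_lt continuous_const (continuous_bary i x)).mem_nhds hx, ?_⟩
      rintro g ⟨y, hy, hy'⟩
      have h1 : ρ g i x = x := by
        refine eq_of_half_lt_bary ?_ hy'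
        rw [bary_realize (ρ g)]
        exact hy
      exact ⟨x, x, Or.inl rfl, Or.inl ⟨h1, h1⟩⟩
    obtain ⟨lo, hi, h1, h2, h3, h4⟩ := exists_ends_of_bary i z
    by_cases h5 : 1 / 2 < bary i lo z
    · exact hbig lo h5
    by_cases h6 : 1 / 2 < bary i hi z
    · exact hbig hi h6
    have hne : lo ≠ hi := fun h => by
      rw [h4 h] at h5
      norm_num at h5
    have h7 := h3 hne
    refine ⟨{z | 1 / 3 < bary i lo z} ∩ {z | 1 / 3 < bary i hi z},
        ((isOpen_lt continuous_const (continuous_bary i lo)).inter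
        (isOpen_lt continuous_const (continuous_bary i hi))).mem_nhds ?_, ?_⟩
    · constructor <;> rw [Set.mem_ofPred_eq] <;> linarith
    · rintro g ⟨y, ⟨hy1, hy2⟩, hy3, hy4⟩
      rw [Set.mem_ofPred_eq] at hy1 hy2 hy3 hy4
      refine ⟨lo, hi, h1, ?_⟩
      -- The ends lo, hi and their images under g all have positive coordinates at the translated
      -- point, so all four lie in {lo', hi'}.
      obtain ⟨lo', hi', -, g2, -, -⟩ := exists_ends_of_bary (T := T) i
        ((productMap fun i => (ρ g i : T i →g T i)).realize y)
      rw [← bary_realize (ρ g)] at hy1 hy2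
      have e1 := g2 _ (lt_trans (by norm_num) hy1)
      have e2 := g2 _ (lt_trans (by norm_num) hy2)
      have e3 := g2 _ (lt_trans (by norm_num) hy3)
      have e4 := g2 _ (lt_trans (by norm_num) hy4)
      have e5 : ρ g i lo ≠ ρ g i hi := fun h => hne ((ρ g i).injective h)
      grind
  choose U hU hU' using hloc
  refine ⟨⋂ i, U i, (Filter.iInter_mem).2 hU, fun g => ?_⟩
  rintro ⟨y, hy, hy'⟩
  rw [Set.mem_iInter] at hy hy'
  exact hstab g fun i => hU' i g ⟨y, hy i, hy' i⟩

end Maps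

/-! ## Letters and reduced words -/

/-- An alphabet with involution whose letters have types. -/
structure LetterSystem (I : Type*) (L : Type*) where
  ty : L → I
  inv : L → L
  inv_inv : ∀ a, inv (inv a) = a
  ty_inv : ∀ a, ty (inv a) = ty a

namespace LetterSystem

variable {I : Type u} {L : Type v} (S : LetterSystem I L)

/-- `l` is a reduced word in the letters of type `i`. -/
def IsWord (i : I) (l : List L) : Prop :=
  l.IsChain (fun a b => b ≠ S.inv a) ∧ ∀ a ∈ l, S.ty a = i

/-- The reduced words in the letters of type `i`. -/
abbrev Word (i : I) : Type v := {l : List L // S.IsWord i l}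

theorem isWord_nil (i : I) : S.IsWord i [] := ⟨List.IsChain.nil, by simp⟩

theorem isWord_singleton (a : L) : S.IsWord (S.ty a) [a] := ⟨List.IsChain.singleton _, by simp⟩

theorem IsWord.tail {S : LetterSystem I L} {i : I} {a : L} {l : List L} (h : S.IsWord i (a :: l)) :
    S.IsWord i l := ⟨h.1.tail, fun b hb => h.2 b (List.mem_cons_of_mem a hb)⟩

theorem IsWord.prefix {S : LetterSystem I L} {i : I} {l l' : List L} (h : S.IsWord i l)
    (hl : l' <+: l) : S.IsWord i l' := ⟨h.1.prefix hl, fun b hb => h.2 b (hl.subset hb)⟩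

open Classical in
/-- Multiplication of a reduced word by a letter from the left. -/
def consRed (a : L) : List L → List L
  | [] => [a]
  | b :: l => if b = S.inv a then l else a :: b :: l

theorem consRed_inv_cons (a : L) (l : List L) : S.consRed a (S.inv a :: l) = l := if_pos rfl

theorem consRed_of_isChain {a : L} {l : List L} (h : (a :: l).IsChain (fun a b => b ≠ S.inv a)) :
    S.consRed a l = a :: l := by
  cases l with
  | nil => rfl
  | cons b l => exact if_neg (List.isChain_cons_cons.1 h).1

theorem isWord_consRed {i : I} {a : L} {l : List L} (ha : S.ty a = i) (h : S.IsWord i l) :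
    S.IsWord i (S.consRed a l) := by
  cases l with
  | nil => exact ⟨List.IsChain.singleton _, by simpa [consRed] using ha⟩
  | cons b l =>
    by_cases hb : b = S.inv a
    · rw [hb, consRed_inv_cons]
      exact h.tail
    · rw [consRed, if_neg hb]
      refine ⟨List.isChain_cons_cons.2 ⟨hb, h.1⟩, ?_⟩
      intro c hc
      rcases List.mem_cons.1 hc with rfl | hc
      · exact ha
      · exact h.2 c hc

theorem consRed_inv_consRed {i : I} {a : L} {l : List L} (h : S.IsWord i l) :
    S.consRed (S.inv a) (S.consRed a l) = l := by
  cases l with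
  | nil => exact if_pos (S.inv_inv a).symm
  | cons b l =>
    by_cases hb : b = S.inv a
    · rw [hb, consRed_inv_cons]
      apply S.consRed_of_isChain
      rw [← hb]
      exact h.1
    · rw [consRed, if_neg hb]
      exact if_pos (S.inv_inv a).symm

/-- The tree of reduced words in the letters of type `i`. -/
def wordTree (i : I) : RootedTree (S.Word i) where
  root := ⟨[], S.isWord_nil i⟩
  -- The parent drops the last letter, so that multiplication from the left is an automorphism of
  -- the tree.
  parent w := ⟨w.1.dropLast, w.2.prefix (List.dropLast_prefix _)⟩
  depth w := w.1.length
  depth_root := rfl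
  parent_root := rfl
  depth_parent w hw := by
    have : w.1 ≠ [] := fun h => hw (Subtype.ext h)
    have := List.length_pos_iff.2 this
    simp only [List.length_dropLast]
    omega

theorem wordTree_adj {i : I} {w w' : S.Word i} : (S.wordTree i).graph.Adj w w' ↔
    (∃ a, w'.1 = w.1 ++ [a]) ∨ ∃ a, w.1 = w'.1 ++ [a] := by
  have key : ∀ w w' : S.Word i, (w' ≠ (S.wordTree i).root ∧ w = (S.wordTree i).parent w') ↔
      ∃ a, w'.1 = w.1 ++ [a] := by
    intro w w'
    constructor
    · rintro ⟨h1, rfl⟩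
      have : w'.1 ≠ [] := fun h => h1 (Subtype.ext h)
      exact ⟨w'.1.getLast this, (List.dropLast_append_getLast this).symm⟩
    · rintro ⟨a, ha⟩
      constructor
      · rintro rfl
        have h2 : ([] : List L) = w.1 ++ [a] := ha
        simp at h2
      · apply Subtype.ext
        change w.1 = w'.1.dropLast
        rw [ha, List.dropLast_concat]
  rw [RootedTree.adj_iff, key, key]

theorem finite_depth [Finite L] (i : I) (n : ℕ) : {w | (S.wordTree i).depth w = n}.Finite := by
  refine Set.Finite.of_finite_image (f := Subtype.val) ?_ Subtype.val_injective.injOn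
  refine (List.finite_length_eq L n).subset ?_
  rintro _ ⟨w, hw, rfl⟩
  exact hw

/-! ### Groups generated by letters -/

section Generators

variable {G : Type w} [Group G] (gen : L → G)

/-- The product of a word in a group. -/
def wordProd (l : List L) : G := (l.map gen).prod

@[simp] theorem wordProd_nil : wordProd gen [] = 1 := rfl

@[simp] theorem wordProd_cons (a : L) (l : List L) : wordProd gen (a :: l) = gen a * wordProd gen l :=
  List.prod_cons

@[simp] theorem wordProd_append (l l' : List L) :
    wordProd gen (l ++ l') = wordProd gen l * wordProd gen l' := by
  simp [wordProd]

variable {gen} (hinv : ∀ a, gen (S.inv a) = (gen a)⁻¹)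

include hinv

theorem wordProd_consRed (a : L) (l : List L) :
    wordProd gen (S.consRed a l) = gen a * wordProd gen l := by
  cases l with
  | nil => rfl
  | cons b l =>
    by_cases hb : b = S.inv a
    · rw [hb, consRed_inv_cons, wordProd_cons, hinv, mul_inv_cancel_left]
    · rw [consRed, if_neg hb, wordProd_cons]

theorem exists_isWord {i : I} (l : List L) (h : ∀ a ∈ l, S.ty a = i) :
    ∃ l', S.IsWord i l' ∧ wordProd gen l' = wordProd gen l := by
  induction l with
  | nil => exact ⟨[], S.isWord_nil i, rfl⟩
  | cons a l ih =>
    obtain ⟨l', h1, h2⟩ := ih fun b hb => h b (List.mem_cons_of_mem a hb)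
    exact ⟨S.consRed a l', S.isWord_consRed (h a List.mem_cons_self) h1, by
      rw [S.wordProd_consRed hinv, h2, wordProd_cons]⟩

theorem exists_wordProd (hgen : Subgroup.closure (Set.range gen) = ⊤) (g : G) :
    ∃ l, g = wordProd gen l := by
  have hg : g ∈ Subgroup.closure (Set.range gen) := hgen ▸ Subgroup.mem_top g
  induction hg using Subgroup.closure_induction_left with
  | one => exact ⟨[], rfl⟩
  | mul_left x hx y hy ih =>
    obtain ⟨a, rfl⟩ := hx
    obtain ⟨l, rfl⟩ := ih
    exact ⟨a :: l, by rw [wordProd_cons]⟩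
  | inv_mul_cancel x hx y hy ih =>
    obtain ⟨a, rfl⟩ := hx
    obtain ⟨l, rfl⟩ := ih
    exact ⟨S.inv a :: l, by rw [wordProd_cons, hinv]⟩

omit hinv

variable (hex : ∀ a b, S.ty a ≠ S.ty b → ∃ b' a', S.ty b' = S.ty b ∧ S.ty a' = S.ty a ∧
  gen a * gen b = gen b' * gen a')

include hex

/-- The letter moves to the right by one exchange after the other. It changes on the way, as do the
letters it passes, but all types are kept. -/
theorem exists_push {s : Set I} {a : L} (ha : S.ty a ∉ s) (l : List L) (hl : ∀ b ∈ l, S.ty b ∈ s) :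
    ∃ l' a', (∀ b ∈ l', S.ty b ∈ s) ∧ S.ty a' = S.ty a ∧
      gen a * wordProd gen l = wordProd gen l' * gen a' := by
  induction l generalizing a with
  | nil => exact ⟨[], a, by simp, rfl, by simp⟩
  | cons b l ih =>
    have hb := hl b List.mem_cons_self
    obtain ⟨b', a', h1, h2, h3⟩ := hex a b (fun h => ha (h ▸ hb))
    obtain ⟨l', a'', h4, h5, h6⟩ := ih (a := a') (by rw [h2]; exact ha)
      fun c hc => hl c (List.mem_cons_of_mem b hc)
    refine ⟨b' :: l', a'', ?_, h5.trans h2, ?_⟩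
    · intro c hc
      rcases List.mem_cons.1 hc with rfl | hc
      · rw [h1]
        exact hb
      · exact h4 c hc
    · rw [wordProd_cons, wordProd_cons, ← mul_assoc, h3, mul_assoc, h6, mul_assoc]

/-- The letters of type i are collected on the right by pushing each of them through the part of the
word that has the other types. -/
theorem exists_split {s : Set I} {i : I} (hi : i ∉ s) (l : List L)
    (hl : ∀ a ∈ l, S.ty a ∈ insert i s) :
    ∃ l₁ l₂, (∀ a ∈ l₁, S.ty a ∈ s) ∧ (∀ a ∈ l₂, S.ty a = i) ∧
      wordProd gen l = wordProd gen l₁ * wordProd gen l₂ := by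
  induction l with
  | nil => exact ⟨[], [], by simp, by simp, by simp⟩
  | cons a l ih =>
    obtain ⟨l₁, l₂, h1, h2, h3⟩ := ih fun b hb => hl b (List.mem_cons_of_mem a hb)
    rcases hl a List.mem_cons_self with ha | ha
    · obtain ⟨l₁', a', h4, h5, h6⟩ := S.exists_push hex (ha ▸ hi) l₁ h1
      refine ⟨l₁', a' :: l₂, h4, ?_, ?_⟩
      · intro c hc
        rcases List.mem_cons.1 hc with rfl | hc
        · exact h5.trans ha
        · exact h2 c hc
      · rw [wordProd_cons, h3, ← mul_assoc, h6, wordProd_cons, mul_assoc]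
    · refine ⟨a :: l₁, l₂, ?_, h2, ?_⟩
      · intro c hc
        rcases List.mem_cons.1 hc with rfl | hc
        · exact ha
        · exact h1 c hc
      · rw [wordProd_cons, h3, wordProd_cons, mul_assoc]

variable {V : I → Type*} {T : ∀ i, SimpleGraph (V i)} (ρ : G →* ∀ i, T i ≃g T i) (x : ∀ i, V i)
variable (hfix : ∀ a i, S.ty a ≠ i → ρ (gen a) i (x i) = x i)

omit hex in
include hfix in
theorem wordProd_fix {i : I} (l : List L) (hl : ∀ a ∈ l, S.ty a ≠ i) :
    ρ (wordProd gen l) i (x i) = x i := by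
  induction l with
  | nil => simp
  | cons a l ih =>
    rw [wordProd_cons, map_mul]
    change ρ (gen a) i (ρ (wordProd gen l) i (x i)) = x i
    rw [ih fun b hb => hl b (List.mem_cons_of_mem a hb), hfix a i (hl a List.mem_cons_self)]

include hinv hfix in
/-- If the reduced words in the letters of one type move the base point, the action is free. -/
theorem eq_one_of_fix [Finite I]
    (hfree : ∀ i l, S.IsWord i l → l ≠ [] → ρ (wordProd gen l) i (x i) ≠ x i)
    (l : List L) (hl : ∀ i, ρ (wordProd gen l) i (x i) = x i) : wordProd gen l = 1 := by
  classical
  cases nonempty_fintype I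
  -- Induction on the set of types that occur. In the sorted form l₁l₂ with l₂ of type i, the factor
  -- l₂ fixes the base points of the types in s, so l₁ fixes them too and is trivial by induction.
  -- What remains is a word of one type, which must reduce to the empty word.
  have key : ∀ (s : Finset I) (l : List L), (∀ a ∈ l, S.ty a ∈ (s : Set I)) →
      (∀ i ∈ s, ρ (wordProd gen l) i (x i) = x i) → wordProd gen l = 1 := by
    intro s
    induction s using Finset.induction_on with
    | empty =>
      intro l hl _
      cases l with
      | nil => rfl
      | cons a l => exact absurd (hl a List.mem_cons_self) (by simp)
    | insert i s hi ih =>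
      intro l hl hl'
      rw [Finset.coe_insert] at hl
      obtain ⟨l₁, l₂, h1, h2, h3⟩ := S.exists_split hex (s := (s : Set I)) (by simpa using hi) l hl
      have h4 : wordProd gen l₁ = 1 := by
        refine ih l₁ h1 fun j hj => ?_
        have h5 := hl' j (Finset.mem_insert_of_mem hj)
        rw [h3, map_mul] at h5
        change ρ (wordProd gen l₁) j (ρ (wordProd gen l₂) j (x j)) = x j at h5
        rwa [S.wordProd_fix ρ x hfix l₂ fun a ha => by
          rw [h2 a ha]; rintro rfl; exact hi hj] at h5
      rw [h4, one_mul] at h3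
      obtain ⟨l₂', h5, h6⟩ := S.exists_isWord hinv l₂ h2
      rw [h3, ← h6]
      by_contra hne
      refine hfree i l₂' h5 ?_ ?_
      · rintro rfl
        exact hne rfl
      · rw [h6, ← h3]
        exact hl' i (Finset.mem_insert_self i s)
  exact key Finset.univ l (by simp) fun i _ => hl i

omit hex in
include hfix in
/-- If the letters of each type generate a group that is transitive on the vertices of the factor of
that type, the action is transitive. -/
theorem exists_translate [Finite I]
    (htrans : ∀ i (y : V i), ∃ l : List L, (∀ a ∈ l, S.ty a = i) ∧ ρ (wordProd gen l) i (x i) = y)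
    (y : ∀ i, V i) : ∃ g : G, ∀ i, ρ g i (x i) = y i := by
  classical
  cases nonempty_fintype I
  have key : ∀ s : Finset I, ∃ g : G, ∀ i ∈ s, ρ g i (x i) = y i := by
    intro s
    induction s using Finset.induction_on with
    | empty => exact ⟨1, by simp⟩
    | insert i s hi ih =>
      obtain ⟨g, hg⟩ := ih
      -- A word of type i multiplied from the right corrects the component i and leaves the
      -- components already reached unchanged, since it fixes their base points.
      obtain ⟨l, h1, h2⟩ := htrans i (ρ g⁻¹ i (y i))
      refine ⟨g * wordProd gen l, fun j hj => ?_⟩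
      rw [map_mul]
      change ρ g j (ρ (wordProd gen l) j (x j)) = y j
      rcases Finset.mem_insert.1 hj with rfl | hj
      · rw [h2]
        change (ρ g * ρ g⁻¹) j (y j) = y j
        rw [← map_mul]
        simp
      · rw [S.wordProd_fix ρ x hfix l fun a ha => by
          rw [h1 a ha]; rintro rfl; exact hi hj]
        exact hg j hj
  obtain ⟨g, hg⟩ := key Finset.univ
  exact ⟨g, fun i => hg i (Finset.mem_univ i)⟩

end Generators

end LetterSystem

namespace LetterSystem

variable {I : Type u} {L : Type v} (S : LetterSystem I L)

/-! ### The action of letters on words in the letters of another type -/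

/-- A realization of the letters in a group `M`, such that letters of different types can be
exchanged, with subgroups `stab i` (the stabilizers of base points) that separate the letters. -/
structure ExchangeData (M : Type w) [Group M] where
  val : L → M
  val_inv : ∀ a, val (S.inv a) = (val a)⁻¹
  exchange : ∀ a b, S.ty a ≠ S.ty b → ∃ b' a', S.ty b' = S.ty b ∧ S.ty a' = S.ty a ∧
    val a * val b = val b' * val a'
  stab : I → Subgroup M
  val_mem : ∀ a i, S.ty a ≠ i → val a ∈ stab i
  separated : ∀ a a', S.ty a = S.ty a' → (val a)⁻¹ * val a' ∈ stab (S.ty a) → a = a'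

namespace ExchangeData

variable {S} {M : Type w} [Group M] (E : S.ExchangeData M)

/-- A letter can be read off from its left coset modulo the stabilizer of its type. All uniqueness
statements about exchanges rest on this. -/
theorem eq_of_mul_eq {a a' : L} {m m' : M} (h : S.ty a = S.ty a') (hm : m ∈ E.stab (S.ty a))
    (hm' : m' ∈ E.stab (S.ty a)) (e : E.val a * m = E.val a' * m') : a = a' := by
  refine E.separated a a' h ?_
  have : (E.val a)⁻¹ * E.val a' = m * m'⁻¹ := by
    rw [inv_mul_eq_iff_eq_mul, ← mul_assoc, e, mul_inv_cancel_right]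
  rw [this]
  exact Subgroup.mul_mem _ hm (Subgroup.inv_mem _ hm')

theorem val_injective {a a' : L} (h : S.ty a = S.ty a') (e : E.val a = E.val a') : a = a' :=
  E.eq_of_mul_eq h (Subgroup.one_mem _) (Subgroup.one_mem _) (by rw [e])

/-- `a` and `b` are letters of different types, and `ab = b'a'`. -/
def IsSquare (a b b' a' : L) : Prop :=
  S.ty a ≠ S.ty b ∧ S.ty b' = S.ty b ∧ S.ty a' = S.ty a ∧ E.val a * E.val b = E.val b' * E.val a'

variable {E}

/-- The relation ab = b'a' is the boundary of a square; `symm`, `rotate` and `inv_left` read the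
same square from other corners. -/
theorem IsSquare.symm {a b b' a' : L} (h : E.IsSquare a b b' a') : E.IsSquare b' a' a b :=
  ⟨by rw [h.2.1, h.2.2.1]; exact h.1.symm, h.2.2.1.symm, h.2.1.symm, h.2.2.2.symm⟩

theorem IsSquare.rotate {a b b' a' : L} (h : E.IsSquare a b b' a') :
    E.IsSquare b (S.inv a') (S.inv a) b' := by
  refine ⟨?_, ?_, h.2.1, ?_⟩
  · rw [S.ty_inv, h.2.2.1]
    exact h.1.symm
  · rw [S.ty_inv, S.ty_inv, h.2.2.1]
  · rw [E.val_inv, E.val_inv, eq_inv_mul_iff_mul_eq, ← mul_assoc, h.2.2.2, mul_inv_cancel_right]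

theorem IsSquare.inv_left {a b b' a' : L} (h : E.IsSquare a b b' a') :
    E.IsSquare (S.inv a) b' b (S.inv a') := by
  refine ⟨?_, h.2.1.symm, ?_, ?_⟩
  · rw [S.ty_inv, h.2.1]
    exact h.1
  · rw [S.ty_inv, S.ty_inv, h.2.2.1]
  · rw [E.val_inv, E.val_inv, inv_mul_eq_iff_eq_mul, ← mul_assoc, h.2.2.2, mul_inv_cancel_right]

/-- The letters a' and a'' have a type different from that of b', so they lie in the stabilizer that
separates the letters of the type of b'. This gives b' = b'', and then a' = a'' by cancellation. -/
theorem IsSquare.unique {a b b' a' b'' a'' : L} (h : E.IsSquare a b b' a')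
    (h' : E.IsSquare a b b'' a'') : b' = b'' ∧ a' = a'' := by
  have e : b' = b'' := by
    refine E.eq_of_mul_eq (h.2.1.trans h'.2.1.symm) (E.val_mem a' _ ?_) (E.val_mem a'' _ ?_)
      (h.2.2.2.symm.trans h'.2.2.2)
    · rw [h.2.1, h.2.2.1]
      exact h.1
    · rw [h.2.1, h'.2.2.1]
      exact h.1
  subst e
  exact ⟨rfl, E.val_injective (h.2.2.1.trans h'.2.2.1.symm)
    (mul_left_cancel (h.2.2.2.symm.trans h'.2.2.2))⟩

variable (E)

theorem exists_isSquare {a b : L} (h : S.ty a ≠ S.ty b) : ∃ p : L × L, E.IsSquare a b p.1 p.2 := by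
  obtain ⟨b', a', h1, h2, h3⟩ := E.exchange a b h
  exact ⟨(b', a'), h, h1, h2, h3⟩

open Classical in
/-- The pair `(b', a')` with `ab = b'a'`, for letters of different types. -/
def swap (a b : L) : L × L :=
  if h : S.ty a ≠ S.ty b then (E.exists_isSquare h).choose else (b, a)

theorem isSquare_swap {a b : L} (h : S.ty a ≠ S.ty b) :
    E.IsSquare a b (E.swap a b).1 (E.swap a b).2 := by
  rw [swap, dif_pos h]
  exact (E.exists_isSquare h).choose_spec

/-- The action of a letter on words in the letters of another type. -/
def push : L → List L → List L
  | _, [] => []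
  | b, a :: l => (E.swap b a).1 :: push (E.swap b a).2 l

/-- The state of the automaton `push` after reading the word. -/
def pushState : L → List L → L
  | b, [] => b
  | b, a :: l => pushState (E.swap b a).2 l

theorem push_append (b : L) (l l' : List L) :
    E.push b (l ++ l') = E.push b l ++ E.push (E.pushState b l) l' := by
  induction l generalizing b with
  | nil => rfl
  | cons a l ih =>
    rw [List.cons_append, push, push, pushState, ih]
    rfl

theorem push_cons {a b b' a' : L} (h : E.IsSquare b a a' b') (l : List L) :
    E.push b (a :: l) = a' :: E.push b' l := by
  obtain ⟨e1, e2⟩ := (E.isSquare_swap h.1).unique h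
  rw [push, e1, e2]

section

variable {i : I}

theorem ty_push {b : L} (hb : S.ty b ≠ i) {l : List L} (hl : ∀ a ∈ l, S.ty a = i) :
    ∀ a ∈ E.push b l, S.ty a = i := by
  induction l generalizing b with
  | nil => simp [push]
  | cons a l ih =>
    have ha := hl a List.mem_cons_self
    have h := E.isSquare_swap (a := b) (b := a) (by rwa [ha])
    intro c hc
    rw [push] at hc
    rcases List.mem_cons.1 hc with rfl | hc
    · rw [h.2.1, ha]
    · exact ih (by rwa [h.2.2.1]) (fun d hd => hl d (List.mem_cons_of_mem a hd)) c hc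

theorem ty_pushState {b : L} (hb : S.ty b ≠ i) {l : List L} (hl : ∀ a ∈ l, S.ty a = i) :
    S.ty (E.pushState b l) = S.ty b := by
  induction l generalizing b with
  | nil => rfl
  | cons a l ih =>
    have ha := hl a List.mem_cons_self
    have h := E.isSquare_swap (a := b) (b := a) (by rwa [ha])
    rw [pushState, ih (by rwa [h.2.2.1]) fun d hd => hl d (List.mem_cons_of_mem a hd), h.2.2.1]

theorem val_mul_wordProd {b : L} (hb : S.ty b ≠ i) {l : List L} (hl : ∀ a ∈ l, S.ty a = i) :
    E.val b * wordProd E.val l = wordProd E.val (E.push b l) * E.val (E.pushState b l) := by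
  induction l generalizing b with
  | nil => simp [push, pushState]
  | cons a l ih =>
    have ha := hl a List.mem_cons_self
    have h := E.isSquare_swap (a := b) (b := a) (by rwa [ha])
    rw [wordProd_cons, ← mul_assoc, h.2.2.2, mul_assoc, ih (by rwa [h.2.2.1])
      fun d hd => hl d (List.mem_cons_of_mem a hd), push, pushState, wordProd_cons, mul_assoc]

/-- Letters that are exchanged to mutually inverse letters are mutually inverse. -/
theorem eq_inv_of_swap {b a₁ a₂ a₁' b' b'' : L} (h₁ : E.IsSquare b a₁ a₁' b')
    (h₂ : E.IsSquare b' a₂ (S.inv a₁') b'') : a₂ = S.inv a₁ := by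
  have h5 : E.IsSquare b' (S.inv a₁) (S.inv a₁') b := by
    refine ⟨?_, ?_, ?_, ?_⟩
    · rw [S.ty_inv, h₁.2.2.1]
      exact h₁.1
    · rw [S.ty_inv, S.ty_inv, h₁.2.1]
    · rw [h₁.2.2.1]
    · rw [E.val_inv, E.val_inv, mul_inv_eq_iff_eq_mul, mul_assoc, h₁.2.2.2, inv_mul_cancel_left]
  -- Both sides equal `(E.val b')⁻¹ * E.val (S.inv a₁')`.
  have e : E.val (S.inv a₁) * (E.val b)⁻¹ = E.val a₂ * (E.val b'')⁻¹ := by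
    have e1 : E.val (S.inv a₁) = (E.val b')⁻¹ * (E.val (S.inv a₁') * E.val b) := by
      rw [← h5.2.2.2, inv_mul_cancel_left]
    have e2 : E.val a₂ = (E.val b')⁻¹ * (E.val (S.inv a₁') * E.val b'') := by
      rw [← h₂.2.2.2, inv_mul_cancel_left]
    rw [e1, e2]
    group
  have t : S.ty (S.inv a₁) = S.ty a₂ := by
    rw [S.ty_inv, ← h₂.2.1, S.ty_inv, h₁.2.1]
  refine (E.eq_of_mul_eq t (Subgroup.inv_mem _ (E.val_mem _ _ ?_))
    (Subgroup.inv_mem _ (E.val_mem _ _ ?_)) e).symm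
  · rw [S.ty_inv]
    exact h₁.1
  · rw [S.ty_inv, h₂.2.2.1, h₁.2.2.1]
    exact h₁.1

/-- A cancellation between neighbouring letters of the pushed word would come from a cancellation in
the original word, by `eq_inv_of_swap`. -/
theorem isWord_push {b : L} (hb : S.ty b ≠ i) {l : List L} (hl : S.IsWord i l) :
    S.IsWord i (E.push b l) := by
  refine ⟨?_, E.ty_push hb hl.2⟩
  induction l generalizing b with
  | nil => exact List.IsChain.nil
  | cons a l ih =>
    have ha := hl.2 a List.mem_cons_self
    have h := E.isSquare_swap (a := b) (b := a) (by rwa [ha])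
    have h1 := ih (b := (E.swap b a).2) (by rwa [h.2.2.1]) hl.tail
    cases l with
    | nil => exact List.IsChain.singleton _
    | cons a₂ l =>
      have ha₂ := hl.2 a₂ (by simp)
      have h2 := E.isSquare_swap (a := (E.swap b a).2) (b := a₂) (by rwa [h.2.2.1, ha₂])
      rw [push, push]
      rw [push] at h1
      refine List.isChain_cons_cons.2 ⟨fun hcon => ?_, h1⟩
      rw [hcon] at h2
      exact (List.isChain_cons_cons.1 hl.1).1 (E.eq_inv_of_swap h h2)

theorem push_inv_push {b : L} (hb : S.ty b ≠ i) {l : List L} (hl : ∀ a ∈ l, S.ty a = i) :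
    E.push (S.inv b) (E.push b l) = l := by
  induction l generalizing b with
  | nil => rfl
  | cons a l ih =>
    have ha := hl a List.mem_cons_self
    have h := E.isSquare_swap (a := b) (b := a) (by rwa [ha])
    rw [push, E.push_cons h.inv_left, ih (by rwa [h.2.2.1])
      fun d hd => hl d (List.mem_cons_of_mem a hd)]

/-- The square relation between b and c continues through the word. For its first letter a, both
orders of exchange write the product bca as a letter of type i times two letters of other types.
Separation shows that the letters of type i agree, and cancelling them leaves a square with which
the induction goes on. -/
theorem push_push {b c c' b' : L} (h : E.IsSquare b c c' b') (hb : S.ty b ≠ i) (hc : S.ty c ≠ i)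
    {l : List L} (hl : ∀ a ∈ l, S.ty a = i) :
    E.push b (E.push c l) = E.push c' (E.push b' l) := by
  induction l generalizing b c c' b' with
  | nil => rfl
  | cons a l ih =>
    have ha := hl a List.mem_cons_self
    have h1 := E.isSquare_swap (a := c) (b := a) (by rwa [ha])
    have h2 := E.isSquare_swap (a := b) (b := (E.swap c a).1) (by rwa [h1.2.1, ha])
    have h3 := E.isSquare_swap (a := b') (b := a) (by rwa [ha, h.2.2.1])
    have h4 := E.isSquare_swap (a := c') (b := (E.swap b' a).1) (by rwa [h3.2.1, ha, h.2.1])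
    rw [E.push_cons h1, E.push_cons h2, E.push_cons h3, E.push_cons h4]
    set a₁ := (E.swap c a).1
    set c₁ := (E.swap c a).2
    set a₂ := (E.swap b a₁).1
    set b₁ := (E.swap b a₁).2
    set α₁ := (E.swap b' a).1
    set b₁' := (E.swap b' a).2
    set α₂ := (E.swap c' α₁).1
    set c₁' := (E.swap c' α₁).2
    have e : E.val a₂ * (E.val b₁ * E.val c₁) = E.val α₂ * (E.val c₁' * E.val b₁') := by
      rw [← mul_assoc, ← h2.2.2.2, mul_assoc, ← h1.2.2.2, ← mul_assoc, h.2.2.2, mul_assoc, h3.2.2.2,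
        ← mul_assoc, h4.2.2.2, mul_assoc]
    have t2 : S.ty a₂ = i := by rw [h2.2.1, h1.2.1, ha]
    have t2' : S.ty α₂ = i := by rw [h4.2.1, h3.2.1, ha]
    have tb : S.ty b₁ = S.ty b := h2.2.2.1
    have tc : S.ty c₁ = S.ty c := h1.2.2.1
    have tb' : S.ty b₁' = S.ty b := h3.2.2.1.trans h.2.2.1
    have tc' : S.ty c₁' = S.ty c := h4.2.2.1.trans h.2.1
    have e2 : a₂ = α₂ := by
      refine E.eq_of_mul_eq (t2.trans t2'.symm) (Subgroup.mul_mem _ (E.val_mem _ _ ?_) (E.val_mem _ _ ?_))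
        (Subgroup.mul_mem _ (E.val_mem _ _ ?_) (E.val_mem _ _ ?_)) e
      · rwa [t2, tb]
      · rwa [t2, tc]
      · rwa [t2, tc']
      · rwa [t2, tb']
    rw [e2] at e
    rw [e2, ih (b := b₁) (c := c₁) (c' := c₁') (b' := b₁') ⟨by rw [tb, tc]; exact h.1, tc'.trans tc.symm,
      tb'.trans tb.symm, mul_left_cancel e⟩ (by rwa [tb]) (by rwa [tc])
      fun d hd => hl d (List.mem_cons_of_mem a hd)]

/-- The mixed case of the square relation, in which one letter multiplies the word and the other is
pushed through it. The point is that a cancellation with the first letter takes place on one side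
exactly if it takes place on the other. -/
theorem consRed_push {a b b' a' : L} (h : E.IsSquare a b b' a') (ha : S.ty a = i) {l : List L}
    (hl : S.IsWord i l) : S.consRed a (E.push b l) = E.push b' (S.consRed a' l) := by
  have h5 : E.IsSquare b (S.inv a') (S.inv a) b' := h.rotate
  cases l with
  | nil =>
    rw [push, consRed, consRed, E.push_cons h.symm]
    rfl
  | cons a₂ l =>
    by_cases h2 : a₂ = S.inv a'
    · rw [h2, consRed_inv_cons, E.push_cons h5, consRed_inv_cons]
    · have ha₂ := hl.2 a₂ List.mem_cons_self
      have hb : S.ty b ≠ i := ha ▸ h.1.symm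
      have h3 := E.isSquare_swap (a := b) (b := a₂) (by rwa [ha₂])
      rw [consRed, if_neg h2, E.push_cons h.symm]
      apply S.consRed_of_isChain
      rw [push]
      refine List.isChain_cons_cons.2 ⟨fun hcon => ?_, ?_⟩
      · rw [hcon] at h3
        have := E.eq_inv_of_swap h.symm h3
        exact h2 this
      · have := (E.isWord_push hb hl).1
        rwa [push] at this

end

open Classical in
/-- The action of a letter on the reduced words of type `i`. -/
def letterAct (b : L) (i : I) (w : S.Word i) : S.Word i :=
  if h : S.ty b = i then ⟨S.consRed b w.1, S.isWord_consRed h w.2⟩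
  else ⟨E.push b w.1, E.isWord_push h w.2⟩

theorem letterAct_of_eq {b : L} {i : I} (h : S.ty b = i) (w : S.Word i) :
    (E.letterAct b i w).1 = S.consRed b w.1 := by rw [letterAct, dif_pos h]

theorem letterAct_of_ne {b : L} {i : I} (h : S.ty b ≠ i) (w : S.Word i) :
    (E.letterAct b i w).1 = E.push b w.1 := by rw [letterAct, dif_neg h]

theorem letterAct_inv (b : L) (i : I) (w : S.Word i) :
    E.letterAct (S.inv b) i (E.letterAct b i w) = w := by
  apply Subtype.ext
  by_cases h : S.ty b = i
  · rw [E.letterAct_of_eq (by rwa [S.ty_inv]), E.letterAct_of_eq h, S.consRed_inv_consRed w.2]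
  · rw [E.letterAct_of_ne (by rwa [S.ty_inv]), E.letterAct_of_ne h, E.push_inv_push h w.2.2]

/-- The action changes words from the left and a final letter stays a final letter. The only
exception is the edge from the empty word to the inverse of b, which is mapped to the edge between b
and the empty word with the roles of parent and child reversed. -/
theorem letterAct_adj (b : L) (i : I) {w w' : S.Word i} (h : (S.wordTree i).graph.Adj w w') :
    (S.wordTree i).graph.Adj (E.letterAct b i w) (E.letterAct b i w') := by
  have key : ∀ w w' : S.Word i, (∃ a, w'.1 = w.1 ++ [a]) →
      (S.wordTree i).graph.Adj (E.letterAct b i w) (E.letterAct b i w') := by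
    rintro w w' ⟨a, ha⟩
    rw [wordTree_adj]
    by_cases h : S.ty b = i
    · simp only [E.letterAct_of_eq h]
      rw [ha]
      cases hw : w.1 with
      | nil =>
        by_cases hab : a = S.inv b
        · right
          refine ⟨b, ?_⟩
          rw [hab, List.nil_append, consRed_inv_cons]
          rfl
        · left
          refine ⟨a, ?_⟩
          rw [List.nil_append]
          exact if_neg hab
      | cons c l =>
        left
        refine ⟨a, ?_⟩
        rw [List.cons_append]
        by_cases hc : c = S.inv b
        · rw [hc, consRed_inv_cons, consRed_inv_cons]
        · rw [consRed, if_neg hc, consRed, if_neg hc]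
          rfl
    · simp only [E.letterAct_of_ne h]
      rw [ha, push_append]
      exact Or.inl ⟨_, rfl⟩
  rcases wordTree_adj S |>.1 h with h | h
  · exact key w w' h
  · exact (key w' w h).symm

/-- The action of a letter on the tree of reduced words of type `i`. -/
def letterIso (b : L) (i : I) : (S.wordTree i).graph ≃g (S.wordTree i).graph where
  toFun := E.letterAct b i
  invFun := E.letterAct (S.inv b) i
  left_inv := E.letterAct_inv b i
  right_inv w := by
    have := E.letterAct_inv (S.inv b) i w
    rwa [S.inv_inv] at this
  map_rel_iff' := by
    intro w w'
    refine ⟨fun h => ?_, E.letterAct_adj b i⟩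
    have := E.letterAct_adj (S.inv b) i h
    simpa only [Equiv.coe_fn_mk, E.letterAct_inv] using this

theorem letterIso_mul_inv (b : L) : E.letterIso b * E.letterIso (S.inv b) = 1 := by
  funext i
  apply RelIso.ext
  intro w
  have := E.letterAct_inv (S.inv b) i w
  rw [S.inv_inv] at this
  exact this

/-- The relations from squares hold for the action on words; with `letterIso_mul_inv` this makes the
presented group act. The cases are: a has type i, b has type i, or neither does. -/
theorem letterIso_mul {a b b' a' : L} (h : E.IsSquare a b b' a') :
    E.letterIso a * E.letterIso b = E.letterIso b' * E.letterIso a' := by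
  funext i
  apply RelIso.ext
  intro w
  change E.letterAct a i (E.letterAct b i w) = E.letterAct b' i (E.letterAct a' i w)
  apply Subtype.ext
  have h1 := h.2.1
  have h2 := h.2.2.1
  by_cases ha : S.ty a = i
  · have hb : S.ty b ≠ i := ha ▸ h.1.symm
    rw [E.letterAct_of_eq ha, E.letterAct_of_ne hb, E.letterAct_of_ne (by rwa [h1]),
      E.letterAct_of_eq (by rwa [h2])]
    exact E.consRed_push h ha w.2
  · by_cases hb : S.ty b = i
    · rw [E.letterAct_of_ne ha, E.letterAct_of_eq hb, E.letterAct_of_eq (by rwa [h1]),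
        E.letterAct_of_ne (by rwa [h2])]
      exact (E.consRed_push h.symm (h1.trans hb) w.2).symm
    · rw [E.letterAct_of_ne ha, E.letterAct_of_ne hb, E.letterAct_of_ne (by rwa [h1]),
        E.letterAct_of_ne (by rwa [h2])]
      exact E.push_push h ha hb w.2.2

end ExchangeData

end LetterSystem

namespace LetterSystem

variable {I : Type u} {L : Type v} {S : LetterSystem I L}

namespace ExchangeData

variable {M : Type w} [Group M] (E : S.ExchangeData M)

/-! ### Groups acting on products of trees of words -/

/-- A group `G` over `M` that is generated by letters with the relations of `E`, and acts on words
as the letters do. -/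
structure Lift (G : Type*) [Group G] where
  gen : L → G
  closure_range : Subgroup.closure (Set.range gen) = ⊤
  gen_inv : ∀ a, gen (S.inv a) = (gen a)⁻¹
  gen_mul : ∀ a b b' a', E.IsSquare a b b' a' → gen a * gen b = gen b' * gen a'
  wordAct : G →* ∀ i, (S.wordTree i).graph ≃g (S.wordTree i).graph
  wordAct_gen : ∀ a, wordAct (gen a) = E.letterIso a
  toM : G →* M
  toM_gen : ∀ a, toM (gen a) = E.val a

variable {E} {G : Type*} [Group G] (P : E.Lift G)

namespace Lift

/-- The empty words. -/
def root (S : LetterSystem I L) (i : I) : S.Word i := ⟨[], S.isWord_nil i⟩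

theorem wordAct_gen_apply (a : L) (i : I) (w : S.Word i) :
    P.wordAct (P.gen a) i w = E.letterAct a i w := by
  rw [P.wordAct_gen]
  rfl

theorem wordAct_mul (g h : G) (i : I) (w : S.Word i) :
    P.wordAct (g * h) i w = P.wordAct g i (P.wordAct h i w) := by
  rw [map_mul]
  rfl

theorem wordAct_gen_root {a : L} {i : I} (h : S.ty a ≠ i) :
    P.wordAct (P.gen a) i (root S i) = root S i := by
  rw [wordAct_gen_apply]
  apply Subtype.ext
  rw [E.letterAct_of_ne h]
  rfl

theorem wordAct_gen_root_self (a : L) :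
    P.wordAct (P.gen a) (S.ty a) (root S (S.ty a)) = ⟨[a], S.isWord_singleton a⟩ := by
  rw [wordAct_gen_apply]
  apply Subtype.ext
  rw [E.letterAct_of_eq rfl]
  rfl

theorem wordAct_wordProd {i : I} {l : List L} (hl : S.IsWord i l) :
    P.wordAct (wordProd P.gen l) i (root S i) = ⟨l, hl⟩ := by
  induction l with
  | nil =>
    rw [wordProd_nil, map_one]
    rfl
  | cons a l ih =>
    rw [wordProd_cons, wordAct_mul, ih hl.tail, wordAct_gen_apply]
    apply Subtype.ext
    rw [E.letterAct_of_eq (hl.2 a List.mem_cons_self)]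
    exact S.consRed_of_isChain hl.1

theorem exists_gen_mul (a b : L) (h : S.ty a ≠ S.ty b) : ∃ b' a', S.ty b' = S.ty b ∧
    S.ty a' = S.ty a ∧ P.gen a * P.gen b = P.gen b' * P.gen a' := by
  have hs := E.isSquare_swap h
  exact ⟨_, _, hs.2.1, hs.2.2.1, P.gen_mul _ _ _ _ hs⟩

/-- A reduced word of type i maps the empty word to itself read as a vertex, so a nonempty one moves
the root. Sorting by types extends this to all of G; together with `exists_root` the action is
simply transitive on vertices. -/
theorem eq_one_of_root [Finite I] {g : G} (h : ∀ i, P.wordAct g i (root S i) = root S i) : g = 1 := by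
  obtain ⟨l, rfl⟩ := S.exists_wordProd P.gen_inv P.closure_range g
  refine S.eq_one_of_fix P.gen_inv P.exists_gen_mul P.wordAct (root S)
    (fun a i hai => P.wordAct_gen_root hai) ?_ l h
  intro i l hl hne heq
  rw [P.wordAct_wordProd hl] at heq
  exact hne (congrArg Subtype.val heq)

theorem exists_root [Finite I] (y : ∀ i, S.Word i) :
    ∃ g : G, ∀ i, P.wordAct g i (root S i) = y i :=
  S.exists_translate P.wordAct (root S) (fun _ _ hai => P.wordAct_gen_root hai)
    (fun _ y => ⟨y.1, y.2.2, P.wordAct_wordProd y.2⟩) y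

theorem exists_to_root [Finite I] (y : ∀ i, S.Word i) :
    ∃ g : G, ∀ i, P.wordAct g i (y i) = root S i := by
  obtain ⟨g, hg⟩ := P.exists_root y
  refine ⟨g⁻¹, fun i => ?_⟩
  rw [← hg, ← wordAct_mul, inv_mul_cancel, map_one]
  rfl

theorem eq_one_of_fix [Finite I] {g : G} (y : ∀ i, S.Word i) (h : ∀ i, P.wordAct g i (y i) = y i) :
    g = 1 := by
  obtain ⟨k, hk⟩ := P.exists_root y
  have : k⁻¹ * g * k = 1 := by
    refine P.eq_one_of_root fun i => ?_
    rw [wordAct_mul, wordAct_mul, hk, h, ← hk, ← wordAct_mul, inv_mul_cancel, map_one]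
    rfl
  rwa [mul_eq_one_iff_eq_inv, inv_mul_eq_iff_eq_mul, mul_inv_cancel] at this

end Lift

/-! ### Equivariant maps from trees of words -/

section WordMap

variable {V : I → Type*} {T : ∀ i, SimpleGraph (V i)} (r : M →* ∀ i, T i ≃g T i) (x : ∀ i, V i)

/-- The map from words to vertices given by the orbit of the base point. -/
def orbitMap (E : S.ExchangeData M) (i : I) (w : S.Word i) : V i := r (wordProd E.val w.1) i (x i)

variable (hadj : ∀ a, (T (S.ty a)).Adj (x (S.ty a)) (r (E.val a) (S.ty a) (x (S.ty a))))

include hadj in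
theorem orbitMap_adj {i : I} {w w' : S.Word i} (h : (S.wordTree i).graph.Adj w w') :
    (T i).Adj (orbitMap r x E i w) (orbitMap r x E i w') := by
  have key : ∀ w w' : S.Word i, (∃ a, w'.1 = w.1 ++ [a]) →
      (T i).Adj (orbitMap r x E i w) (orbitMap r x E i w') := by
    rintro w w' ⟨a, ha⟩
    have hi : S.ty a = i := w'.2.2 a (by rw [ha]; simp)
    subst hi
    rw [orbitMap, orbitMap, ha, wordProd_append, map_mul]
    change (T (S.ty a)).Adj _ (r (wordProd E.val w.1) (S.ty a) (r (wordProd E.val [a]) (S.ty a) (x (S.ty a))))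
    rw [(r (wordProd E.val w.1) (S.ty a)).map_adj_iff]
    simpa using hadj a
  rcases wordTree_adj S |>.1 h with h | h
  · exact key w w' h
  · exact (key w' w h).symm

/-- `orbitMap` as a homomorphism of graphs. -/
def wordMap (i : I) : (S.wordTree i).graph →g T i where
  toFun := orbitMap r x E i
  map_rel' := orbitMap_adj r x hadj

theorem wordMap_root (i : I) : wordMap r x hadj i (Lift.root S i) = x i := by
  change r (wordProd E.val []) i (x i) = x i
  rw [wordProd_nil, map_one]
  rfl

theorem wordMap_singleton (a : L) :
    wordMap r x hadj (S.ty a) ⟨[a], S.isWord_singleton a⟩ = r (E.val a) (S.ty a) (x (S.ty a)) := by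
  change r (wordProd E.val [a]) _ _ = _
  simp

variable (hstab : ∀ i, ∀ m ∈ E.stab i, r m i (x i) = x i)

include hstab

/-- If b has another type than the word w, then bw equals the pushed word times the final state of
the letter. That state still has a type different from i and fixes the base point. -/
theorem wordMap_letterAct (b : L) (i : I) (w : S.Word i) :
    wordMap r x hadj i (E.letterAct b i w) = r (E.val b) i (wordMap r x hadj i w) := by
  change r (wordProd E.val _) i (x i) = r (E.val b) i (r (wordProd E.val w.1) i (x i))
  by_cases h : S.ty b = i
  · rw [E.letterAct_of_eq h, S.wordProd_consRed E.val_inv, map_mul]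
    rfl
  · have h2 : r (E.val b) i (r (wordProd E.val w.1) i (x i)) =
        r (E.val b * wordProd E.val w.1) i (x i) := by
      rw [map_mul]
      rfl
    rw [E.letterAct_of_ne h, h2, E.val_mul_wordProd h w.2.2, map_mul]
    change _ = r (wordProd E.val (E.push b w.1)) i (r (E.val (E.pushState b w.1)) i (x i))
    rw [hstab i _ (E.val_mem _ _ (by rwa [E.ty_pushState h w.2.2]))]

theorem wordMap_wordAct (g : G) (i : I) (w : S.Word i) :
    wordMap r x hadj i (P.wordAct g i w) = r (P.toM g) i (wordMap r x hadj i w) := by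
  obtain ⟨l, rfl⟩ := S.exists_wordProd P.gen_inv P.closure_range g
  induction l with
  | nil =>
    rw [wordProd_nil, map_one, map_one, map_one]
    rfl
  | cons a l ih =>
    rw [wordProd_cons, P.wordAct_mul, P.wordAct_gen_apply, wordMap_letterAct r x hadj hstab, ih,
      map_mul, map_mul, P.toM_gen]
    rfl

end WordMap

/-- The values alternate along edges, so the value at the root determines all others. Hence the two
projections of a word have the same folding. -/
theorem hom_unitEdge_eq {i : I} (f : (S.wordTree i).graph →g unitEdge)
    (h : f (Lift.root S i) = 1) (w : S.Word i) : f w = (-1) ^ w.1.length := by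
  obtain ⟨l, hl⟩ := w
  induction l using List.reverseRecOn with
  | nil => exact h
  | append_singleton l a ih =>
    have hl' : S.IsWord i l := hl.prefix (List.prefix_append l [a])
    have h1 : (S.wordTree i).graph.Adj ⟨l, hl'⟩ ⟨l ++ [a], hl⟩ :=
      (wordTree_adj S).2 (Or.inl ⟨a, rfl⟩)
    have h2 : f ⟨l, hl'⟩ ≠ f ⟨l ++ [a], hl⟩ := f.map_adj h1
    rw [ih hl'] at h2
    have key : ∀ s t : ℤˣ, s ≠ t → t = s * (-1) := by decide
    change f _ = (-1) ^ (l ++ [a]).length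
    rw [key _ _ h2, List.length_append, pow_add]
    simp

end ExchangeData

end LetterSystem

/-! ## The double as a quotient of a product of trees -/

theorem quot_eq_iff {X : Type*} {G : Type*} [Group G] (f : G → X → X) (h1 : ∀ x, f 1 x = x)
    (hm : ∀ g h x, f (g * h) x = f g (f h x)) {x y : X} :
    Quot.mk (fun x y => ∃ g, f g x = y) x = Quot.mk (fun x y => ∃ g, f g x = y) y ↔
      ∃ g, f g x = y := by
  have he : Equivalence (fun x y => ∃ g, f g x = y) := by
    refine ⟨fun x => ⟨1, h1 x⟩, ?_, ?_⟩
    · rintro x _ ⟨g, rfl⟩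
      exact ⟨g⁻¹, by rw [← hm, inv_mul_cancel, h1]⟩
    · rintro x _ _ ⟨g, rfl⟩ ⟨h, rfl⟩
      exact ⟨h * g, hm h g x⟩
  exact ⟨fun h => he.eqvGen_iff.1 (Quot.eqvGen_exact h), fun h => Quot.sound h⟩

section Act

variable {ι : Type u} {V : ι → Type v} {T : ∀ i, SimpleGraph (V i)} {Γ : Type w} [Group Γ]
variable (ρ : Γ →* ∀ i, T i ≃g T i)

theorem act_one (n : ℕ) (c : (productComplex T).obj n) : (act ρ 1).app n c = c := by
  apply Subtype.ext
  funext a i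
  change ρ 1 i (c.1 a i) = c.1 a i
  rw [map_one]
  rfl

theorem act_mul (g h : Γ) (n : ℕ) (c : (productComplex T).obj n) :
    (act ρ (g * h)).app n c = (act ρ g).app n ((act ρ h).app n c) := by
  apply Subtype.ext
  funext a i
  change ρ (g * h) i (c.1 a i) = ρ g i (ρ h i (c.1 a i))
  rw [map_mul]
  rfl

variable (hT : ∀ i, (T i).IsTree) (x : ∀ i, V i)

/-- The image in the double of a pair of cubes with the same folding. -/
def doubleMk {n : ℕ} (c c' : (productComplex T).obj n)
    (h : (productFolding hT x).app n c = (productFolding hT x).app n c') : (double hT x ρ).obj n :=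
  Quot.mk _ ⟨(Quot.mk _ c, Quot.mk _ c'), h⟩

theorem doubleMk_surjective {n : ℕ} (y : (double hT x ρ).obj n) :
    ∃ c c' h, y = doubleMk ρ hT x (n := n) c c' h := by
  obtain ⟨⟨⟨⟨c⟩, ⟨c'⟩⟩, h⟩⟩ := y
  exact ⟨c, c', h, rfl⟩

theorem typeCover_mk_eq_iff {n : ℕ} {c d : (productComplex T).obj n} :
    (Quot.mk _ c : (typeCover hT x ρ).obj n) = Quot.mk _ d ↔
      ∃ g : Γ, typeMap hT x ρ g = 1 ∧ (act ρ g).app n c = d := by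
  refine (quot_eq_iff (fun g : typeKernel hT x ρ => (act ρ (g : Γ)).app n)
    (fun c => act_one ρ n c) (fun g h c => act_mul ρ g h n c)).trans ?_
  exact ⟨fun ⟨g, hg⟩ => ⟨g, g.2, hg⟩, fun ⟨g, hg, h⟩ => ⟨⟨g, hg⟩, h⟩⟩

/-- The type of an element can be read off from a single vertex and its image. -/
theorem typeMap_eq_of_folding {n : ℕ} {c d : (productComplex T).obj n} {g : Γ}
    (h : (act ρ g).app n c = d) (i : ι) : typeMap hT x ρ g i =
      folding (hT i) (x i) (ProductCube.hi d i) * (folding (hT i) (x i) (ProductCube.hi c i))⁻¹ := by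
  subst h
  rw [eq_mul_inv_iff_mul_eq]
  exact (folding_act hT x ρ g i (ProductCube.hi c i)).symm

theorem folding_hi {n : ℕ} {c d : (productComplex T).obj n}
    (h : (productFolding hT x).app n c = (productFolding hT x).app n d) (i : ι) :
    folding (hT i) (x i) (ProductCube.hi c i) = folding (hT i) (x i) (ProductCube.hi d i) :=
  congrFun (congrFun (congrArg Subtype.val h) 1) i

/-- The two components may be translated independently. Since the pairs have equal foldings, the
translating elements g and g' have the same type, so g'g⁻¹ lies in Γ₀ and the two translations
amount to the diagonal action of g followed by an element of Γ₀ on the second component. -/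
theorem doubleMk_eq_iff {n : ℕ} {c c' d d' : (productComplex T).obj n} (h h') :
    doubleMk ρ hT x c c' h = doubleMk ρ hT x d d' h' ↔
      ∃ g g' : Γ, (act ρ g).app n c = d ∧ (act ρ g').app n c' = d' := by
  refine (quot_eq_iff (fun g : Γ => (fibreProductAct hT x ρ g).app n) ?_ ?_).trans ?_
  · rintro ⟨⟨⟨c⟩, ⟨c'⟩⟩, h⟩
    apply Subtype.ext
    exact Prod.ext (congrArg (Quot.mk _) (act_one ρ n c)) (congrArg (Quot.mk _) (act_one ρ n c'))
  · rintro g g' ⟨⟨⟨c⟩, ⟨c'⟩⟩, h⟩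
    apply Subtype.ext
    exact Prod.ext (congrArg (Quot.mk _) (act_mul ρ g g' n c))
      (congrArg (Quot.mk _) (act_mul ρ g g' n c'))
  constructor
  · rintro ⟨g, hg⟩
    have h1 : (Quot.mk _ ((act ρ g).app n c) : (typeCover hT x ρ).obj n) = Quot.mk _ d :=
      congrArg (fun p => p.1.1) hg
    have h2 : (Quot.mk _ ((act ρ g).app n c') : (typeCover hT x ρ).obj n) = Quot.mk _ d' :=
      congrArg (fun p => p.1.2) hg
    obtain ⟨k, -, hk⟩ := (typeCover_mk_eq_iff ρ hT x).1 h1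
    obtain ⟨k', -, hk'⟩ := (typeCover_mk_eq_iff ρ hT x).1 h2
    exact ⟨k * g, k' * g, by rw [act_mul, hk], by rw [act_mul, hk']⟩
  · rintro ⟨g, g', hg, hg'⟩
    have e : typeMap hT x ρ g = typeMap hT x ρ g' := by
      funext i
      rw [typeMap_eq_of_folding ρ hT x hg, typeMap_eq_of_folding ρ hT x hg', folding_hi hT x h,
        folding_hi hT x h']
    refine ⟨g, ?_⟩
    apply Subtype.ext
    refine Prod.ext (congrArg (Quot.mk _) hg) ?_
    refine (typeCover_mk_eq_iff ρ hT x).2 ⟨g' * g⁻¹, ?_, ?_⟩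
    · rw [map_mul, map_inv, e, mul_inv_cancel]
    · rw [← act_mul, inv_mul_cancel_right, hg']

theorem dir_eq_of_folding {n : ℕ} {c d : ProductCube T n}
    (h : (productFolding hT x).app n c = (productFolding hT x).app n d) : c.dir = d.dir := by
  rw [← ProductCube.dir_productMap (fun i => folding (hT i) (x i)) c,
    ← ProductCube.dir_productMap (fun i => folding (hT i) (x i)) d]
  exact congrArg ProductCube.dir h

end Act

/-- A group acting simply transitively and without `2`-torsion on a product of trees, with letters
that are the pairs of elements that map the base point to neighbours in the same direction. -/
structure DoubleData {ι : Type u} {V : ι → Type v} {T : ∀ i, SimpleGraph (V i)} {Γ : Type w} [Group Γ]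
    (x : ∀ i, V i) (ρ : Γ →* ∀ i, T i ≃g T i) {L : Type*} {S : LetterSystem ι L}
    (E : S.ExchangeData (Γ × Γ)) : Prop where
  adj_fst : ∀ a, (T (S.ty a)).Adj (x (S.ty a)) (ρ (E.val a).1 (S.ty a) (x (S.ty a)))
  adj_snd : ∀ a, (T (S.ty a)).Adj (x (S.ty a)) (ρ (E.val a).2 (S.ty a) (x (S.ty a)))
  mem_stab : ∀ i m, m ∈ E.stab i ↔ ρ m.1 i (x i) = x i ∧ ρ m.2 i (x i) = x i
  neighbour : ∀ i y y', (T i).Adj (x i) y → (T i).Adj (x i) y' →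
    ∃ a, S.ty a = i ∧ ρ (E.val a).1 i (x i) = y ∧ ρ (E.val a).2 i (x i) = y'
  torsion : ∀ g : Γ, g * g = 1 → g = 1
  transitive : ∀ y : ∀ i, V i, ∃ g, ∀ i, ρ g i (x i) = y i
  free : ∀ g, (∀ i, ρ g i (x i) = x i) → g = 1
  exists_letter : ∀ i, ∃ a, S.ty a = i

/-! ### The map from the product of the trees of words to the double -/

namespace DoubleData

open LetterSystem ExchangeData

variable {ι : Type u} {V : ι → Type v} {T : ∀ i, SimpleGraph (V i)} {Γ : Type w} [Group Γ]
variable {x : ∀ i, V i} {ρ : Γ →* ∀ i, T i ≃g T i} {L : Type*} {S : LetterSystem ι L}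
variable {E : S.ExchangeData (Γ × Γ)} (D : DoubleData x ρ E)

/-- The map from words to vertices given by the first components of the letters. -/
def fst (i : ι) : (S.wordTree i).graph →g T i :=
  wordMap (E := E) (ρ.comp (MonoidHom.fst Γ Γ)) x D.adj_fst i

/-- The map from words to vertices given by the second components of the letters. -/
def snd (i : ι) : (S.wordTree i).graph →g T i :=
  wordMap (E := E) (ρ.comp (MonoidHom.snd Γ Γ)) x D.adj_snd i

theorem fst_root (i : ι) : D.fst i (Lift.root S i) = x i := wordMap_root _ _ D.adj_fst i

theorem snd_root (i : ι) : D.snd i (Lift.root S i) = x i := wordMap_root _ _ D.adj_snd i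

theorem fst_singleton {i : ι} (a : L) (h : S.ty a = i) :
    D.fst i ⟨[a], h ▸ S.isWord_singleton a⟩ = ρ (E.val a).1 i (x i) := by
  subst h
  exact wordMap_singleton _ _ D.adj_fst a

theorem snd_singleton {i : ι} (a : L) (h : S.ty a = i) :
    D.snd i ⟨[a], h ▸ S.isWord_singleton a⟩ = ρ (E.val a).2 i (x i) := by
  subst h
  exact wordMap_singleton _ _ D.adj_snd a

variable {G : Type*} [Group G] (P : E.Lift G)

theorem fst_wordAct (g : G) (i : ι) (w : S.Word i) :
    D.fst i (P.wordAct g i w) = ρ (P.toM g).1 i (D.fst i w) :=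
  wordMap_wordAct P _ _ D.adj_fst (fun i m hm => ((D.mem_stab i m).1 hm).1) g i w

theorem snd_wordAct (g : G) (i : ι) (w : S.Word i) :
    D.snd i (P.wordAct g i w) = ρ (P.toM g).2 i (D.snd i w) :=
  wordMap_wordAct P _ _ D.adj_snd (fun i m hm => ((D.mem_stab i m).1 hm).2) g i w

variable (hT : ∀ i, (T i).IsTree)

theorem folding_fst (i : ι) (w : S.Word i) : folding (hT i) (x i) (D.fst i w) = (-1) ^ w.1.length :=
  hom_unitEdge_eq ((folding (hT i) (x i)).comp (D.fst i))
    ((congrArg _ (D.fst_root i)).trans (folding_self (hT i) (x i))) w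

theorem folding_snd (i : ι) (w : S.Word i) : folding (hT i) (x i) (D.snd i w) = (-1) ^ w.1.length :=
  hom_unitEdge_eq ((folding (hT i) (x i)).comp (D.snd i))
    ((congrArg _ (D.snd_root i)).trans (folding_self (hT i) (x i))) w

theorem folding_eq {n : ℕ} (c : (productComplex fun i => (S.wordTree i).graph).obj n) :
    (productFolding hT x).app n ((productMap D.fst).app n c) =
      (productFolding hT x).app n ((productMap D.snd).app n c) := by
  apply Subtype.ext
  funext a i
  exact (D.folding_fst hT i _).trans (D.folding_snd hT i _).symm

/-- The universal covering of the double. -/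
def covering : Hom (productComplex fun i => (S.wordTree i).graph) (double hT x ρ) where
  app n c := doubleMk ρ hT x ((productMap D.fst).app n c) ((productMap D.snd).app n c)
    (D.folding_eq hT c)
  naturality _ _ := rfl

theorem fst_act (k : G) {n : ℕ} (c : (productComplex fun i => (S.wordTree i).graph).obj n) :
    (productMap D.fst).app n ((act P.wordAct k).app n c) =
      (act ρ (P.toM k).1).app n ((productMap D.fst).app n c) := by
  apply Subtype.ext
  funext a i
  exact D.fst_wordAct P k i _

theorem snd_act (k : G) {n : ℕ} (c : (productComplex fun i => (S.wordTree i).graph).obj n) :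
    (productMap D.snd).app n ((act P.wordAct k).app n c) =
      (act ρ (P.toM k).2).app n ((productMap D.snd).app n c) := by
  apply Subtype.ext
  funext a i
  exact D.snd_wordAct P k i _

theorem covering_act (k : G) {n : ℕ} (c : (productComplex fun i => (S.wordTree i).graph).obj n) :
    (D.covering hT).app n ((act P.wordAct k).app n c) = (D.covering hT).app n c := by
  refine Eq.symm ((doubleMk_eq_iff ρ hT x _ _).2 ⟨(P.toM k).1, (P.toM k).2, ?_, ?_⟩)
  · exact (D.fst_act P k c).symm
  · exact (D.snd_act P k c).symm

theorem exists_act_hi [Finite ι] (P : E.Lift G) {n : ℕ}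
    (c : (productComplex fun i => (S.wordTree i).graph).obj n) :
    ∃ k : G, ProductCube.hi ((act P.wordAct k).app n c : ProductCube _ n) = Lift.root S := by
  obtain ⟨k, hk⟩ := P.exists_to_root (ProductCube.hi c)
  exact ⟨k, funext hk⟩

theorem exists_word_adj {i : ι} {w : S.Word i} (h : (S.wordTree i).graph.Adj w (Lift.root S i)) :
    ∃ a, ∃ h : S.ty a = i, w = ⟨[a], h ▸ S.isWord_singleton a⟩ := by
  rcases (wordTree_adj S).1 h with ⟨a, ha⟩ | ⟨a, ha⟩
  · exact absurd ha.symm (by simp [Lift.root])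
  · have e : w.1 = [a] := by simpa [Lift.root] using ha
    exact ⟨a, w.2.2 a (by rw [e]; simp), Subtype.ext e⟩

include D in
-- A neighbour of the empty word is a single letter, and a letter is determined by the pair of
-- neighbours of the base point to which its two components lead.
theorem word_ext {i : ι} {w w' : S.Word i} (h : (S.wordTree i).graph.Adj w (Lift.root S i))
    (h' : (S.wordTree i).graph.Adj w' (Lift.root S i)) (h1 : D.fst i w = D.fst i w')
    (h2 : D.snd i w = D.snd i w') : w = w' := by
  obtain ⟨a, rfl, rfl⟩ := exists_word_adj h
  obtain ⟨b, hb, rfl⟩ := exists_word_adj h'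
  have e : a = b := by
    refine E.separated a b hb.symm ((D.mem_stab _ _).2 ?_)
    have key : ∀ (g g' : Γ) (i : ι), ρ g i (x i) = ρ g' i (x i) → ρ (g⁻¹ * g') i (x i) = x i := by
      intro g g' i h
      rw [map_mul]
      change ρ g⁻¹ i (ρ g' i (x i)) = x i
      rw [← h]
      change (ρ g⁻¹ * ρ g) i (x i) = x i
      rw [← map_mul, inv_mul_cancel, map_one]
      rfl
    constructor
    · refine key _ _ _ ?_
      rw [← D.fst_singleton a rfl, h1]
      exact D.fst_singleton b hb
    · refine key _ _ _ ?_
      rw [← D.snd_singleton a rfl, h2]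
      exact D.snd_singleton b hb
  subst e
  rfl

theorem covering_eq_iff [Finite ι] {n : ℕ}
    (c d : (productComplex fun i => (S.wordTree i).graph).obj n) :
    (D.covering hT).app n c = (D.covering hT).app n d ↔ ∃ k : G, (act P.wordAct k).app n c = d := by
  constructor
  swap
  · rintro ⟨k, rfl⟩
    exact (D.covering_act P hT k c).symm
  -- Cubes with upper corner at the root suffice. For these the elements g, g' from
  -- `doubleMk_eq_iff` fix the base point, hence are trivial, and the cubes agree because their
  -- edges at the root are determined by their two projections.
  have main : ∀ c d : ProductCube (fun i => (S.wordTree i).graph) n, c.hi = Lift.root S →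
      d.hi = Lift.root S → (D.covering hT).app n c = (D.covering hT).app n d → c = d := by
    intro c d hc hd h
    obtain ⟨g, g', hg, hg'⟩ := (doubleMk_eq_iff ρ hT x _ _).1 h
    have e : ∀ i, ρ g i (x i) = x i := by
      intro i
      have h1 : ρ g i (D.fst i (c.hi i)) = D.fst i (d.hi i) :=
        congrFun (congrFun (congrArg Subtype.val hg) 1) i
      rwa [hc, hd, D.fst_root] at h1
    have e' : ∀ i, ρ g' i (x i) = x i := by
      intro i
      have h1 : ρ g' i (D.snd i (c.hi i)) = D.snd i (d.hi i) :=
        congrFun (congrFun (congrArg Subtype.val hg') 1) i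
      rwa [hc, hd, D.snd_root] at h1
    rw [D.free g e, act_one] at hg
    rw [D.free g' e', act_one] at hg'
    have hdir : c.dir = d.dir := by
      rw [← ProductCube.dir_productMap D.fst c, ← ProductCube.dir_productMap D.fst d]
      exact congrArg ProductCube.dir hg
    refine ProductCube.ext_of hdir (hc.trans hd.symm) fun k => ?_
    have h1 := c.adj_dir k
    have h2 := d.adj_dir k
    rw [hc] at h1
    rw [hd, ← hdir] at h2
    exact D.word_ext h1 h2 (congrFun (congrFun (congrArg Subtype.val hg) _) _)
      (congrFun (congrFun (congrArg Subtype.val hg') _) _)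
  intro h
  obtain ⟨k, hk⟩ := exists_act_hi P c
  obtain ⟨l, hl⟩ := exists_act_hi P d
  rw [← D.covering_act P hT k c, ← D.covering_act P hT l d] at h
  have := main _ _ hk hl h
  refine ⟨l⁻¹ * k, ?_⟩
  rw [act_mul]
  erw [this]
  rw [← act_mul, inv_mul_cancel, act_one]

/-- By transitivity both members of a pair can be moved so that their upper corners are the base
point. In each direction the opposite ends are then a pair of neighbours of the base point, which a
letter realizes. -/
theorem covering_surjective (n : ℕ) : Function.Surjective ((D.covering hT).app n) := by
  have main : ∀ (c c' : ProductCube T n) (h : _), c.hi = x → c'.hi = x →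
      ∃ d, (D.covering hT).app n d = doubleMk ρ hT x (n := n) c c' h := by
    intro c c' h hc hc'
    have hdir : c.dir = c'.dir := dir_eq_of_folding hT x h
    have h1 : ∀ i, ∃ w : S.Word i, i ∈ Set.range c.dir →
        (S.wordTree i).graph.Adj w (Lift.root S i) ∧ D.fst i w = c.lo i ∧ D.snd i w = c'.lo i := by
      intro i
      by_cases hi : i ∈ Set.range c.dir
      · obtain ⟨k, rfl⟩ := hi
        have h2 := c.adj_dir k
        have h3 := c'.adj_dir k
        rw [hc] at h2
        rw [hc', ← hdir] at h3
        obtain ⟨a, ha, ha1, ha2⟩ := D.neighbour _ _ _ h2.symm h3.symm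
        rw [← ha] at ha1 ha2 ⊢
        refine ⟨⟨[a], S.isWord_singleton a⟩, fun _ => ⟨?_, ?_, ?_⟩⟩
        · exact (wordTree_adj S).2 (Or.inr ⟨a, rfl⟩)
        · rw [D.fst_singleton a rfl, ha1]
        · rw [D.snd_singleton a rfl, ha2]
      · exact ⟨Lift.root S i, fun h => absurd h hi⟩
    choose w hw using h1
    let d : ProductCube (fun i => (S.wordTree i).graph) n :=
      ProductCube.mk' c.dir w (Lift.root S) fun k => (hw _ ⟨k, rfl⟩).1
    have hd : d.dir = c.dir := ProductCube.mk'_dir _ _ _ _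
    have e1 : (productMap D.fst).app n d = c := by
      refine ProductCube.ext_of ((ProductCube.dir_productMap D.fst d).trans hd) ?_ fun k => ?_
      · funext i
        change D.fst i (d.hi i) = _
        rw [ProductCube.mk'_hi, hc, D.fst_root]
      · rw [ProductCube.dir_productMap D.fst d, hd]
        change D.fst _ (d.lo _) = _
        rw [ProductCube.mk'_lo]
        exact (hw _ ⟨k, rfl⟩).2.1
    have e2 : (productMap D.snd).app n d = c' := by
      refine ProductCube.ext_of ((ProductCube.dir_productMap D.snd d).trans (hd.trans hdir)) ?_
        fun k => ?_
      · funext i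
        change D.snd i (d.hi i) = _
        rw [ProductCube.mk'_hi, hc', D.snd_root]
      · rw [ProductCube.dir_productMap D.snd d, hd]
        change D.snd _ (d.lo _) = _
        rw [ProductCube.mk'_lo]
        exact (hw _ ⟨k, rfl⟩).2.2
    exact ⟨d, (doubleMk_eq_iff ρ hT x (D.folding_eq hT d) h).2
      ⟨1, 1, (act_one ρ n _).trans e1, (act_one ρ n _).trans e2⟩⟩
  intro y
  obtain ⟨c, c', h, rfl⟩ := doubleMk_surjective ρ hT x y
  obtain ⟨g, hg⟩ := D.transitive (ProductCube.hi c)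
  obtain ⟨g', hg'⟩ := D.transitive (ProductCube.hi c')
  have key : ∀ (g : Γ) (i : ι) (y : V i), ρ g i (x i) = y → ρ g⁻¹ i y = x i := by
    rintro g i _ rfl
    change (ρ g⁻¹ * ρ g) i (x i) = x i
    rw [← map_mul, inv_mul_cancel, map_one]
    rfl
  have e : ProductCube.hi ((act ρ g⁻¹).app n c : ProductCube T n) = x :=
    funext fun i => key g i _ (hg i)
  have e' : ProductCube.hi ((act ρ g'⁻¹).app n c' : ProductCube T n) = x :=
    funext fun i => key g' i _ (hg' i)
  have hf : (productFolding hT x).app n ((act ρ g⁻¹).app n c) =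
      (productFolding hT x).app n ((act ρ g'⁻¹).app n c') := by
    -- Both elements move corners with the same folding to the base point, so they have the same
    -- type and the translated pair still has equal foldings.
    have et : typeMap hT x ρ g⁻¹ = typeMap hT x ρ g'⁻¹ := by
      funext i
      rw [typeMap_eq_of_folding ρ hT x (c := c) rfl, typeMap_eq_of_folding ρ hT x (c := c') rfl, e, e',
        folding_hi hT x h]
    apply Subtype.ext
    funext a i
    refine (folding_act hT x ρ g⁻¹ i (c.1 a i)).trans
      (Eq.trans ?_ (folding_act hT x ρ g'⁻¹ i (c'.1 a i)).symm)
    rw [et]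
    exact congrArg _ (congrFun (congrFun (congrArg Subtype.val h) a) i)
  obtain ⟨d, hd⟩ := main _ _ hf e e'
  refine ⟨d, hd.trans ?_⟩
  refine (doubleMk_eq_iff ρ hT x _ _).2 ⟨g, g', ?_, ?_⟩
  · rw [← act_mul, mul_inv_cancel, act_one]
  · rw [← act_mul, mul_inv_cancel, act_one]

end DoubleData

/-! ### The double as a cube complex and its universal covering -/

namespace DoubleData

open LetterSystem ExchangeData Topology

variable {ι : Type u} {V : ι → Type v} {T : ∀ i, SimpleGraph (V i)} {Γ : Type w} [Group Γ]
variable {x : ∀ i, V i} {ρ : Γ →* ∀ i, T i ≃g T i} {L : Type*} {S : LetterSystem ι L}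
variable {E : S.ExchangeData (Γ × Γ)} (D : DoubleData x ρ E)
variable {G : Type*} [Group G] (P : E.Lift G) (hT : ∀ i, (T i).IsTree)

include D in
-- The square of such an element fixes a vertex and is trivial, so its image in Γ is trivial by the
-- absence of 2-torsion. If the element reversed an edge, the projection `fst` would then map both
-- ends of that edge to the same vertex, although it preserves adjacency.
theorem eq_one_of_stab [Finite ι] (g : G) (h : ∀ i, ∃ y z, (y = z ∨ (S.wordTree i).graph.Adj y z) ∧
    ((P.wordAct g i y = y ∧ P.wordAct g i z = z) ∨ (P.wordAct g i y = z ∧ P.wordAct g i z = y))) :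
    g = 1 := by
  choose y z hyz hg using h
  have h2 : g * g = 1 := by
    refine P.eq_one_of_fix y fun i => ?_
    rw [P.wordAct_mul]
    rcases hg i with h | h
    · rw [h.1, h.1]
    · rw [h.1, h.2]
  have h3 : (P.toM g).1 = 1 := by
    apply D.torsion
    rw [← Prod.fst_mul, ← map_mul, h2, map_one]
    rfl
  refine P.eq_one_of_fix y fun i => ?_
  rcases hg i with h | h
  · exact h.1
  · rcases hyz i with h4 | h4
    · rw [h.1, h4]
    · have h5 := D.fst_wordAct P g i (y i)
      rw [h3, map_one, h.1] at h5
      exact absurd h5.symm ((D.fst i).map_adj h4).ne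

include D in
-- A symmetry that fixes a cube of the double comes from an element of G that preserves a cube of
-- the covering. This element is trivial, so the symmetry fixes all corners of the lifted cube.
theorem map_covering_free [Finite ι] (P : E.Lift G) {n : ℕ} (f : CubeHom (Fin n) (Fin n))
    (y : (double hT x ρ).obj n) (h : (double hT x ρ).map f y = y) : f = CubeHom.id (Fin n) := by
  obtain ⟨c, rfl⟩ := D.covering_surjective hT n y
  rw [← (D.covering hT).naturality, D.covering_eq_iff P] at h
  obtain ⟨k, hk⟩ := h
  change ProductCube (fun i => (S.wordTree i).graph) n at c
  have hd : f.σ.trans c.dir = c.dir := by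
    have h1 := congrArg ProductCube.dir hk
    rw [← c.dir_map f, ← h1]
    exact (ProductCube.dir_productMap (fun i => ((P.wordAct k i : (S.wordTree i).graph ≃g (S.wordTree i).graph) :
      (S.wordTree i).graph →g (S.wordTree i).graph)) _).symm
  have hσ : ∀ l, f.σ l = l := fun l => c.dir.injective (DFunLike.congr_fun hd l)
  have happ : ∀ a l, f.app a l = f.ε l * a l := by
    intro a l
    have h1 : Function.extend f.σ a 1 (f.σ l) = a l := f.σ.injective.extend_apply a 1 l
    rw [hσ] at h1
    rw [CubeHom.app, h1]
  have hkc : ∀ a i, P.wordAct k i (c.1 (f.app a) i) = c.1 a i := fun a i =>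
    congrFun (congrFun (congrArg Subtype.val hk) a) i
  have hk1 : k = 1 := by
    refine D.eq_one_of_stab P k fun i => ⟨c.1 (f.app 1) i, c.1 (f.app fun _ => -1) i, ?_⟩
    by_cases hi : i ∈ Set.range c.dir
    · obtain ⟨l, rfl⟩ := hi
      have e1 := hkc 1 (c.dir l)
      have e2 := hkc (fun _ => -1) (c.dir l)
      rw [e1, e2]
      simp only [c.apply_dir, happ, Pi.one_apply]
      have h3 := c.adj_dir l
      rcases Int.units_eq_one_or (f.ε l) with h | h <;> rw [h]
      · rw [if_pos (by decide), if_neg (by decide), if_pos trivial, if_neg (by decide)]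
        exact ⟨Or.inr h3.symm, Or.inl ⟨rfl, rfl⟩⟩
      · rw [if_neg (by decide), if_pos (by decide), if_pos trivial, if_neg (by decide)]
        exact ⟨Or.inr h3, Or.inr ⟨rfl, rfl⟩⟩
    · have e1 := hkc 1 i
      have e2 := hkc (fun _ => -1) i
      rw [e1, e2]
      simp only [c.apply_of_notMem _ hi]
      simp
  have hε : f.ε = 1 := by
    funext l
    have e1 := hkc 1 (c.dir l)
    rw [hk1, map_one, c.apply_dir, c.apply_dir, happ, Pi.one_apply (M := fun _ : Fin n => ℤˣ)] at e1
    rcases Int.units_eq_one_or (f.ε l) with h | h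
    · exact h
    · rw [h, if_neg (by decide), if_pos rfl] at e1
      exact absurd e1 (c.adj_dir l).ne
  apply CubeHom.ext
  · exact DFunLike.ext _ _ hσ
  · exact hε

include D in
theorem exists_adj (i : ι) (w : S.Word i) : ∃ w', (S.wordTree i).graph.Adj w' w := by
  rcases List.eq_nil_or_concat w.1 with h | ⟨l, a, h⟩
  · obtain ⟨a, rfl⟩ := D.exists_letter i
    refine ⟨⟨[a], S.isWord_singleton a⟩, (wordTree_adj S).2 (Or.inr ⟨a, ?_⟩)⟩
    rw [h]
    rfl
  · have hl : S.IsWord i l := w.2.prefix (⟨[a], by rw [h, List.concat_eq_append]⟩)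
    exact ⟨⟨l, hl⟩, (wordTree_adj S).2 (Or.inl ⟨a, by rw [h, List.concat_eq_append]⟩)⟩

include D in
-- A lift of the cube is enlarged in an unused direction j. This is possible as each tree of words
-- has an edge at every vertex.
theorem exists_face [Fintype ι] {n : ℕ} (hn : n < Fintype.card ι) (y : (double hT x ρ).obj n) :
    ∃ (z : (double hT x ρ).obj (n + 1)) (i : Fin (n + 1)) (ε : ℤˣ),
      y = (double hT x ρ).map (CubeHom.face i ε) z := by
  classical
  obtain ⟨c, rfl⟩ := D.covering_surjective hT n y
  change ProductCube (fun i => (S.wordTree i).graph) n at c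
  obtain ⟨j, hj⟩ : ∃ j, j ∉ Set.range c.dir := by
    by_contra! hall
    have := Fintype.card_le_of_surjective c.dir hall
    simp only [Fintype.card_fin] at this
    omega
  obtain ⟨w, hw⟩ := D.exists_adj j (c.hi j)
  -- The new direction comes first, and the old cube is the face at the end 1 of it.
  let σ : Fin (n + 1) ↪ ι := ⟨Fin.cons j c.dir, Fin.cons_injective_iff.2 ⟨hj, c.dir.injective⟩⟩
  have hσ0 : σ 0 = j := rfl
  have hσs : ∀ l : Fin n, σ l.succ = c.dir l := fun l => rfl
  have hne : ∀ l, c.dir l ≠ j := fun l hl => hj ⟨l, hl⟩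
  let d : ProductCube (fun i => (S.wordTree i).graph) (n + 1) :=
    ProductCube.mk' σ (Function.update c.lo j w) c.hi (by
      intro k
      refine Fin.cases ?_ (fun l => ?_) k
      · rw [hσ0, Function.update_self]
        exact hw
      · rw [hσs, Function.update_of_ne (hne l)]
        exact c.adj_dir l)
  have hdd : d.dir = σ := ProductCube.mk'_dir _ _ _ _
  have happ : ∀ a : Fin n → ℤˣ, (CubeHom.face 0 1).app a = Fin.cons 1 a := by
    intro a
    funext k
    refine Fin.cases ?_ (fun l => ?_) k
    · rw [CubeHom.app, Function.extend_apply' _ _ _ (by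
        rintro ⟨l, hl⟩
        exact Fin.succAbove_ne 0 l hl)]
      rfl
    · have h1 : Function.extend (CubeHom.face (0 : Fin (n + 1)) 1).σ a 1 l.succ = a l := by
        exact (CubeHom.face (0 : Fin (n + 1)) 1).σ.injective.extend_apply a 1 l
      rw [CubeHom.app, h1, Fin.cons_succ]
      simp [CubeHom.face]
  have hd : (productComplex fun i => (S.wordTree i).graph).map (CubeHom.face 0 1) d = c := by
    apply Subtype.ext
    funext a i
    change d.1 ((CubeHom.face 0 1).app a) i = c.1 a i
    rw [happ]
    by_cases hi : i ∈ Set.range c.dir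
    · obtain ⟨l, rfl⟩ := hi
      have e1 := d.apply_dir (Fin.cons 1 a) l.succ
      rw [hdd, hσs, Fin.cons_succ] at e1
      rw [e1, c.apply_dir]
      congr 1
      · exact congrFun (ProductCube.mk'_hi _ _ _ _) _
      · rw [← hσs, ProductCube.mk'_lo, hσs, Function.update_of_ne (hne l)]
    · rw [c.apply_of_notMem a hi]
      by_cases hij : i = j
      · subst hij
        have e1 := d.apply_dir (Fin.cons 1 a) 0
        rw [hdd, hσ0, Fin.cons_zero, if_pos rfl] at e1
        rw [e1]
        exact congrFun (ProductCube.mk'_hi _ _ _ _) _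
      · rw [d.apply_of_notMem]
        · exact congrFun (ProductCube.mk'_hi _ _ _ _) _
        · rw [hdd]
          rintro ⟨k, hk⟩
          revert hk
          refine Fin.cases ?_ (fun l => ?_) k
          · intro hk
            exact hij hk.symm
          · intro hk
            exact hi ⟨l, hk⟩
  exact ⟨(D.covering hT).app _ d, 0, 1, ((congrArg _ hd).symm.trans
    ((D.covering hT).naturality (CubeHom.face 0 1) d))⟩

include D in
theorem isCubeComplex [Fintype ι] (P : E.Lift G) :
    (double hT x ρ).IsCubeComplex (Fintype.card ι) where
  isEmpty m hm := by
    refine ⟨fun y => ?_⟩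
    obtain ⟨c, rfl⟩ := D.covering_surjective hT m y
    have := ProductCube.card_le c
    omega
  exists_face m hm y := D.exists_face hT hm y
  free m _ f y h := D.map_covering_free hT P f y h

/-- The vertex of empty words. -/
def rootVertex (S : LetterSystem ι L) : (productComplex fun i => (S.wordTree i).graph).obj 0 :=
  (ProductCube.mk' ⟨Fin.elim0, fun i => i.elim0⟩ (Lift.root S) (Lift.root S) fun k => k.elim0 :
    ProductCube _ 0)

theorem eq_covering_root [Finite ι] (P : E.Lift G) (y : (double hT x ρ).obj 0) :
    y = (D.covering hT).app 0 (rootVertex S) := by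
  obtain ⟨c, rfl⟩ := D.covering_surjective hT 0 y
  obtain ⟨k, hk⟩ := exists_act_hi P c
  rw [← D.covering_act P hT k c]
  congr 1
  refine ProductCube.ext_of ?_ ?_ fun k => k.elim0
  · exact DFunLike.ext _ _ fun k => k.elim0
  · rw [hk]
    exact (ProductCube.mk'_hi _ _ _ _).symm

include D in
theorem nonempty_unique [Finite ι] (P : E.Lift G) : Nonempty (Unique ((double hT x ρ).obj 0)) :=
  ⟨⟨⟨(D.covering hT).app 0 (rootVertex S)⟩, D.eq_covering_root hT P⟩⟩

theorem simplyConnectedSpace_words [Finite ι] [Finite L] (S : LetterSystem ι L) :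
    SimplyConnectedSpace (productComplex fun i => (S.wordTree i).graph).Realization :=
  have := contractibleSpace_treeProduct (fun i => S.wordTree i) fun i n => S.finite_depth i n
  inferInstance

theorem isQuotientCoveringMap [Finite ι] :
    letI := realizeAction (act P.wordAct) (act_one P.wordAct) (act_mul P.wordAct)
    IsQuotientCoveringMap (D.covering hT).realize G :=
  isQuotientCoveringMap_realize (act P.wordAct) (act_one P.wordAct) (act_mul P.wordAct)
    (D.covering_surjective hT) (fun _ c d => D.covering_eq_iff P hT c d)
    (exists_disjoint_nhds (fun g => P.wordAct g) (D.eq_one_of_stab P))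

theorem isUniversalCovering [Finite ι] [Finite L] (P : E.Lift G) :
    (D.covering hT).IsUniversalCovering where
  simplyConnected := simplyConnectedSpace_words S
  isCoveringMap :=
    letI := realizeAction (act P.wordAct) (act_one P.wordAct) (act_mul P.wordAct)
    (D.isQuotientCoveringMap P hT).isCoveringMap
  surjective := by
    let := realizeAction (act P.wordAct) (act_one P.wordAct) (act_mul P.wordAct)
    exact (D.isQuotientCoveringMap P hT).surjective

end DoubleData

/-! ### The fundamental group of the double and the loops of its generators -/

theorem fundamentalGroupToMulOpposite_of_lift {Z X G : Type*} [TopologicalSpace Z]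
    [TopologicalSpace X] [Group G] [MulAction G Z] {p : Z → X} (hp : IsQuotientCoveringMap p G) {x : X}
    (z : p ⁻¹' {x}) (g : G) (β : Path z.1 (g • z.1)) (γ : Path x x) (h : ∀ t, p (β t) = γ t) :
    hp.fundamentalGroupToMulOpposite z (FundamentalGroup.fromPath (Path.Homotopic.Quotient.mk γ)) =
      MulOpposite.op g := by
  rw [IsQuotientCoveringMap.fundamentalGroupToMulOpposite_apply_eq_Iff]
  have hz : p (g • z.1) = x := (hp.map_smul g).trans z.2
  -- The monodromy of γ is computed with its lift β, which ends in g • z.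
  have := hp.isCoveringMap.monodromy_eq_of_map_eq (γ := .mk γ) (ex := z) (ey := ⟨g • z.1, hz⟩)
    (Path.Homotopic.Quotient.mk β) (by
      refine congrArg Path.Homotopic.Quotient.mk ?_
      ext t
      exact h t)
  exact (congrArg Subtype.val this).symm

namespace DoubleData

open LetterSystem ExchangeData Topology

variable {ι : Type u} {V : ι → Type v} {T : ∀ i, SimpleGraph (V i)} {Γ : Type w} [Group Γ]
variable {x : ∀ i, V i} {ρ : Γ →* ∀ i, T i ≃g T i} {L : Type*} {S : LetterSystem ι L}
variable {E : S.ExchangeData (Γ × Γ)} (D : DoubleData x ρ E)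
variable {G : Type*} [Group G] (P : E.Lift G) (hT : ∀ i, (T i).IsTree)

open Classical in
/-- The end of the edge from the empty words in the direction of a letter. -/
def letterEnd (S : LetterSystem ι L) (a : L) (i : ι) : S.Word i :=
  if h : S.ty a = i then ⟨[a], h ▸ S.isWord_singleton a⟩ else Lift.root S i

theorem letterEnd_of_eq {a : L} {i : ι} (h : S.ty a = i) :
    letterEnd S a i = ⟨[a], h ▸ S.isWord_singleton a⟩ := dif_pos h

theorem letterEnd_of_ne {a : L} {i : ι} (h : S.ty a ≠ i) : letterEnd S a i = Lift.root S i := dif_neg h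

theorem wordAct_gen_root_eq (a : L) (i : ι) :
    P.wordAct (P.gen a) i (Lift.root S i) = letterEnd S a i := by
  by_cases h : S.ty a = i
  · subst h
    rw [P.wordAct_gen_root_self, letterEnd_of_eq rfl]
  · rw [P.wordAct_gen_root h, letterEnd_of_ne h]

/-- The edge from the empty words in the direction of a letter. -/
def letterEdge (S : LetterSystem ι L) (a : L) : ProductCube (fun i => (S.wordTree i).graph) 1 :=
  ProductCube.mk' ⟨fun _ => S.ty a, fun _ _ _ => Subsingleton.elim _ _⟩ (Lift.root S) (letterEnd S a)
    fun k => by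
      change (S.wordTree (S.ty a)).graph.Adj (Lift.root S (S.ty a)) (letterEnd S a (S.ty a))
      rw [letterEnd_of_eq rfl]
      exact (wordTree_adj S).2 (Or.inl ⟨a, rfl⟩)

theorem letterEdge_one (a : L) : (letterEdge S a).1 (fun _ => 1) = letterEnd S a :=
  ProductCube.mk'_hi _ _ _ _

theorem letterEdge_neg_one (a : L) : (letterEdge S a).1 (fun _ => -1) = Lift.root S := by
  funext i
  by_cases h : S.ty a = i
  · subst h
    exact ProductCube.mk'_lo ⟨fun _ => S.ty a, fun _ _ _ => Subsingleton.elim _ _⟩ _ _ _ 0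
  · rw [ProductCube.apply_of_notMem]
    · exact (congrFun (ProductCube.mk'_hi _ _ _ _) i).trans (letterEnd_of_ne h)
    · rw [letterEdge, ProductCube.mk'_dir]
      rintro ⟨k, hk⟩
      exact h hk

theorem fst_letterEnd (a : L) (i : ι) : D.fst i (letterEnd S a i) = ρ (E.val a).1 i (x i) := by
  by_cases h : S.ty a = i
  · rw [letterEnd_of_eq h, D.fst_singleton a h]
  · rw [letterEnd_of_ne h, D.fst_root, ((D.mem_stab i _).1 (E.val_mem a i h)).1]

theorem snd_letterEnd (a : L) (i : ι) : D.snd i (letterEnd S a i) = ρ (E.val a).2 i (x i) := by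
  by_cases h : S.ty a = i
  · rw [letterEnd_of_eq h, D.snd_singleton a h]
  · rw [letterEnd_of_ne h, D.snd_root, ((D.mem_stab i _).1 (E.val_mem a i h)).2]

/-- The inclusion of a vertex of the `1`-cube. -/
def endInclusion (s : ℤˣ) : CubeHom (Fin 0) (Fin 1) := ⟨⟨Fin.elim0, fun k => k.elim0⟩, fun _ => s⟩

theorem point_end {X : CubicalSet.{u}} (e : X.obj 1) (s : ℤˣ) (t : Fin 1 → CubeHom.I₁)
    (ht : (t 0 : ℝ) = ((s : ℤ) : ℝ)) : X.point e t = X.vertex (X.map (endInclusion s) e) := by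
  rw [vertex, point_map]
  congr 1
  funext k
  apply Subtype.ext
  rw [Subsingleton.elim k 0, ht]
  simp only [CubeHom.appReal, endInclusion]
  rw [Function.extend_apply' _ _ _ (by rintro ⟨l, -⟩; exact l.elim0)]
  simp

/-- The path that runs through an oriented edge. -/
def edgePath {X : CubicalSet.{u}} (e : X.obj 1) {y z : X.Realization}
    (hy : X.vertex (X.map (endInclusion (-1)) e) = y) (hz : X.vertex (X.map (endInclusion 1) e) = z) :
    Path y z where
  toFun t := X.point e (fun _ => ⟨2 * (t : ℝ) - 1, by constructor <;> linarith [t.2.1, t.2.2]⟩)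
  continuous_toFun := (X.continuous_point e).comp (by fun_prop)
  source' := by
    rw [← hy]
    exact point_end e (-1) _ (by simp)
  target' := by
    rw [← hz]
    refine point_end e 1 _ ?_
    simp only [Set.Icc.coe_one, Units.val_one]
    norm_num

theorem app_endInclusion (s : ℤˣ) (a : Fin 0 → ℤˣ) : (endInclusion s).app a = fun _ => s := by
  funext k
  simp only [CubeHom.app, endInclusion]
  rw [Function.extend_apply' _ _ _ (by rintro ⟨l, -⟩; exact l.elim0)]
  simp

/-- The edge of the double that belongs to a letter. -/
theorem isImageOfPair_letterEdge (a : L) : ∃ c c' : ProductCube T 1,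
    c.1 (fun _ => -1) = x ∧ c'.1 (fun _ => -1) = x ∧
    (∀ i, c.1 (fun _ => 1) i = ρ (E.val a).1 i (x i)) ∧
    (∀ i, c'.1 (fun _ => 1) i = ρ (E.val a).2 i (x i)) ∧
    IsImageOfPair hT x ρ ((D.covering hT).app 1 (letterEdge S a)) c c' := by
  refine ⟨(productMap D.fst).app 1 (letterEdge S a), (productMap D.snd).app 1 (letterEdge S a),
    ?_, ?_, ?_, ?_, D.folding_eq hT (letterEdge S a), rfl⟩
  · funext i
    change D.fst i ((letterEdge S a).1 (fun _ => -1) i) = _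
    rw [letterEdge_neg_one, D.fst_root]
  · funext i
    change D.snd i ((letterEdge S a).1 (fun _ => -1) i) = _
    rw [letterEdge_neg_one, D.snd_root]
  · intro i
    change D.fst i ((letterEdge S a).1 (fun _ => 1) i) = _
    rw [letterEdge_one, D.fst_letterEnd]
  · intro i
    change D.snd i ((letterEdge S a).1 (fun _ => 1) i) = _
    rw [letterEdge_one, D.snd_letterEnd]

theorem map_letterEdge_neg_one (a : L) :
    (productComplex fun i => (S.wordTree i).graph).map (endInclusion (-1)) (letterEdge S a) =
      rootVertex S := by
  apply Subtype.ext
  funext b i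
  change (letterEdge S a).1 ((endInclusion (-1)).app b) i = _
  rw [app_endInclusion, letterEdge_neg_one]
  exact ((congrFun (ProductCube.mk'_hi _ _ _ _) i).symm.trans (by
    rw [ProductCube.hi, Subsingleton.elim b 1]
    rfl))

theorem map_letterEdge_one (a : L) :
    (productComplex fun i => (S.wordTree i).graph).map (endInclusion 1) (letterEdge S a) =
      (act P.wordAct (P.gen a)).app 0 (rootVertex S) := by
  have h : ∀ b i, (rootVertex S).1 b i = Lift.root S i := by
    intro b i
    exact ((congrFun (ProductCube.mk'_hi _ _ _ _) i).symm.trans (by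
      rw [ProductCube.hi, Subsingleton.elim b 1]
      rfl)).symm
  apply Subtype.ext
  funext b i
  change (letterEdge S a).1 ((endInclusion 1).app b) i =
    P.wordAct (P.gen a) i ((rootVertex S).1 b i)
  rw [app_endInclusion, letterEdge_one, h, wordAct_gen_root_eq]

include D in
-- The covering is simply connected with group G. The loop along the edge of a letter a lifts to the
-- edge from the vertex of empty words to its translate by `P.gen a`, which identifies the element
-- of G that belongs to it.
theorem exists_fundamentalGroup_equiv [Finite ι] [Finite L] (v : (double hT x ρ).obj 0) :
    ∃ φ : G ≃* (FundamentalGroup (double hT x ρ).Realization ((double hT x ρ).vertex v))ᵐᵒᵖ,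
      ∀ a : L, ∃ (e : (double hT x ρ).obj 1)
        (γ : Path ((double hT x ρ).vertex v) ((double hT x ρ).vertex v)),
        (∃ c c' : ProductCube T 1, c.1 (fun _ => -1) = x ∧ c'.1 (fun _ => -1) = x ∧
          (∀ i, c.1 (fun _ => 1) i = ρ (E.val a).1 i (x i)) ∧
          (∀ i, c'.1 (fun _ => 1) i = ρ (E.val a).2 i (x i)) ∧ IsImageOfPair hT x ρ e c c') ∧
        (double hT x ρ).IsEdgePath e γ ∧
        φ (P.gen a) = MulOpposite.op (FundamentalGroup.fromPath (Path.Homotopic.Quotient.mk γ)) := by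
  let := realizeAction (act P.wordAct) (act_one P.wordAct) (act_mul P.wordAct)
  have hp := D.isQuotientCoveringMap P hT
  have := simplyConnectedSpace_words S
  let X := productComplex fun i => (S.wordTree i).graph
  have hv : (D.covering hT).realize (X.vertex (rootVertex S)) = (double hT x ρ).vertex v := by
    rw [D.eq_covering_root hT P v]
    rfl
  let z : (D.covering hT).realize ⁻¹' {(double hT x ρ).vertex v} := ⟨X.vertex (rootVertex S), hv⟩
  let φ := hp.fundamentalGroupEquiv z
  -- `φ` identifies the fundamental group with the opposite group of G, so passing to opposite
  -- groups once more identifies G with the opposite of the fundamental group.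
  refine ⟨(MulEquiv.opOp G).trans (MulEquiv.op φ.symm), fun a => ?_⟩
  have hy (s : ℤˣ) : (double hT x ρ).vertex ((double hT x ρ).map (endInclusion s)
      ((D.covering hT).app 1 (letterEdge S a))) = (double hT x ρ).vertex v := by
    congr 1
    exact (D.eq_covering_root hT P _).trans (D.eq_covering_root hT P v).symm
  let β : Path z.1 (P.gen a • z.1) := edgePath (X := X) (letterEdge S a)
    (congrArg X.vertex (map_letterEdge_neg_one a)) (congrArg X.vertex (map_letterEdge_one P a))
  let γ : Path ((double hT x ρ).vertex v) ((double hT x ρ).vertex v) :=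
    edgePath ((D.covering hT).app 1 (letterEdge S a)) (hy (-1)) (hy 1)
  refine ⟨(D.covering hT).app 1 (letterEdge S a), γ, D.isImageOfPair_letterEdge hT a,
    fun t => rfl, ?_⟩
  change MulOpposite.op (φ.symm (MulOpposite.op (P.gen a))) = _
  congr 1
  rw [MulEquiv.symm_apply_eq]
  exact (fundamentalGroupToMulOpposite_of_lift hp z (P.gen a) β γ fun t => rfl).symm

end DoubleData

namespace LetterSystem

/-! ## Trees on which letters act freely -/

variable {I : Type u} {L : Type v} {S : LetterSystem I L} {M : Type w} [Group M] {gen : L → M}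
variable {V : Type*} {T : SimpleGraph V} {r : M →* (T ≃g T)} {x : V} {i : I}

theorem rel_mul_apply (g h : M) (y : V) : r (g * h) y = r g (r h y) := by
  rw [map_mul]
  rfl

variable (hinv : ∀ a, gen (S.inv a) = (gen a)⁻¹)
variable (hfree : ∀ l, S.IsWord i l → l ≠ [] → r (wordProd gen l) x ≠ x)

include hinv hfree

/-- The first letter of l is moved to the other side, where it multiplies l' with reduction; by
induction on l the remaining words agree. -/
theorem word_eq_of_apply_eq {l l' : List L} (hl : S.IsWord i l) (hl' : S.IsWord i l')
    (h : r (wordProd gen l) x = r (wordProd gen l') x) : l = l' := by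
  induction l generalizing l' with
  | nil =>
    by_contra hne
    refine hfree l' hl' (Ne.symm hne) ?_
    rw [← h, wordProd_nil, map_one]
    rfl
  | cons a l ih =>
    have ha := hl.2 a List.mem_cons_self
    have h1 : l = S.consRed (S.inv a) l' := by
      refine ih hl.tail (S.isWord_consRed (by rwa [S.ty_inv]) hl') ?_
      rw [S.wordProd_consRed hinv, hinv, rel_mul_apply, ← h, wordProd_cons, ← rel_mul_apply,
        inv_mul_cancel_left]
    have h2 := S.consRed_inv_consRed (a := S.inv a) hl'
    rw [S.inv_inv, ← h1, S.consRed_of_isChain hl.1] at h2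
    exact h2

/-- The orbit map from the tree of reduced words is an isomorphism of graphs: injective since
nonempty reduced words move x, surjective by transitivity, and compatible with edges because the
neighbours of x are its images under the letters. -/
theorem isTree_of_free (hadj : ∀ y, T.Adj x y ↔ ∃ a, S.ty a = i ∧ r (gen a) x = y)
    (htrans : ∀ y, ∃ l : List L, (∀ a ∈ l, S.ty a = i) ∧ r (wordProd gen l) x = y) : T.IsTree := by
  have hadj' : ∀ g y, T.Adj (r g x) y ↔ ∃ a, S.ty a = i ∧ r (g * gen a) x = y := by
    intro g y
    have h1 : y = r g (r g⁻¹ y) := by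
      rw [← rel_mul_apply, mul_inv_cancel, map_one]
      rfl
    rw [h1, (r g).map_adj_iff, hadj]
    refine exists_congr fun a => and_congr_right fun _ => ?_
    rw [rel_mul_apply]
    exact (r g).injective.eq_iff.symm
  let f : S.Word i → V := fun w => r (wordProd gen w.1) x
  have hf : Function.Injective f := fun w w' h =>
    Subtype.ext (word_eq_of_apply_eq hinv hfree w.2 w'.2 h)
  have hf' : Function.Surjective f := by
    intro y
    obtain ⟨l, hl, rfl⟩ := htrans y
    obtain ⟨l', h1, h2⟩ := S.exists_isWord hinv l hl
    exact ⟨⟨l', h1⟩, by rw [← h2]⟩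
  have h1 : ∀ w w' : S.Word i, (S.wordTree i).graph.Adj w w' → T.Adj (f w) (f w') := by
    have key : ∀ w w' : S.Word i, (∃ a, w'.1 = w.1 ++ [a]) → T.Adj (f w) (f w') := by
      rintro w w' ⟨a, ha⟩
      refine (hadj' _ _).2 ⟨a, w'.2.2 a (by rw [ha]; simp), ?_⟩
      change _ = r (wordProd gen w'.1) x
      rw [ha, wordProd_append, wordProd_cons, wordProd_nil, mul_one]
    intro w w' h
    rcases (wordTree_adj S).1 h with h | h
    · exact key w w' h
    · exact (key w' w h).symm
  have h2 : ∀ w w' : S.Word i, T.Adj (f w) (f w') → (S.wordTree i).graph.Adj w w' := by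
    intro w w' h
    obtain ⟨a, ha, h⟩ := (hadj' _ _).1 h
    rw [wordTree_adj]
    have h3 : r (wordProd gen (w.1 ++ [a])) x = r (wordProd gen w'.1) x := by
      rw [wordProd_append, wordProd_cons, wordProd_nil, mul_one]
      exact h
    by_cases hw : S.IsWord i (w.1 ++ [a])
    · exact Or.inl ⟨a, (word_eq_of_apply_eq hinv hfree hw w'.2 h3).symm⟩
    -- If the extended word is not reduced, the new letter cancels the last one, and w' is the
    -- parent of w.
    · right
      rcases List.eq_nil_or_concat w.1 with h4 | ⟨l, b, h4⟩
      · rw [h4] at hw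
        exact absurd (ha ▸ S.isWord_singleton a) hw
      · rw [List.concat_eq_append] at h4
        have hl : S.IsWord i l := w.2.prefix ⟨[b], h4.symm⟩
        have hab : a = S.inv b := by
          by_contra hab
          refine hw ⟨?_, ?_⟩
          · rw [List.isChain_append]
            refine ⟨w.2.1, List.IsChain.singleton _, ?_⟩
            intro c hc d hd
            rw [h4, List.getLast?_concat] at hc
            simp only [Option.mem_def, Option.some.injEq, List.head?_cons] at hc hd
            subst hc hd
            exact hab
          · intro c hc
            rcases List.mem_append.1 hc with hc | hc
            · exact w.2.2 c hc
            · rw [List.mem_singleton.1 hc, ha]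
        refine ⟨b, ?_⟩
        rw [h4, hab, wordProd_append, wordProd_append, wordProd_cons, wordProd_cons, wordProd_nil,
          mul_one, mul_one, hinv, mul_inv_cancel_right] at h3
        rw [h4, word_eq_of_apply_eq hinv hfree hl w'.2 h3]
  let e : (S.wordTree i).graph ≃g T :=
    { toEquiv := Equiv.ofBijective f ⟨hf, hf'⟩
      map_rel_iff' := fun {w w'} => ⟨h2 w w', h1 w w'⟩ }
  exact e.isTree_iff.1 (S.wordTree i).isTree

end LetterSystem

/-! ## Reduced norms -/

section ReducedNorm

variable {R : Type u} {R' : Type v} [CommRing R] [CommRing R'] {c t : R} {c' t' : R'}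

theorem nrd_eq (a : ℍ[R,c,t]) :
    nrd a = a.re ^ 2 - c * a.imI ^ 2 - t * a.imJ ^ 2 + c * t * a.imK ^ 2 := by
  simp [nrd]
  ring

theorem nrd_mul (a b : ℍ[R,c,t]) : nrd (a * b) = nrd a * nrd b := by
  simp only [nrd_eq, QuaternionAlgebra.re_mul, QuaternionAlgebra.imI_mul, QuaternionAlgebra.imJ_mul,
    QuaternionAlgebra.imK_mul]
  ring

theorem nrd_smul (r : R) (a : ℍ[R,c,t]) : nrd (r • a) = r ^ 2 * nrd a := by
  simp only [nrd_eq, QuaternionAlgebra.re_smul, QuaternionAlgebra.imI_smul,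
    QuaternionAlgebra.imJ_smul, QuaternionAlgebra.imK_smul, smul_eq_mul]
  ring

theorem nrd_star (a : ℍ[R,c,t]) : nrd (star a) = nrd a := by
  simp [nrd_eq]

theorem nrd_one : nrd (1 : ℍ[R,c,t]) = 1 := by
  simp [nrd_eq]

theorem mul_star_eq (a : ℍ[R,c,t]) : a * star a = algebraMap R _ (nrd a) := by
  ext <;> simp [nrd, QuaternionAlgebra.algebraMap_eq] <;> ring

theorem star_mul_eq (a : ℍ[R,c,t]) : star a * a = algebraMap R _ (nrd a) := by
  ext <;> simp [nrd, QuaternionAlgebra.algebraMap_eq] <;> ring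

theorem nrd_quaternionMap (f : R →+* R') (hc : f c = c') (ht : f t = t') (a : ℍ[R,c,t]) :
    nrd (quaternionMap f hc ht a) = f (nrd a) := by
  simp [nrd_eq, quaternionMap, hc, ht]

theorem star_quaternionMap (f : R →+* R') (hc : f c = c') (ht : f t = t') (a : ℍ[R,c,t]) :
    star (quaternionMap f hc ht a) = quaternionMap f hc ht (star a) := by
  ext <;> simp [quaternionMap]

theorem quaternionMap_smul (f : R →+* R') (hc : f c = c') (ht : f t = t') (r : R) (a : ℍ[R,c,t]) :
    quaternionMap f hc ht (r • a) = f r • quaternionMap f hc ht a := by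
  ext <;> simp [quaternionMap]

theorem quaternionMap_injective {f : R →+* R'} (hf : Function.Injective f) (hc : f c = c')
    (ht : f t = t') : Function.Injective (quaternionMap f hc ht) := by
  intro a b h
  have h1 := congrArg QuaternionAlgebra.re h
  have h2 := congrArg QuaternionAlgebra.imI h
  have h3 := congrArg QuaternionAlgebra.imJ h
  have h4 := congrArg QuaternionAlgebra.imK h
  exact QuaternionAlgebra.ext (hf h1) (hf h2) (hf h3) (hf h4)

end ReducedNorm

section UnitOfNrd

variable {k : Type u} [Field k] {c t : k}

/-- The unit given by a quaternion of nonzero reduced norm. -/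
def unitOfNrd (a : ℍ[k,c,t]) (h : nrd a ≠ 0) : ℍ[k,c,t]ˣ where
  val := a
  inv := (nrd a)⁻¹ • star a
  val_inv := by
    rw [mul_smul_comm, mul_star_eq, Algebra.smul_def, ← map_mul, inv_mul_cancel₀ h, map_one]
  inv_val := by
    rw [smul_mul_assoc, star_mul_eq, Algebra.smul_def, ← map_mul, inv_mul_cancel₀ h, map_one]

theorem nrd_unit_ne_zero (a : ℍ[k,c,t]ˣ) : nrd (a : ℍ[k,c,t]) ≠ 0 := by
  intro h
  have h1 := nrd_mul (a : ℍ[k,c,t]) (↑a⁻¹ : ℍ[k,c,t])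
  rw [Units.mul_inv, nrd_one, h, zero_mul] at h1
  exact one_ne_zero h1

theorem pUnits_mk_eq_iff {a b : ℍ[k,c,t]ˣ} : (QuotientGroup.mk a : PUnits k ℍ[k,c,t]) = QuotientGroup.mk b ↔
    ∃ r : k, r ≠ 0 ∧ r • (a : ℍ[k,c,t]) = b := by
  rw [QuotientGroup.eq]
  constructor
  · rintro ⟨r, hr⟩
    refine ⟨r, r.ne_zero, ?_⟩
    have h1 : b = a * Units.map (algebraMap k ℍ[k,c,t] : k →* ℍ[k,c,t]) r := by
      rw [hr, mul_inv_cancel_left]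
    rw [h1, Units.val_mul, Algebra.smul_def, Algebra.commutes]
    rfl
  · rintro ⟨r, hr, h⟩
    refine ⟨Units.mk0 r hr, ?_⟩
    rw [eq_inv_mul_iff_mul_eq]
    apply Units.ext
    rw [Units.val_mul, ← h, Algebra.smul_def, Algebra.commutes]
    rfl

end UnitOfNrd

/-! ## The local groups -/

section Local

variable {F : Type u} [Field F] {c τ : F}

/-- The inclusion of the local order. -/
def orderMap (c τ : F) : LocalOrder c τ →+* LocalQuat c τ :=
  quaternionMap (algebraMap F⟦X⟧ F⸨X⸩) rfl rfl

theorem algebraMap_laurent_injective : Function.Injective (algebraMap F⟦X⟧ F⸨X⸩) :=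
  IsFractionRing.injective F⟦X⟧ F⸨X⸩

theorem orderMap_injective : Function.Injective (orderMap c τ) :=
  quaternionMap_injective algebraMap_laurent_injective _ _

theorem nrd_orderMap (y : LocalOrder c τ) : nrd (orderMap c τ y) = algebraMap F⟦X⟧ F⸨X⸩ (nrd y) :=
  nrd_quaternionMap _ _ _ y

theorem nrd_orderMap_ne_zero {y : LocalOrder c τ} (h : nrd y ≠ 0) : nrd (orderMap c τ y) ≠ 0 := by
  rw [nrd_orderMap]
  exact fun h1 => h (algebraMap_laurent_injective (h1.trans (map_zero _).symm))

open Classical in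
/-- The class of an element of the local order. -/
def localClass (y : LocalOrder c τ) : LocalPGL c τ :=
  if h : nrd y ≠ 0 then QuotientGroup.mk (unitOfNrd (orderMap c τ y) (nrd_orderMap_ne_zero h)) else 1

theorem localClass_eq_mk {y : LocalOrder c τ} {z : (LocalQuat c τ)ˣ}
    (h : (z : LocalQuat c τ) = orderMap c τ y) : localClass y = QuotientGroup.mk z := by
  have h1 : nrd y ≠ 0 := by
    intro h1
    apply nrd_unit_ne_zero z
    rw [h, nrd_orderMap, h1, map_zero]
  rw [localClass, dif_pos h1]
  congr 1
  exact Units.ext h.symm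

theorem localClass_mul {y z : LocalOrder c τ} (hy : nrd y ≠ 0) (hz : nrd z ≠ 0) :
    localClass (y * z) = localClass y * localClass z := by
  rw [localClass, dif_pos (by rw [nrd_mul]; exact mul_ne_zero hy hz), localClass, dif_pos hy, localClass,
    dif_pos hz, ← QuotientGroup.mk_mul]
  congr 1
  exact Units.ext (map_mul (orderMap c τ) y z)

theorem localClass_one : localClass (1 : LocalOrder c τ) = 1 :=
  localClass_eq_mk (z := 1) (map_one (orderMap c τ)).symm

theorem localClass_eq_iff {y z : LocalOrder c τ} (hy : nrd y ≠ 0) (hz : nrd z ≠ 0) :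
    localClass y = localClass z ↔ ∃ r s : F⟦X⟧, r ≠ 0 ∧ s ≠ 0 ∧ r • y = s • z := by
  rw [localClass, dif_pos hy, localClass, dif_pos hz, pUnits_mk_eq_iff]
  change (∃ r : F⸨X⸩, r ≠ 0 ∧ r • orderMap c τ y = orderMap c τ z) ↔ _
  constructor
  · rintro ⟨q, hq, h⟩
    obtain ⟨r, s, hs, rfl⟩ := IsFractionRing.div_surjective (A := F⟦X⟧) q
    have hs0 : s ≠ 0 := nonZeroDivisors.ne_zero hs
    have hs' : algebraMap F⟦X⟧ F⸨X⸩ s ≠ 0 :=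
      fun h1 => hs0 (algebraMap_laurent_injective (h1.trans (map_zero _).symm))
    refine ⟨r, s, ?_, hs0, ?_⟩
    · rintro rfl
      simp at hq
    · apply orderMap_injective
      rw [orderMap, quaternionMap_smul, quaternionMap_smul]
      change _ • orderMap c τ y = _ • orderMap c τ z
      rw [← h, smul_smul, mul_div_cancel₀ _ hs']
  · rintro ⟨r, s, hr, hs, h⟩
    have hs' : algebraMap F⟦X⟧ F⸨X⸩ s ≠ 0 :=
      fun h1 => hs (algebraMap_laurent_injective (h1.trans (map_zero _).symm))
    have hr' : algebraMap F⟦X⟧ F⸨X⸩ r ≠ 0 :=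
      fun h1 => hr (algebraMap_laurent_injective (h1.trans (map_zero _).symm))
    refine ⟨algebraMap F⟦X⟧ F⸨X⸩ r / algebraMap F⟦X⟧ F⸨X⸩ s, div_ne_zero hr' hs', ?_⟩
    have h1 := congrArg (orderMap c τ) h
    rw [orderMap, quaternionMap_smul, quaternionMap_smul] at h1
    change _ • orderMap c τ y = _ • orderMap c τ z at h1
    rw [div_eq_inv_mul, mul_smul, h1, smul_smul, inv_mul_cancel₀ hs', one_smul]

theorem localClass_smul {r : F⟦X⟧} (hr : r ≠ 0) {y : LocalOrder c τ} (hy : nrd y ≠ 0) :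
    localClass (r • y) = localClass y := by
  have h : nrd (r • y) ≠ 0 := by
    rw [nrd_smul]
    exact mul_ne_zero (pow_ne_zero 2 hr) hy
  rw [localClass_eq_iff h hy]
  exact ⟨1, r, one_ne_zero, hr, one_smul _ _⟩

theorem localClass_star {y : LocalOrder c τ} (hy : nrd y ≠ 0) :
    localClass (star y) = (localClass y)⁻¹ := by
  rw [eq_inv_iff_mul_eq_one, ← localClass_mul (by rwa [nrd_star]) hy, star_mul_eq,
    Algebra.algebraMap_eq_smul_one, localClass_smul hy (by rw [nrd_one]; exact one_ne_zero),
    localClass_one]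

theorem exists_localClass (g : LocalPGL c τ) : ∃ y : LocalOrder c τ, nrd y ≠ 0 ∧ g = localClass y := by
  classical
  obtain ⟨d, rfl⟩ := QuotientGroup.mk_surjective g
  obtain ⟨b, hb⟩ := IsLocalization.exist_integer_multiples_of_finset (nonZeroDivisors F⟦X⟧)
    ({(d : LocalQuat c τ).re, (d : LocalQuat c τ).imI, (d : LocalQuat c τ).imJ,
      (d : LocalQuat c τ).imK} : Finset F⸨X⸩)
  obtain ⟨y0, h0⟩ := hb (d : LocalQuat c τ).re (by simp)
  obtain ⟨y1, h1⟩ := hb (d : LocalQuat c τ).imI (by simp)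
  obtain ⟨y2, h2⟩ := hb (d : LocalQuat c τ).imJ (by simp)
  obtain ⟨y3, h3⟩ := hb (d : LocalQuat c τ).imK (by simp)
  have hb0 : (b : F⟦X⟧) ≠ 0 := nonZeroDivisors.ne_zero b.2
  have hb' : algebraMap F⟦X⟧ F⸨X⸩ b ≠ 0 :=
    fun h1 => hb0 (algebraMap_laurent_injective (h1.trans (map_zero _).symm))
  let y : LocalOrder c τ := ⟨y0, y1, y2, y3⟩
  have hy : orderMap c τ y = algebraMap F⟦X⟧ F⸨X⸩ b • (d : LocalQuat c τ) := by
    rw [Algebra.smul_def] at h0 h1 h2 h3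
    exact QuaternionAlgebra.ext h0 h1 h2 h3
  have hn : nrd y ≠ 0 := by
    intro hn
    have h4 := nrd_orderMap y
    rw [hy, nrd_smul, hn, map_zero] at h4
    exact mul_ne_zero (pow_ne_zero 2 hb') (nrd_unit_ne_zero d) h4
  refine ⟨y, hn, ?_⟩
  rw [localClass, dif_pos hn, pUnits_mk_eq_iff]
  exact ⟨_, hb', hy.symm⟩

theorem mem_localStabilizer_iff {g : LocalPGL c τ} :
    g ∈ localStabilizer c τ ↔ ∃ y : LocalOrder c τ, IsUnit (nrd y) ∧ g = localClass y := by
  constructor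
  · rintro ⟨h, rfl⟩
    obtain ⟨z, rfl⟩ := QuotientGroup.mk_surjective h
    refine ⟨z, ?_, ?_⟩
    · refine .of_mul_eq_one (nrd (↑z⁻¹ : LocalOrder c τ)) ?_
      rw [← nrd_mul, Units.mul_inv, nrd_one]
    · refine (localClass_eq_mk ?_).symm
      rfl
  · rintro ⟨y, ⟨r, hr⟩, rfl⟩
    let z : (LocalOrder c τ)ˣ :=
      { val := y
        inv := (↑r⁻¹ : F⟦X⟧) • star y
        val_inv := by
          rw [mul_smul_comm, mul_star_eq, Algebra.smul_def, ← map_mul, ← hr, Units.inv_mul, map_one]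
        inv_val := by
          rw [smul_mul_assoc, star_mul_eq, Algebra.smul_def, ← map_mul, ← hr, Units.inv_mul, map_one] }
    refine ⟨QuotientGroup.mk z, ?_⟩
    refine (localClass_eq_mk ?_).symm
    rfl

theorem isUniformizerClass_iff {h : LocalPGL c τ} :
    IsUniformizerClass h ↔ ∃ y : LocalOrder c τ, (nrd y).order = 1 ∧ h = localClass y := by
  constructor
  · rintro ⟨y, z, h1, h2, rfl⟩
    exact ⟨y, h1, (localClass_eq_mk h2).symm⟩
  · rintro ⟨y, h1, rfl⟩
    have hy : nrd y ≠ 0 := by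
      intro hy
      rw [hy, PowerSeries.order_zero] at h1
      exact absurd h1 (by simp)
    refine ⟨y, unitOfNrd (orderMap c τ y) (nrd_orderMap_ne_zero hy), h1, rfl, ?_⟩
    exact localClass_eq_mk rfl

end Local

/-! ## The local letters -/

section LocalLetters

variable {F : Type u} [Field F] {c τ : F}

theorem fact_of_not_isSquare (hc : ¬ IsSquare c) : Fact (∀ r : F, r ^ 2 ≠ c + 0 * r) :=
  ⟨fun r h => hc ⟨r, by rw [← sq, h]; ring⟩⟩

/-- The reduction of the local order modulo the maximal ideal of `F⟦X⟧`. -/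
def reduction (c τ : F) : LocalOrder c τ →+* ℍ[F,c,τ] :=
  quaternionMap PowerSeries.constantCoeff (by simp) (by simp)

/-- The element `1 + αF` of the local order. -/
def localLetter (τ : F) (α : QuadExt c) : LocalOrder c τ :=
  ⟨1, 0, PowerSeries.C α.re, PowerSeries.C α.im⟩

theorem nrd_localLetter (α : QuadExt c) : nrd (localLetter τ α) =
    1 - PowerSeries.C (QuadraticAlgebra.norm α) * (PowerSeries.C τ + PowerSeries.X) := by
  simp only [nrd_eq, localLetter, QuadraticAlgebra.norm_def, map_sub, map_add, map_mul, zero_mul]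
  simp
  ring

theorem nrd_localLetter_of_eq {α : QuadExt c} (h : QuadraticAlgebra.norm α * τ = 1) :
    nrd (localLetter τ α) = -(PowerSeries.C (QuadraticAlgebra.norm α) * PowerSeries.X) := by
  rw [nrd_localLetter, mul_add, ← map_mul, h, map_one]
  ring

theorem nrd_localLetter_ne_zero {α : QuadExt c} (h : QuadraticAlgebra.norm α * τ = 1) :
    nrd (localLetter τ α) ≠ 0 := by
  rw [nrd_localLetter_of_eq h, neg_ne_zero]
  refine mul_ne_zero ?_ PowerSeries.X_ne_zero
  rw [Ne, map_eq_zero]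
  exact left_ne_zero_of_mul_eq_one h

theorem isUnit_nrd_localLetter {α : QuadExt c} (h : QuadraticAlgebra.norm α * τ ≠ 1) :
    IsUnit (nrd (localLetter τ α)) := by
  rw [PowerSeries.isUnit_iff_constantCoeff, nrd_localLetter]
  simp only [map_sub, map_one, map_mul, map_add, PowerSeries.constantCoeff_C,
    PowerSeries.constantCoeff_X, add_zero]
  exact (sub_ne_zero.2 h.symm).isUnit

theorem nrd_reduction (y : LocalOrder c τ) :
    nrd (reduction c τ y) = PowerSeries.constantCoeff (nrd y) := nrd_quaternionMap _ _ _ y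

theorem exists_smul_of_reduction_eq_zero {y : LocalOrder c τ} (h : reduction c τ y = 0) :
    ∃ z : LocalOrder c τ, y = (PowerSeries.X : F⟦X⟧) • z := by
  obtain ⟨z0, h0⟩ := PowerSeries.X_dvd_iff.2 (congrArg QuaternionAlgebra.re h)
  obtain ⟨z1, h1⟩ := PowerSeries.X_dvd_iff.2 (congrArg QuaternionAlgebra.imI h)
  obtain ⟨z2, h2⟩ := PowerSeries.X_dvd_iff.2 (congrArg QuaternionAlgebra.imJ h)
  obtain ⟨z3, h3⟩ := PowerSeries.X_dvd_iff.2 (congrArg QuaternionAlgebra.imK h)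
  exact ⟨⟨z0, z1, z2, z3⟩, QuaternionAlgebra.ext h0 h1 h2 h3⟩

theorem smul_order_cancel {r : F⟦X⟧} (hr : r ≠ 0) {y z : LocalOrder c τ} (h : r • y = r • z) :
    y = z :=
  QuaternionAlgebra.ext (mul_left_cancel₀ hr (congrArg QuaternionAlgebra.re h))
    (mul_left_cancel₀ hr (congrArg QuaternionAlgebra.imI h))
    (mul_left_cancel₀ hr (congrArg QuaternionAlgebra.imJ h))
    (mul_left_cancel₀ hr (congrArg QuaternionAlgebra.imK h))

theorem reduction_smul (r : F⟦X⟧) (y : LocalOrder c τ) :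
    reduction c τ (r • y) = PowerSeries.constantCoeff r • reduction c τ y :=
  quaternionMap_smul _ _ _ r y

/-- An element of the order that is primitive and not a unit has a left factor `1 + αF`. -/
theorem exists_localLetter_mul (hc : ¬ IsSquare c) (hτ : τ ≠ 0) {y : LocalOrder c τ}
    (hn : PowerSeries.constantCoeff (nrd y) = 0) (hy : reduction c τ y ≠ 0) :
    ∃ α : QuadExt c, QuadraticAlgebra.norm α * τ = 1 ∧ ∃ z, y = localLetter τ α * z := by
  have := fact_of_not_isSquare hc
  set w := reduction c τ y with hw
  rw [← nrd_reduction, ← hw, nrd_eq] at hn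
  -- The reduction of y is a + bF with F² = τ. Its reduced norm vanishes, so N(a) = τN(b), and a = 0
  -- would imply b = 0.
  let a : QuadExt c := ⟨w.re, w.imI⟩
  let b : QuadExt c := ⟨w.imJ, w.imK⟩
  have hab : QuadraticAlgebra.norm a = τ * QuadraticAlgebra.norm b := by
    simp only [QuadraticAlgebra.norm_def, a, b]
    linear_combination hn
  have ha : a ≠ 0 := by
    intro ha
    rw [ha, QuadraticAlgebra.norm_zero] at hab
    have hb : b = 0 := QuadraticAlgebra.norm_eq_zero_iff_eq_zero.1
      ((mul_eq_zero.1 hab.symm).resolve_left hτ)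
    exact hy (QuaternionAlgebra.ext (congrArg QuadraticAlgebra.re ha)
      (congrArg QuadraticAlgebra.im ha) (congrArg QuadraticAlgebra.re hb)
      (congrArg QuadraticAlgebra.im hb))
  have ha' : star a ≠ 0 := star_ne_zero.2 ha
  have hna : QuadraticAlgebra.norm a ≠ 0 := fun h => ha (QuadraticAlgebra.norm_eq_zero_iff_eq_zero.1 h)
  -- Since (1 + αF)a = a + αāF, comparison with a + bF forces this value.
  let α : QuadExt c := b / star a
  have hα : α * star a = b := div_mul_cancel₀ b ha'
  have hα' : a = algebraMap F (QuadExt c) τ * α * star b := by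
    apply mul_right_cancel₀ ha'
    rw [← QuadraticAlgebra.algebraMap_norm_eq_mul_star, hab, map_mul,
      QuadraticAlgebra.algebraMap_norm_eq_mul_star]
    linear_combination (-(algebraMap F (QuadExt c) τ) * star b) * hα
  have hnα : QuadraticAlgebra.norm α * τ = 1 := by
    have h1 := congrArg QuadraticAlgebra.norm hα
    rw [map_mul, QuadraticAlgebra.norm_star] at h1
    have h2 : QuadraticAlgebra.norm a * (QuadraticAlgebra.norm α * τ - 1) = 0 := by
      linear_combination τ * h1 - hab
    exact sub_eq_zero.1 ((mul_eq_zero.1 h2).resolve_left hna)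
  refine ⟨α, hnα, ?_⟩
  have e1 := congrArg QuadraticAlgebra.re hα
  have e2 := congrArg QuadraticAlgebra.im hα
  have e3 := congrArg QuadraticAlgebra.re hα'
  have e4 := congrArg QuadraticAlgebra.im hα'
  simp only [QuadraticAlgebra.re_mul, QuadraticAlgebra.im_mul, QuadraticAlgebra.re_star,
    QuadraticAlgebra.im_star, QuadraticAlgebra.algebraMap_re, QuadraticAlgebra.algebraMap_im, a, b]
    at e1 e2 e3 e4
  obtain ⟨z, hz⟩ : ∃ z, star (localLetter τ α) * y = (PowerSeries.X : F⟦X⟧) • z := by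
    apply exists_smul_of_reduction_eq_zero
    have h1 : reduction c τ (star (localLetter τ α)) = ⟨1, 0, -α.re, -α.im⟩ := by
      ext <;> simp [reduction, quaternionMap, localLetter]
    rw [map_mul, h1, ← hw]
    ext
    · simp only [QuaternionAlgebra.re_mul, QuaternionAlgebra.re_zero]
      linear_combination e3
    · simp only [QuaternionAlgebra.imI_mul, QuaternionAlgebra.imI_zero]
      linear_combination e4
    · simp only [QuaternionAlgebra.imJ_mul, QuaternionAlgebra.imJ_zero]
      linear_combination -e1
    · simp only [QuaternionAlgebra.imK_mul, QuaternionAlgebra.imK_zero]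
      linear_combination -e2
  -- The conjugate of the letter times y is Xz, and the reduced norm of the letter is -N(α)X.
  -- Cancelling X leaves the factor -N(α), whose inverse is -τ.
  refine ⟨-(PowerSeries.C τ : F⟦X⟧) • z, ?_⟩
  apply smul_order_cancel (PowerSeries.X_ne_zero (R := F))
  have h2 : nrd (localLetter τ α) • y = (PowerSeries.X : F⟦X⟧) • (localLetter τ α * z) := by
    rw [Algebra.smul_def, ← mul_star_eq, mul_assoc, hz, mul_smul_comm]
  rw [mul_smul_comm, smul_comm, ← h2, nrd_localLetter_of_eq hnα, smul_smul, neg_mul_neg, ← mul_assoc,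
    ← map_mul, mul_comm τ, hnα, map_one, one_mul]

theorem nrd_prod_localLetter_ne_zero (l : List (QuadExt c))
    (h : ∀ α ∈ l, QuadraticAlgebra.norm α * τ = 1) : nrd ((l.map (localLetter τ)).prod) ≠ 0 := by
  induction l with
  | nil =>
    rw [List.map_nil, List.prod_nil, nrd_one]
    exact one_ne_zero
  | cons α l ih =>
    rw [List.map_cons, List.prod_cons, nrd_mul]
    exact mul_ne_zero (nrd_localLetter_ne_zero (h α List.mem_cons_self))
      (ih fun β hβ => h β (List.mem_cons_of_mem α hβ))

theorem prod_localClass (l : List (QuadExt c)) (h : ∀ α ∈ l, QuadraticAlgebra.norm α * τ = 1) :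
    (l.map fun α => localClass (localLetter τ α)).prod = localClass (l.map (localLetter τ)).prod := by
  induction l with
  | nil => exact localClass_one.symm
  | cons α l ih =>
    have h1 : ∀ β ∈ l, QuadraticAlgebra.norm β * τ = 1 := fun β hβ => h β (List.mem_cons_of_mem α hβ)
    rw [List.map_cons, List.prod_cons, ih h1, List.map_cons, List.prod_cons,
      localClass_mul (nrd_localLetter_ne_zero (h α List.mem_cons_self))
        (nrd_prod_localLetter_ne_zero l h1)]

/-- Induction on the order of the reduced norm. An element of unit norm lies in the stabilizer, an
element divisible by the uniformizer is divided by it without changing its class, and in the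
remaining case a letter is split off. Each of the last two steps lowers the order. -/
theorem exists_prod_localLetter (hc : ¬ IsSquare c) (hτ : τ ≠ 0) {y : LocalOrder c τ}
    (hy : nrd y ≠ 0) : ∃ l : List (QuadExt c), (∀ α ∈ l, QuadraticAlgebra.norm α * τ = 1) ∧
      ∃ g ∈ localStabilizer c τ,
        localClass y = (l.map fun α => localClass (localLetter τ α)).prod * g := by
  have key : ∀ (n : ℕ) (y : LocalOrder c τ), ¬ (PowerSeries.X : F⟦X⟧) ^ n ∣ nrd y →
      ∃ l : List (QuadExt c), (∀ α ∈ l, QuadraticAlgebra.norm α * τ = 1) ∧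
      ∃ g ∈ localStabilizer c τ,
        localClass y = (l.map fun α => localClass (localLetter τ α)).prod * g := by
    intro n
    induction n with
    | zero => exact fun y h => absurd (by rw [pow_zero]; exact one_dvd _) h
    | succ n ih =>
      intro y hy
      by_cases hn : PowerSeries.constantCoeff (nrd y) = 0
      swap
      · refine ⟨[], by simp, localClass y, mem_localStabilizer_iff.2 ⟨y, ?_, rfl⟩, by simp⟩
        rw [PowerSeries.isUnit_iff_constantCoeff]
        exact Ne.isUnit hn
      by_cases hr : reduction c τ y = 0
      · obtain ⟨z, rfl⟩ := exists_smul_of_reduction_eq_zero hr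
        rw [nrd_smul] at hy
        have hz : ¬ (PowerSeries.X : F⟦X⟧) ^ n ∣ nrd z := by
          intro h
          apply hy
          rw [pow_succ', sq, mul_assoc]
          exact mul_dvd_mul_left _ (h.mul_left _)
        have hz0 : nrd z ≠ 0 := fun h => hz (h ▸ dvd_zero _)
        rw [localClass_smul PowerSeries.X_ne_zero hz0]
        exact ih z hz
      · obtain ⟨α, hα, z, rfl⟩ := exists_localLetter_mul hc hτ hn hr
        rw [nrd_mul, nrd_localLetter_of_eq hα] at hy
        have hz : ¬ (PowerSeries.X : F⟦X⟧) ^ n ∣ nrd z := by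
          intro h
          apply hy
          rw [pow_succ']
          exact mul_dvd_mul ((Dvd.intro_left _ rfl).neg_right) h
        have hz0 : nrd z ≠ 0 := fun h => hz (h ▸ dvd_zero _)
        obtain ⟨l, hl, g, hg, e⟩ := ih z hz
        refine ⟨α :: l, ?_, g, hg, ?_⟩
        · intro β hβ
          rcases List.mem_cons.1 hβ with rfl | hβ
          · exact hα
          · exact hl β hβ
        · rw [localClass_mul (nrd_localLetter_ne_zero hα) hz0, e, List.map_cons, List.prod_cons,
            mul_assoc]
  have h1 : ∃ n, ¬ (PowerSeries.X : F⟦X⟧) ^ n ∣ nrd y := by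
    by_contra! hall
    apply hy
    ext n
    exact PowerSeries.X_pow_dvd_iff.1 (hall (n + 1)) n (Nat.lt_succ_self n)
  obtain ⟨n, hn⟩ := h1
  exact key n y hn

/-- Reduced products of letters are primitive. -/
theorem reduction_prod_localLetter (hc : ¬ IsSquare c) (α : QuadExt c) (l : List (QuadExt c))
    (h : ∀ β ∈ α :: l, QuadraticAlgebra.norm β * τ = 1)
    (hl : (α :: l).IsChain fun β γ => γ ≠ -β) : ∃ u : QuadExt c, u ≠ 0 ∧
      reduction c τ ((α :: l).map (localLetter τ)).prod =
        ⟨1, 0, α.re, α.im⟩ * (⟨u.re, u.im, 0, 0⟩ : ℍ[F,c,τ]) := by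
  have := fact_of_not_isSquare hc
  have hred : ∀ β : QuadExt c, reduction c τ (localLetter τ β) = ⟨1, 0, β.re, β.im⟩ := by
    intro β
    ext <;> simp [reduction, quaternionMap, localLetter]
  induction l generalizing α with
  | nil =>
    refine ⟨1, one_ne_zero, ?_⟩
    rw [List.map_cons, List.map_nil, List.prod_cons, List.prod_nil, mul_one, hred]
    ext <;> simp [QuadraticAlgebra.re_one, QuadraticAlgebra.im_one]
  | cons β l ih =>
    obtain ⟨u, hu, e⟩ := ih β (fun γ hγ => h γ (List.mem_cons_of_mem α hγ)) hl.tail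
    have hα := h α List.mem_cons_self
    rw [QuadraticAlgebra.norm_def] at hα
    -- In the reduced algebra (1 + αF)(1 + βF) = (1 + αF)v, because αv̄ = α + τN(α)β = α + β. As
    -- N(β)τ = 1, the factor v vanishes only for β = -α, which reducedness excludes.
    let v : QuadExt c := 1 + algebraMap F (QuadExt c) τ * α * star β
    have hv1 : v.re = 1 + τ * (α.re * β.re - c * α.im * β.im) := by
      simp [v, QuadraticAlgebra.re_one]
      ring
    have hv2 : v.im = τ * (α.im * β.re - α.re * β.im) := by
      simp [v, QuadraticAlgebra.im_one]
      ring
    have hv : v ≠ 0 := by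
      intro hv
      have h1 : v.re = 0 := congrArg QuadraticAlgebra.re hv
      have h2 : v.im = 0 := congrArg QuadraticAlgebra.im hv
      rw [hv1] at h1
      rw [hv2] at h2
      apply (List.isChain_cons_cons.1 hl).1
      ext
      · rw [QuadraticAlgebra.re_neg]
        linear_combination α.re * h1 - c * α.im * h2 - β.re * hα
      · rw [QuadraticAlgebra.im_neg]
        linear_combination α.im * h1 - α.re * h2 - β.im * hα
    refine ⟨v * u, mul_ne_zero hv hu, ?_⟩
    rw [List.map_cons, List.prod_cons, map_mul, e, hred, ← mul_assoc]
    have h3 : (⟨1, 0, α.re, α.im⟩ * ⟨1, 0, β.re, β.im⟩ : ℍ[F,c,τ]) =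
        ⟨1, 0, α.re, α.im⟩ * ⟨v.re, v.im, 0, 0⟩ := by
      rw [hv1, hv2]
      ext
      · simp only [QuaternionAlgebra.re_mul]
        ring
      · simp only [QuaternionAlgebra.imI_mul]
        ring
      · simp only [QuaternionAlgebra.imJ_mul]
        linear_combination -β.re * hα
      · simp only [QuaternionAlgebra.imK_mul]
        linear_combination -β.im * hα
    have h4 : (⟨v.re, v.im, 0, 0⟩ * ⟨u.re, u.im, 0, 0⟩ : ℍ[F,c,τ]) =
        ⟨(v * u).re, (v * u).im, 0, 0⟩ := by
      ext <;> simp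
    rw [h3, mul_assoc, h4]

/-- Infinite descent. In an equation rP = sy with P the product of the letters and y of unit norm,
comparison of norms shows that X divides s, and then X divides r because P is primitive. Division by
X gives another such equation, which is impossible for r ≠ 0. -/
theorem prod_localClass_notMem (hc : ¬ IsSquare c) (l : List (QuadExt c)) (hne : l ≠ [])
    (h : ∀ α ∈ l, QuadraticAlgebra.norm α * τ = 1) (hl : l.IsChain fun β γ => γ ≠ -β) :
    (l.map fun α => localClass (localLetter τ α)).prod ∉ localStabilizer c τ := by
  rw [prod_localClass l h, mem_localStabilizer_iff]
  rintro ⟨y, hy, e⟩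
  rw [localClass_eq_iff (nrd_prod_localLetter_ne_zero l h) hy.ne_zero] at e
  obtain ⟨r, s, hr, hs, e⟩ := e
  cases l with
  | nil => exact hne rfl
  | cons α l =>
    obtain ⟨u, hu, hred⟩ := reduction_prod_localLetter hc α l h hl
    have hP : reduction c τ ((α :: l).map (localLetter τ)).prod ≠ 0 := by
      intro h0
      rw [hred] at h0
      apply hu
      ext
      · simpa using congrArg QuaternionAlgebra.re h0
      · simpa using congrArg QuaternionAlgebra.imI h0
    have hnP : PowerSeries.constantCoeff (nrd ((α :: l).map (localLetter τ)).prod) = 0 := by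
      rw [List.map_cons, List.prod_cons, nrd_mul, nrd_localLetter_of_eq (h α List.mem_cons_self)]
      simp
    set P := ((α :: l).map (localLetter τ)).prod
    have hy' : PowerSeries.constantCoeff (nrd y) ≠ 0 :=
      (PowerSeries.isUnit_iff_constantCoeff.1 hy).ne_zero
    have main : ∀ (n : ℕ) (r s : F⟦X⟧), ¬ (PowerSeries.X : F⟦X⟧) ^ n ∣ r → r • P = s • y → False := by
      intro n
      induction n with
      | zero => exact fun r s h _ => h (by rw [pow_zero]; exact one_dvd _)
      | succ n ih =>
        intro r s hr e
        have e1 := congrArg (reduction c τ) e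
        rw [reduction_smul, reduction_smul] at e1
        have e2 := congrArg (fun z => PowerSeries.constantCoeff (nrd z)) e
        simp only [nrd_smul, map_mul, map_pow, hnP, mul_zero] at e2
        have hs : PowerSeries.constantCoeff s = 0 :=
          eq_zero_of_pow_eq_zero ((mul_eq_zero.1 e2.symm).resolve_right hy')
        rw [hs, zero_smul] at e1
        have hr0 := (smul_eq_zero.1 e1).resolve_right hP
        obtain ⟨r', rfl⟩ := PowerSeries.X_dvd_iff.2 hr0
        obtain ⟨s', rfl⟩ := PowerSeries.X_dvd_iff.2 hs
        refine ih r' s' (fun h => hr ?_) ?_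
        · rw [pow_succ']
          exact mul_dvd_mul_left _ h
        · rw [mul_smul, mul_smul] at e
          exact smul_order_cancel PowerSeries.X_ne_zero e
    have h1 : ∃ n, ¬ (PowerSeries.X : F⟦X⟧) ^ n ∣ r := by
      by_contra! hall
      apply hr
      ext n
      exact PowerSeries.X_pow_dvd_iff.1 (hall (n + 1)) n (Nat.lt_succ_self n)
    obtain ⟨n, hn⟩ := h1
    exact main n r s hn e

theorem mk_mul_stabilizer {g h : LocalPGL c τ} (hh : h ∈ localStabilizer c τ) :
    (QuotientGroup.mk (g * h) : BTVertex c τ) = QuotientGroup.mk g :=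
  QuotientGroup.mk_mul_of_mem g hh

/-- The reduced norm of the product of representatives has order 1, so the product is primitive and
has a letter as left factor. The letter uses up the order, so the cofactor has unit norm and fixes
the standard vertex. -/
theorem exists_localLetter_of_isUniformizerClass (hc : ¬ IsSquare c) (hτ : τ ≠ 0) {g h : LocalPGL c τ}
    (hg : g ∈ localStabilizer c τ) (hh : IsUniformizerClass h) :
    ∃ α : QuadExt c, QuadraticAlgebra.norm α * τ = 1 ∧
      (QuotientGroup.mk (g * h) : BTVertex c τ) = QuotientGroup.mk (localClass (localLetter τ α)) := by
  obtain ⟨u, hu, rfl⟩ := mem_localStabilizer_iff.1 hg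
  obtain ⟨y, hy, rfl⟩ := isUniformizerClass_iff.1 hh
  have hy0 : nrd y ≠ 0 := by
    intro h0
    rw [h0, PowerSeries.order_zero] at hy
    exact absurd hy (by simp)
  have ho : (nrd (u * y)).order = 1 := by
    rw [nrd_mul, PowerSeries.order_mul, hy, PowerSeries.order_zero_of_unit hu, zero_add]
  rw [← localClass_mul hu.ne_zero hy0]
  have h1 : PowerSeries.constantCoeff (nrd (u * y)) = 0 := by
    rw [← PowerSeries.order_ne_zero_iff_constCoeff_eq_zero, ho]
    exact one_ne_zero
  have h2 : reduction c τ (u * y) ≠ 0 := by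
    intro h0
    obtain ⟨z, hz⟩ := exists_smul_of_reduction_eq_zero h0
    rw [hz, nrd_smul, PowerSeries.order_mul, PowerSeries.order_X_pow] at ho
    have h3 : ((2 : ℕ) : ℕ∞) ≤ 1 := ho ▸ le_self_add
    exact absurd h3 (by decide)
  obtain ⟨α, hα, z, hz⟩ := exists_localLetter_mul hc hτ h1 h2
  refine ⟨α, hα, ?_⟩
  have hα0 := nrd_localLetter_ne_zero hα
  have hz' : IsUnit (nrd z) := by
    rw [PowerSeries.isUnit_iff_constantCoeff, isUnit_iff_ne_zero]
    intro h0
    rw [hz, nrd_mul, PowerSeries.order_mul] at ho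
    have h3 : (nrd z).order ≠ 0 := PowerSeries.order_ne_zero_iff_constCoeff_eq_zero.2 h0
    have h4 : (nrd (localLetter τ α)).order ≠ 0 := by
      rw [PowerSeries.order_ne_zero_iff_constCoeff_eq_zero, nrd_localLetter_of_eq hα]
      simp
    have h5 : (1 : ℕ∞) + 1 ≤ 1 := by
      nth_rw 3 [← ho]
      exact add_le_add (Order.one_le_iff_pos.2 (pos_iff_ne_zero.2 h4))
        (Order.one_le_iff_pos.2 (pos_iff_ne_zero.2 h3))
    exact absurd h5 (by decide)
  rw [hz, localClass_mul hα0 hz'.ne_zero]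
  exact mk_mul_stabilizer (mem_localStabilizer_iff.2 ⟨z, hz', rfl⟩)

theorem isUniformizerClass_inv {h : LocalPGL c τ} (hh : IsUniformizerClass h) :
    IsUniformizerClass h⁻¹ := by
  obtain ⟨y, hy, rfl⟩ := isUniformizerClass_iff.1 hh
  have hy0 : nrd y ≠ 0 := by
    intro h0
    rw [h0, PowerSeries.order_zero] at hy
    exact absurd hy (by simp)
  exact isUniformizerClass_iff.2 ⟨star y, by rwa [nrd_star], (localClass_star hy0).symm⟩

/-- Conjugation preserves reduced norms and inverts classes, so the inverse of a uniformizer class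
is one too. Both directions of the relation behind the graph therefore give the same neighbours. -/
theorem btGraph_adj_std (hc : ¬ IsSquare c) (hτ : τ ≠ 0) (v : BTVertex c τ) :
    (btGraph c τ).Adj (stdVertex c τ) v ↔ ∃ α : QuadExt c, QuadraticAlgebra.norm α * τ = 1 ∧
      QuotientGroup.mk (localClass (localLetter τ α)) = v := by
  have hstd : ∀ g : LocalPGL c τ, stdVertex c τ = QuotientGroup.mk g ↔ g ∈ localStabilizer c τ := by
    intro g
    rw [stdVertex, QuotientGroup.eq, inv_one, one_mul]
  rw [btGraph, SimpleGraph.fromRel_adj]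
  constructor
  · rintro ⟨-, ⟨g, h, hh, h1, rfl⟩ | ⟨g, h, hh, rfl, h1⟩⟩
    · obtain ⟨α, hα, e⟩ := exists_localLetter_of_isUniformizerClass hc hτ ((hstd g).1 h1) hh
      exact ⟨α, hα, e.symm⟩
    · obtain ⟨α, hα, e⟩ := exists_localLetter_of_isUniformizerClass hc hτ ((hstd _).1 h1)
        (isUniformizerClass_inv hh)
      rw [mul_inv_cancel_right] at e
      exact ⟨α, hα, e.symm⟩
  · rintro ⟨α, hα, rfl⟩
    refine ⟨?_, Or.inl ⟨1, localClass (localLetter τ α), ?_, rfl, by rw [one_mul]⟩⟩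
    · rw [Ne, hstd]
      have := prod_localClass_notMem hc [α] (by simp) (by simpa using hα) (List.IsChain.singleton _)
      simpa using this
    · refine isUniformizerClass_iff.2 ⟨localLetter τ α, ?_, rfl⟩
      have h1 : PowerSeries.C (QuadraticAlgebra.norm α) ≠ 0 := by
        rw [Ne, map_eq_zero]
        exact left_ne_zero_of_mul_eq_one hα
      have h2 : IsUnit (PowerSeries.C (QuadraticAlgebra.norm α)) := by
        rw [PowerSeries.isUnit_iff_constantCoeff, PowerSeries.constantCoeff_C]
        exact (left_ne_zero_of_mul_eq_one hα).isUnit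
      rw [nrd_localLetter_of_eq hα, PowerSeries.order_neg, PowerSeries.order_mul,
        PowerSeries.order_zero_of_unit h2, PowerSeries.order_X, zero_add]

end LocalLetters

/-! ## Pairs of letters -/

/-- Letters of a simply transitive group without `2`-torsion on a product of trees. -/
structure SimpleData {ι : Type u} {V : ι → Type v} {T : ∀ i, SimpleGraph (V i)} {Γ : Type w} [Group Γ]
    (x : ∀ i, V i) (ρ : Γ →* ∀ i, T i ≃g T i) {A : Type*} (S : LetterSystem ι A) (val : A → Γ) :
    Prop where
  val_inv : ∀ a, val (S.inv a) = (val a)⁻¹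
  closure_range : Subgroup.closure (Set.range val) = ⊤
  exchange : ∀ a b, S.ty a ≠ S.ty b → ∃ b' a', S.ty b' = S.ty b ∧ S.ty a' = S.ty a ∧
    val a * val b = val b' * val a'
  fix : ∀ a i, S.ty a ≠ i → ρ (val a) i (x i) = x i
  adj : ∀ i y, (T i).Adj (x i) y ↔ ∃ a, S.ty a = i ∧ ρ (val a) i (x i) = y
  free : ∀ i l, S.IsWord i l → l ≠ [] → ρ (LetterSystem.wordProd val l) i (x i) ≠ x i
  transitive : ∀ i y, ∃ l : List A, (∀ a ∈ l, S.ty a = i) ∧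
    ρ (LetterSystem.wordProd val l) i (x i) = y
  torsion : ∀ g : Γ, g * g = 1 → g = 1
  exists_letter : ∀ i, ∃ a, S.ty a = i

namespace SimpleData

open LetterSystem

variable {ι : Type u} {V : ι → Type v} {T : ∀ i, SimpleGraph (V i)} {Γ : Type w} [Group Γ]
variable {x : ∀ i, V i} {ρ : Γ →* ∀ i, T i ≃g T i} {A : Type*} {S : LetterSystem ι A} {val : A → Γ}
variable (D : SimpleData x ρ S val)

include D

theorem isTree (i : ι) : (T i).IsTree :=
  isTree_of_free (r := (Pi.evalMonoidHom _ i).comp ρ) D.val_inv (D.free i) (D.adj i) (D.transitive i)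

theorem letter_eq {a a' : A} (h : S.ty a = S.ty a')
    (e : ρ (val a) (S.ty a) (x (S.ty a)) = ρ (val a') (S.ty a) (x (S.ty a))) : a = a' := by
  have h1 : [a] = [a'] := by
    refine word_eq_of_apply_eq (r := (Pi.evalMonoidHom _ (S.ty a)).comp ρ) D.val_inv (D.free (S.ty a))
      (S.isWord_singleton a) (h ▸ S.isWord_singleton a') ?_
    rw [wordProd_cons, wordProd_cons, wordProd_nil, mul_one, mul_one]
    exact e
  exact (List.cons.inj h1).1

end SimpleData

section Pairs

open LetterSystem

variable {ι : Type u} {A : Type v} {S : LetterSystem ι A} {L : Type*}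

/-- The pairs of letters of the same type. -/
abbrev LetterSystem.Pair (S : LetterSystem ι A) : Type v := {p : A × A // S.ty p.1 = S.ty p.2}

/-- The alphabet of pairs of letters of the same type. -/
def pairSystem (e : L ≃ S.Pair) : LetterSystem ι L where
  ty l := S.ty (e l).1.1
  inv l := e.symm ⟨(S.inv (e l).1.1, S.inv (e l).1.2), by rw [S.ty_inv, S.ty_inv, (e l).2]⟩
  inv_inv l := by
    rw [Equiv.symm_apply_eq]
    apply Subtype.ext
    simp [S.inv_inv]
  ty_inv l := by simp [S.ty_inv]

theorem pairSystem_inv (e : L ≃ S.Pair) (l : L) : (e ((pairSystem e).inv l)).1 =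
    (S.inv (e l).1.1, S.inv (e l).1.2) := by
  simp [pairSystem]

/-- The stabilizer of the base point of a factor. -/
def pointStabilizer {V : ι → Type*} {T : ∀ i, SimpleGraph (V i)} {Γ : Type w} [Group Γ]
    (x : ∀ i, V i) (ρ : Γ →* ∀ i, T i ≃g T i) (i : ι) : Subgroup Γ where
  carrier := {g | ρ g i (x i) = x i}
  one_mem' := by
    change ρ 1 i (x i) = x i
    rw [map_one]
    rfl
  mul_mem' {g h} hg hh := by
    change ρ (g * h) i (x i) = x i
    rw [map_mul]
    change ρ g i (ρ h i (x i)) = x i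
    rw [hh, hg]
  inv_mem' {g} hg := by
    change ρ g⁻¹ i (x i) = x i
    have h : ρ g i (x i) = x i := hg
    nth_rw 1 [← h]
    change (ρ g⁻¹ * ρ g) i (x i) = x i
    rw [← map_mul, inv_mul_cancel, map_one]
    rfl

variable {V : ι → Type*} {T : ∀ i, SimpleGraph (V i)} {Γ : Type w} [Group Γ]
variable {x : ∀ i, V i} {ρ : Γ →* ∀ i, T i ≃g T i} {val : A → Γ} (D : SimpleData x ρ S val)

/-- The pairs of letters as elements of `Γ × Γ`. -/
def SimpleData.pairExchange (e : L ≃ S.Pair) : (pairSystem e).ExchangeData (Γ × Γ) where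
  val l := (val (e l).1.1, val (e l).1.2)
  val_inv l := by
    rw [pairSystem_inv]
    exact Prod.ext (D.val_inv _) (D.val_inv _)
  exchange a b h := by
    obtain ⟨b₁, a₁, h1, h2, h3⟩ := D.exchange (e a).1.1 (e b).1.1 h
    obtain ⟨b₂, a₂, h4, h5, h6⟩ := D.exchange (e a).1.2 (e b).1.2 (by
      rw [← (e a).2, ← (e b).2]
      exact h)
    refine ⟨e.symm ⟨(b₁, b₂), by rw [h1, h4, (e b).2]⟩, e.symm ⟨(a₁, a₂), by rw [h2, h5, (e a).2]⟩,
      ?_, ?_, ?_⟩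
    · simpa [pairSystem] using h1
    · simpa [pairSystem] using h2
    · simp only [Equiv.apply_symm_apply]
      exact Prod.ext h3 h6
  stab i := (pointStabilizer x ρ i).prod (pointStabilizer x ρ i)
  val_mem a i h := ⟨D.fix _ i h, D.fix _ i (by rw [← (e a).2]; exact h)⟩
  separated a a' h h' := by
    have key : ∀ (g g' : Γ) (i : ι), g⁻¹ * g' ∈ pointStabilizer x ρ i → ρ g i (x i) = ρ g' i (x i) := by
      intro g g' i h
      change ρ (g⁻¹ * g') i (x i) = x i at h
      nth_rw 1 [← h]
      change (ρ g * ρ (g⁻¹ * g')) i (x i) = _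
      rw [← map_mul, mul_inv_cancel_left]
    apply e.injective
    apply Subtype.ext
    refine Prod.ext (D.letter_eq h (key _ _ _ h'.1)) (D.letter_eq ?_ ?_)
    · rw [← (e a).2, ← (e a').2]
      exact h
    · rw [← (e a).2]
      exact key _ _ _ h'.2

theorem SimpleData.doubleData [Finite ι] (e : L ≃ S.Pair) : DoubleData x ρ (D.pairExchange e) where
  adj_fst a := (D.adj _ _).2 ⟨_, rfl, rfl⟩
  adj_snd a := (D.adj _ _).2 ⟨(e a).1.2, (e a).2.symm, rfl⟩
  mem_stab i m := Iff.rfl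
  neighbour i y y' h h' := by
    obtain ⟨a, ha, h1⟩ := (D.adj _ _).1 h
    obtain ⟨a', ha', h1'⟩ := (D.adj _ _).1 h'
    refine ⟨e.symm ⟨(a, a'), ha.trans ha'.symm⟩, ?_, ?_, ?_⟩
    · simpa [pairSystem] using ha
    · simpa [pairExchange] using h1
    · simpa [pairExchange] using h1'
  torsion := D.torsion
  transitive y := S.exists_translate ρ x D.fix D.transitive y
  free g hg := by
    obtain ⟨l, rfl⟩ := S.exists_wordProd D.val_inv D.closure_range g
    exact S.eq_one_of_fix D.val_inv D.exchange ρ x D.fix D.free l hg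
  exists_letter i := by
    obtain ⟨a, ha⟩ := D.exists_letter i
    exact ⟨e.symm ⟨(a, a), rfl⟩, by simpa [pairSystem] using ha⟩

end Pairs

open LetterSystem

/-! ## The letters of the lattice -/

section Classes

variable {F : Type u} [Field F] {c : F}

theorem toQuat_mul_quatF (α : QuadExt c) :
    α.toQuat * quatF c = ⟨0, 0, RatFunc.C α.re, RatFunc.C α.im⟩ := by
  ext <;> simp [QuadExt.toQuat, quatF]

theorem val_oneAdd (α : QuadExt c) :
    (oneAdd α : Quat c) = ⟨1, 0, RatFunc.C α.re, RatFunc.C α.im⟩ := by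
  change 1 + α.toQuat * quatF c = _
  rw [toQuat_mul_quatF]
  ext <;> simp

theorem cls_injective : Function.Injective (cls : QuadExt c → PGLQuat c) := by
  intro α β h
  obtain ⟨r, -, h⟩ := pUnits_mk_eq_iff.1 h
  rw [val_oneAdd, val_oneAdd] at h
  have h0 : r = 1 := by simpa using congrArg QuaternionAlgebra.re h
  subst h0
  ext
  · exact RatFunc.C_injective (by simpa using congrArg QuaternionAlgebra.imJ h)
  · exact RatFunc.C_injective (by simpa using congrArg QuaternionAlgebra.imK h)

theorem cls_mul_cls_neg (α : QuadExt c) : cls α * cls (-α) = 1 := by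
  have h : QuotientGroup.mk (1 : (Quat c)ˣ) = (QuotientGroup.mk (oneAdd α * oneAdd (-α)) : PGLQuat c) := by
    refine pUnits_mk_eq_iff.2 ⟨_, one_sub_norm_ne_zero α, ?_⟩
    have h1 : (oneAdd (-α) : Quat c) = 1 - α.toQuat * quatF c := by
      rw [val_oneAdd, toQuat_mul_quatF]
      ext <;> simp
    rw [Units.val_mul, h1]
    change _ = (1 + α.toQuat * quatF c) * _
    rw [one_add_mul_one_sub, Units.val_one, Algebra.algebraMap_eq_smul_one]
  exact h.symm

theorem cls_neg (α : QuadExt c) : cls (-α) = (cls α)⁻¹ :=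
  eq_inv_of_mul_eq_one_right (cls_mul_cls_neg α)

/-! ### The exchange of letters at different places -/

section Zeta

theorem add_ne_zero_of_norm_ne {α β : QuadExt c}
    (h : QuadraticAlgebra.norm α ≠ QuadraticAlgebra.norm β) : α + β ≠ 0 := by
  intro h0
  apply h
  rw [eq_neg_of_add_eq_zero_left h0, QuadraticAlgebra.norm_neg]

variable (hc : ¬ IsSquare c)

include hc

/-- In this form, whose denominator is the conjugate of α + β, the norm is visibly that of β, and
exchanging α and β keeps the denominator. -/
theorem zeta_mul {α β : QuadExt c} (hβ : β ≠ 0)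
    (h : QuadraticAlgebra.norm α ≠ QuadraticAlgebra.norm β) :
    zeta α β * β = (α + β) * star β / star (α + β) := by
  have := fact_of_not_isSquare hc
  have h1 : star β ≠ 0 := star_ne_zero.2 hβ
  have h2 : star α + star β ≠ 0 := by
    rw [← star_add]
    exact star_ne_zero.2 (add_ne_zero_of_norm_ne h)
  have h3 : 1 + star α / star β = (star α + star β) / star β := by
    rw [add_div, div_self h1, add_comm]
  have h4 : 1 + α / β = (α + β) / β := by
    rw [add_div, div_self hβ, add_comm]
  rw [zeta, star_add, h3, h4]
  field_simp

theorem norm_zeta_mul {α β : QuadExt c} (hβ : β ≠ 0)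
    (h : QuadraticAlgebra.norm α ≠ QuadraticAlgebra.norm β) :
    QuadraticAlgebra.norm (zeta α β * β) = QuadraticAlgebra.norm β := by
  have := fact_of_not_isSquare hc
  have h2 : star (α + β) ≠ 0 := star_ne_zero.2 (add_ne_zero_of_norm_ne h)
  have h3 : QuadraticAlgebra.norm (star (α + β)) ≠ 0 :=
    fun h => h2 (QuadraticAlgebra.norm_eq_zero_iff_eq_zero.1 h)
  rw [zeta_mul hc hβ h]
  apply mul_right_cancel₀ h3
  rw [← map_mul, div_mul_cancel₀ _ h2, map_mul, QuadraticAlgebra.norm_star, QuadraticAlgebra.norm_star,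
    mul_comm]

/-- Since (1 + αF)(1 + βF) = 1 + αβ̄t + (α + β)F, the identity amounts to α + β = β' + α' and αβ̄ =
β'ᾱ'. It holds already in D before passing to classes. -/
theorem cls_mul_cls {α β : QuadExt c} (hα : α ≠ 0) (hβ : β ≠ 0)
    (h : QuadraticAlgebra.norm α ≠ QuadraticAlgebra.norm β) :
    cls α * cls β = cls (zeta α β * β) * cls (zeta β α * α) := by
  have := fact_of_not_isSquare hc
  set β' := zeta α β * β with hβ'
  set α' := zeta β α * α with hα'
  have h0 := add_ne_zero_of_norm_ne h
  have h2 : star (α + β) ≠ 0 := star_ne_zero.2 h0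
  rw [zeta_mul hc hβ h] at hβ'
  rw [zeta_mul hc hα h.symm, add_comm β α] at hα'
  have e1 : α + β = β' + α' := by
    rw [hβ', hα', ← add_div, ← mul_add, ← star_add, add_comm β α, mul_div_cancel_right₀ _ h2]
  have e2 : α * star β = β' * star α' := by
    rw [hβ', hα', star_div₀, star_mul, star_star, star_star]
    field_simp
  have h3 := congrArg QuadraticAlgebra.re e1
  have h4 := congrArg QuadraticAlgebra.im e1
  have h5 := congrArg QuadraticAlgebra.re e2
  have h6 := congrArg QuadraticAlgebra.im e2
  simp only [QuadraticAlgebra.re_add, QuadraticAlgebra.im_add, QuadraticAlgebra.re_mul,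
    QuadraticAlgebra.im_mul, QuadraticAlgebra.re_star, QuadraticAlgebra.im_star] at h3 h4 h5 h6
  have h3' := congrArg (RatFunc.C (K := F)) h3
  have h4' := congrArg (RatFunc.C (K := F)) h4
  have h5' := congrArg (RatFunc.C (K := F)) h5
  have h6' := congrArg (RatFunc.C (K := F)) h6
  simp only [map_add, map_mul, map_neg, map_zero] at h3' h4' h5' h6'
  have key : oneAdd α * oneAdd β = oneAdd β' * oneAdd α' := by
    apply Units.ext
    rw [Units.val_mul, Units.val_mul, val_oneAdd, val_oneAdd, val_oneAdd, val_oneAdd]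
    ext
    · simp only [QuaternionAlgebra.re_mul]
      linear_combination RatFunc.X * h5'
    · simp only [QuaternionAlgebra.imI_mul]
      linear_combination RatFunc.X * h6'
    · simp only [QuaternionAlgebra.imJ_mul]
      linear_combination h3'
    · simp only [QuaternionAlgebra.imK_mul]
      linear_combination h4'
  exact congrArg (fun z : (Quat c)ˣ => (QuotientGroup.mk z : PGLQuat c)) key

end Zeta

end Classes

section Lattice

variable {F : Type u} [Field F] {c : F} {S₀ : Finset Fˣ}

/-- The letters: the elements `α` with `N(α)⁻¹ ∈ S₀`. -/
abbrev Letter (c : F) (S₀ : Finset Fˣ) : Type u :=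
  {α : QuadExt c // ∃ τ : S₀, QuadraticAlgebra.norm α * ((τ : Fˣ) : F) = 1}

/-- The place of a letter. -/
def Letter.place (a : Letter c S₀) : S₀ := a.2.choose

theorem Letter.norm_mul_place (a : Letter c S₀) :
    QuadraticAlgebra.norm a.1 * ((a.place : Fˣ) : F) = 1 := a.2.choose_spec

theorem Letter.place_eq_iff {a : Letter c S₀} {τ : S₀} :
    a.place = τ ↔ QuadraticAlgebra.norm a.1 * ((τ : Fˣ) : F) = 1 := by
  constructor
  · rintro rfl
    exact a.norm_mul_place
  · intro h
    apply Subtype.ext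
    apply Units.ext
    exact mul_left_cancel₀ (left_ne_zero_of_mul_eq_one h) (a.norm_mul_place.trans h.symm)

theorem Letter.place_eq_place {a b : Letter c S₀} :
    a.place = b.place ↔ QuadraticAlgebra.norm a.1 = QuadraticAlgebra.norm b.1 := by
  refine place_eq_iff.trans ⟨fun h => ?_, fun h => by rw [h, b.norm_mul_place]⟩
  exact mul_right_cancel₀ (Units.ne_zero _) (h.trans b.norm_mul_place.symm)

theorem Letter.ne_zero (a : Letter c S₀) : a.1 ≠ 0 := by
  intro h
  have h1 := a.norm_mul_place
  rw [h, QuadraticAlgebra.norm_zero, zero_mul] at h1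
  exact zero_ne_one h1

/-- The alphabet of the lattice. -/
def latticeLetters (c : F) (S₀ : Finset Fˣ) : LetterSystem S₀ (Letter c S₀) where
  ty := Letter.place
  inv a := ⟨-a.1, by simpa only [QuadraticAlgebra.norm_neg] using a.2⟩
  inv_inv a := Subtype.ext (neg_neg a.1)
  ty_inv a := Letter.place_eq_place.2 (QuadraticAlgebra.norm_neg a.1)

theorem mem_PA_iff {τ : S₀} {g : PGLQuat c} :
    g ∈ PA c (τ : Fˣ) ↔ ∃ a : Letter c S₀, a.place = τ ∧ g = cls a.1 := by
  constructor
  · rintro ⟨α, h, rfl⟩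
    have h1 : QuadraticAlgebra.norm α * ((τ : Fˣ) : F) = 1 := by
      rw [← h, mul_inv_cancel₀]
      intro h0
      rw [h0, inv_zero] at h
      exact Units.ne_zero _ h.symm
    exact ⟨⟨α, τ, h1⟩, Letter.place_eq_iff.2 h1, rfl⟩
  · rintro ⟨a, h, rfl⟩
    exact ⟨a.1, inv_eq_of_mul_eq_one_right (Letter.place_eq_iff.1 h), rfl⟩

theorem cls_mem_latticeΓ (a : Letter c S₀) : cls a.1 ∈ latticeΓ c S₀ := by
  apply Subgroup.subset_closure
  exact Set.mem_biUnion a.place.2 (mem_PA_iff.2 ⟨a, rfl, rfl⟩)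

/-- The letters as elements of the lattice. -/
def letterClass (a : Letter c S₀) : latticeΓ c S₀ := ⟨cls a.1, cls_mem_latticeΓ a⟩

theorem closure_range_letterClass :
    Subgroup.closure (Set.range (letterClass : Letter c S₀ → latticeΓ c S₀)) = ⊤ := by
  apply Subgroup.map_injective (latticeΓ c S₀).subtype_injective
  rw [MonoidHom.map_closure, ← MonoidHom.range_eq_map, Subgroup.range_subtype]
  change _ = Subgroup.closure _
  congr 1
  ext g
  simp only [Set.mem_image, Set.mem_range, exists_exists_eq_and, Set.mem_iUnion]
  constructor
  · rintro ⟨a, rfl⟩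
    exact ⟨a.place, a.place.2, mem_PA_iff.2 ⟨a, rfl, rfl⟩⟩
  · rintro ⟨τ, hτ, h⟩
    obtain ⟨a, -, rfl⟩ := (mem_PA_iff (τ := ⟨τ, hτ⟩)).1 h
    exact ⟨a, rfl⟩

/-- The homomorphism from the global to the local group. -/
def localHom (c τ : F) : PGLQuat c →* LocalPGL c τ :=
  pUnitsMap (localization τ) (localization_C τ c) (localization_X τ)

theorem localHom_cls (τ : F) (α : QuadExt c) : localHom c τ (cls α) = localClass (localLetter τ α) := by
  refine (localClass_eq_mk ?_).symm
  rw [Units.coe_map]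
  change quaternionMap _ (localization_C τ c) (localization_X τ) (oneAdd α : Quat c) = _
  rw [val_oneAdd]
  ext <;> simp [quaternionMap, orderMap, localLetter, localization_C]

theorem latticeAct_std (g : latticeΓ c S₀) (τ : S₀) :
    latticeAct c S₀ g τ (stdPoint c S₀ τ) = QuotientGroup.mk (localHom c (τ : Fˣ) g) := by
  change ((localHom c (τ : Fˣ) g * 1 : LocalPGL c ((τ : Fˣ) : F)) : BTVertex c ((τ : Fˣ) : F)) = _
  rw [mul_one]

theorem mk_eq_std_iff {τ : F} {g : LocalPGL c τ} :
    (QuotientGroup.mk g : BTVertex c τ) = stdVertex c τ ↔ g ∈ localStabilizer c τ := by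
  rw [eq_comm, stdVertex, QuotientGroup.eq, inv_one, one_mul]

theorem localHom_wordProd (τ : F) (l : List (Letter c S₀)) :
    localHom c τ (wordProd letterClass l : latticeΓ c S₀) =
      ((l.map Subtype.val).map fun α => localClass (localLetter τ α)).prod := by
  induction l with
  | nil =>
    rw [wordProd_nil]
    exact map_one _
  | cons a l ih =>
    rw [wordProd_cons, Subgroup.coe_mul, map_mul, ih, List.map_cons, List.map_cons, List.prod_cons]
    congr 1
    exact localHom_cls τ a.1

/-- Elements of the lattice are classes of elements whose real part does not vanish. -/
theorem exists_re_ne_zero (g : latticeΓ c S₀) : ∃ z : (Quat c)ˣ, QuotientGroup.mk z = (g : PGLQuat c) ∧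
    (z : Quat c).re ≠ 0 := by
  let φ : ℍ[Polynomial F,Polynomial.C c,Polynomial.X] →+* Quat c :=
    quaternionMap (algebraMap (Polynomial F) (RatFunc F)) (by simp) (by simp)
  -- Representatives can be taken with polynomial coordinates and with F_q[Z]-part equal to 1 at t =
  -- 0. Products keep this form because F² = t vanishes at t = 0, and inverses are represented by
  -- conjugates.
  have key : ∀ g ∈ latticeΓ c S₀, ∃ (z : (Quat c)ˣ) (y : ℍ[Polynomial F,Polynomial.C c,Polynomial.X]),
      QuotientGroup.mk z = g ∧ (z : Quat c) = φ y ∧ y.re.coeff 0 = 1 ∧ y.imI.coeff 0 = 0 := by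
    intro g hg
    induction hg using Subgroup.closure_induction with
    | mem g hg =>
      simp only [Set.mem_iUnion] at hg
      obtain ⟨τ, hτ, α, -, rfl⟩ := hg
      refine ⟨oneAdd α, ⟨1, 0, Polynomial.C α.re, Polynomial.C α.im⟩, rfl, ?_, by simp, by simp⟩
      rw [val_oneAdd]
      ext <;> simp [φ, quaternionMap]
    | one => exact ⟨1, 1, rfl, (map_one φ).symm, by simp, by simp⟩
    | mul g h _ _ ihg ihh =>
      obtain ⟨z, y, rfl, h1, h2, h3⟩ := ihg
      obtain ⟨z', y', rfl, h1', h2', h3'⟩ := ihh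
      refine ⟨z * z', y * y', rfl, by rw [Units.val_mul, h1, h1', map_mul], ?_, ?_⟩
      · simp [Polynomial.mul_coeff_zero, h2, h3, h2', h3']
      · simp [Polynomial.mul_coeff_zero, h2, h3, h2', h3']
    | inv g _ ih =>
      obtain ⟨z, y, rfl, h1, h2, h3⟩ := ih
      have hn : nrd (star (z : Quat c)) ≠ 0 := by
        rw [nrd_star]
        exact nrd_unit_ne_zero z
      refine ⟨unitOfNrd (star (z : Quat c)) hn, star y, ?_, ?_, by simpa using h2, by simpa using h3⟩
      · rw [eq_inv_iff_mul_eq_one, ← QuotientGroup.mk_mul]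
        refine Eq.symm (pUnits_mk_eq_iff.2 ⟨_, nrd_unit_ne_zero z, ?_⟩)
        change _ = star (z : Quat c) * z
        rw [star_mul_eq, Units.val_one, Algebra.algebraMap_eq_smul_one]
      · change star (z : Quat c) = _
        rw [h1]
        exact star_quaternionMap _ _ _ y
  obtain ⟨z, y, hz, h1, h2, -⟩ := key g g.2
  refine ⟨z, hz, ?_⟩
  intro h0
  rw [h1] at h0
  have h4 : y.re = 0 := (map_eq_zero_iff _ (RatFunc.algebraMap_injective F)).1 h0
  rw [h4] at h2
  simp at h2

/-- If z² is a scalar, the products of 2 re(z) with the other three coordinates of z vanish. Since 2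
re(z) ≠ 0, z is itself a scalar. -/
theorem eq_one_of_mul_self (h2 : (2 : F) ≠ 0) (g : latticeΓ c S₀) (h : g * g = 1) : g = 1 := by
  obtain ⟨z, hz, hre⟩ := exists_re_ne_zero g
  have h1 : (QuotientGroup.mk 1 : PGLQuat c) = QuotientGroup.mk (z * z) := by
    rw [QuotientGroup.mk_mul, hz, ← Subgroup.coe_mul, h]
    rfl
  obtain ⟨r, -, hr⟩ := pUnits_mk_eq_iff.1 h1
  rw [Units.val_mul, Units.val_one] at hr
  have h2' : (2 : RatFunc F) ≠ 0 := by
    intro h0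
    apply h2
    have h3 : (RatFunc.C (2 : F)) = 0 := by rw [map_ofNat, h0]
    exact (map_eq_zero _).1 h3
  have h20 : 2 * (z : Quat c).re ≠ 0 := mul_ne_zero h2' hre
  have e1 : (z : Quat c).imI = 0 := by
    have := congrArg QuaternionAlgebra.imI hr
    simp only [QuaternionAlgebra.imI_smul, QuaternionAlgebra.imI_one, QuaternionAlgebra.imI_mul,
      smul_zero] at this
    exact (mul_eq_zero.1 (show 2 * (z : Quat c).re * (z : Quat c).imI = 0 by
      linear_combination -this)).resolve_left h20
  have e2 : (z : Quat c).imJ = 0 := by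
    have := congrArg QuaternionAlgebra.imJ hr
    simp only [QuaternionAlgebra.imJ_smul, QuaternionAlgebra.imJ_one, QuaternionAlgebra.imJ_mul,
      smul_zero] at this
    exact (mul_eq_zero.1 (show 2 * (z : Quat c).re * (z : Quat c).imJ = 0 by
      linear_combination -this)).resolve_left h20
  have e3 : (z : Quat c).imK = 0 := by
    have := congrArg QuaternionAlgebra.imK hr
    simp only [QuaternionAlgebra.imK_smul, QuaternionAlgebra.imK_one, QuaternionAlgebra.imK_mul,
      smul_zero] at this
    exact (mul_eq_zero.1 (show 2 * (z : Quat c).re * (z : Quat c).imK = 0 by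
      linear_combination -this)).resolve_left h20
  apply Subtype.ext
  rw [← hz]
  refine Eq.symm (pUnits_mk_eq_iff.2 ⟨(z : Quat c).re, hre, ?_⟩)
  rw [Units.val_one]
  ext
  · simp
  · simp [e1]
  · simp [e2]
  · simp [e3]

/-- The form x² - cy² represents every element of a finite field of odd order. This provides letters
at each place. -/
theorem exists_norm_eq [Finite F] (hq : Odd (Nat.card F)) (hc : c ≠ 0) (a : F) :
    ∃ α : QuadExt c, QuadraticAlgebra.norm α = a := by
  cases nonempty_fintype F
  have h1 : (Polynomial.X ^ 2 - Polynomial.C a : Polynomial F).degree = 2 :=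
    Polynomial.degree_X_pow_sub_C (by norm_num) a
  have h2 : (Polynomial.C (-c) * Polynomial.X ^ 2 : Polynomial F).degree = 2 :=
    Polynomial.degree_C_mul_X_pow 2 (neg_ne_zero.2 hc)
  obtain ⟨s, t, h⟩ := FiniteField.exists_root_sum_quadratic h1 h2 (by
    rw [← Nat.card_eq_fintype_card]
    exact Nat.odd_iff.1 hq)
  refine ⟨⟨s, t⟩, ?_⟩
  simp only [Polynomial.eval_sub, Polynomial.eval_pow, Polynomial.eval_X, Polynomial.eval_C,
    Polynomial.eval_mul] at h
  rw [QuadraticAlgebra.norm_def]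
  linear_combination h

theorem two_ne_zero_of_odd [Finite F] (hq : Odd (Nat.card F)) : (2 : F) ≠ 0 := by
  cases nonempty_fintype F
  rw [Nat.card_eq_fintype_card] at hq
  apply Ring.two_ne_zero
  intro h
  have := FiniteField.even_card_of_char_two h
  rw [Nat.odd_iff] at hq
  omega

theorem exchange_letters (hc : ¬ IsSquare c) (a b : Letter c S₀) (h : a.place ≠ b.place) :
    ∃ b' a' : Letter c S₀, b'.1 = zeta a.1 b.1 * b.1 ∧ a'.1 = zeta b.1 a.1 * a.1 ∧
      b'.place = b.place ∧ a'.place = a.place ∧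
      letterClass a * letterClass b = letterClass b' * letterClass a' := by
  have hab : QuadraticAlgebra.norm a.1 ≠ QuadraticAlgebra.norm b.1 := mt Letter.place_eq_place.2 h
  have h1 := norm_zeta_mul hc b.ne_zero hab
  have h2 := norm_zeta_mul hc a.ne_zero hab.symm
  refine ⟨⟨zeta a.1 b.1 * b.1, by rw [h1]; exact b.2⟩, ⟨zeta b.1 a.1 * a.1, by rw [h2]; exact a.2⟩,
    rfl, rfl, Letter.place_eq_place.2 h1, Letter.place_eq_place.2 h2, ?_⟩
  exact Subtype.ext (cls_mul_cls hc a.ne_zero b.ne_zero hab)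

/-- The arithmetic input of the proof. A letter of another place has unit reduced norm at τ and
fixes the standard vertex there, while the action of the letters of place τ is described by the
factorization of elements of the local order. -/
theorem simpleData [Finite F] (hq : Odd (Nat.card F)) (hc : ¬ IsSquare c) :
    SimpleData (stdPoint c S₀) (latticeAct c S₀) (latticeLetters c S₀) letterClass where
  val_inv a := Subtype.ext (cls_neg a.1)
  closure_range := closure_range_letterClass
  exchange a b h := by
    obtain ⟨b', a', -, -, h1, h2, h3⟩ := exchange_letters hc a b h
    exact ⟨b', a', h1, h2, h3⟩
  fix a τ h := by
    rw [latticeAct_std]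
    refine mk_eq_std_iff.2 ?_
    refine mem_localStabilizer_iff.2 ⟨localLetter _ a.1, ?_, localHom_cls _ _⟩
    exact isUnit_nrd_localLetter (mt Letter.place_eq_iff.2 h)
  adj τ y := by
    refine (btGraph_adj_std hc (Units.ne_zero _) y).trans ?_
    constructor
    · rintro ⟨α, hα, rfl⟩
      refine ⟨⟨α, τ, hα⟩, Letter.place_eq_iff.2 hα, ?_⟩
      rw [latticeAct_std]
      exact congrArg _ (localHom_cls _ α)
    · rintro ⟨a, ha, rfl⟩
      refine ⟨a.1, Letter.place_eq_iff.1 ha, ?_⟩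
      rw [latticeAct_std]
      exact congrArg _ (localHom_cls _ a.1).symm
  free τ l hl hne h := by
    rw [latticeAct_std] at h
    have h1 := mk_eq_std_iff.1 h
    rw [localHom_wordProd] at h1
    refine prod_localClass_notMem hc (l.map Subtype.val) (mt List.map_eq_nil_iff.1 hne) ?_ ?_ h1
    · intro α hα
      obtain ⟨a, ha, rfl⟩ := List.mem_map.1 hα
      exact Letter.place_eq_iff.1 (hl.2 a ha)
    · rw [List.isChain_map]
      exact hl.1.imp fun a b hab h => hab (Subtype.ext h)
  transitive τ y := by
    obtain ⟨g, rfl⟩ := QuotientGroup.mk_surjective y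
    obtain ⟨z, hz, rfl⟩ := exists_localClass g
    obtain ⟨l, hl, g, hg, e⟩ := exists_prod_localLetter hc (Units.ne_zero _) hz
    have h1 : ∀ l : List (QuadExt c), (∀ α ∈ l, QuadraticAlgebra.norm α * ((τ : Fˣ) : F) = 1) →
        ∃ l' : List (Letter c S₀), (∀ a ∈ l', a.place = τ) ∧ l'.map Subtype.val = l := by
      intro l hl
      refine ⟨l.attachWith _ fun α hα => ⟨τ, hl α hα⟩, fun a ha => ?_, (List.attachWith_map_val (f := id) _).trans (List.map_id l)⟩
      exact Letter.place_eq_iff.2 (hl _ ((List.mem_attachWith _ _).1 ha))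
    obtain ⟨l', h2, rfl⟩ := h1 l hl
    refine ⟨l', h2, ?_⟩
    rw [latticeAct_std, localHom_wordProd, e, mk_mul_stabilizer hg]
  torsion := eq_one_of_mul_self (two_ne_zero_of_odd hq)
  exists_letter τ := by
    have hc0 : c ≠ 0 := by
      rintro rfl
      exact hc ⟨0, by simp⟩
    obtain ⟨α, hα⟩ := exists_norm_eq hq hc0 (((τ : Fˣ) : F)⁻¹)
    have h1 : QuadraticAlgebra.norm α * ((τ : Fˣ) : F) = 1 := by
      rw [hα, inv_mul_cancel₀ (Units.ne_zero _)]
    exact ⟨⟨α, τ, h1⟩, Letter.place_eq_iff.2 h1⟩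

end Lattice

open ExchangeData

/-! ## The presentation -/

section Presentation

variable {F : Type u} [Field F] {c : F} {S₀ : Finset Fˣ}

/-- The generator that belongs to a pair of letters. -/
def pairGen (p : (latticeLetters c S₀).Pair) : Gen c S₀ :=
  ⟨(cls p.1.1.1, cls p.1.2.1), (p.1.1.place : Fˣ), p.1.1.place.2, mem_PA_iff.2 ⟨_, rfl, rfl⟩,
    mem_PA_iff.2 ⟨_, p.2.symm, rfl⟩⟩

theorem pairGen_bijective : Function.Bijective (pairGen : (latticeLetters c S₀).Pair → Gen c S₀) := by
  constructor
  · intro p p' h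
    have h1 := congrArg Subtype.val h
    exact Subtype.ext (Prod.ext (Subtype.ext (cls_injective (congrArg Prod.fst h1)))
      (Subtype.ext (cls_injective (congrArg Prod.snd h1))))
  · rintro ⟨⟨g, g'⟩, τ, hτ, h, h'⟩
    obtain ⟨a, ha, rfl⟩ := (mem_PA_iff (τ := ⟨τ, hτ⟩)).1 h
    obtain ⟨a', ha', rfl⟩ := (mem_PA_iff (τ := ⟨τ, hτ⟩)).1 h'
    exact ⟨⟨(a, a'), ha.trans ha'.symm⟩, rfl⟩

variable {L : Type*} (e : L ≃ (latticeLetters c S₀).Pair)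

/-- The bijection between the letters and the generators. -/
def genEquiv : L ≃ Gen c S₀ := e.trans (Equiv.ofBijective pairGen pairGen_bijective)

theorem isPair_genEquiv {l : L} {α α' : QuadExt c} :
    (genEquiv e l).IsPair α α' ↔ (e l).1.1.1 = α ∧ (e l).1.2.1 = α' := by
  constructor
  · intro h
    exact ⟨cls_injective (congrArg Prod.fst h), cls_injective (congrArg Prod.snd h)⟩
  · rintro ⟨rfl, rfl⟩
    rfl

variable [Finite F] (hq : Odd (Nat.card F)) (hc : ¬ IsSquare c)

/-- The elements of `Γ × Γ` that belong to the letters. -/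
abbrev latticeExchange : (pairSystem e).ExchangeData (latticeΓ c S₀ × latticeΓ c S₀) :=
  (simpleData hq hc).pairExchange e

theorem isSquare_of_zeta {a b b' a' : L} (h : (e a).1.1.place ≠ (e b).1.1.place)
    (h1 : (e b').1.1.1 = zeta (e a).1.1.1 (e b).1.1.1 * (e b).1.1.1)
    (h2 : (e b').1.2.1 = zeta (e a).1.2.1 (e b).1.2.1 * (e b).1.2.1)
    (h3 : (e a').1.1.1 = zeta (e b).1.1.1 (e a).1.1.1 * (e a).1.1.1)
    (h4 : (e a').1.2.1 = zeta (e b).1.2.1 (e a).1.2.1 * (e a).1.2.1) :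
    (latticeExchange e hq hc).IsSquare a b b' a' := by
  have h' : (e a).1.2.place ≠ (e b).1.2.place := by
    intro h0
    exact h (((e a).2.trans h0).trans (e b).2.symm)
  obtain ⟨b₁, a₁, e1, e2, e3, e4, e5⟩ := exchange_letters hc _ _ h
  obtain ⟨b₂, a₂, e1', e2', -, -, e5'⟩ := exchange_letters hc _ _ h'
  have g1 : (e b').1.1 = b₁ := Subtype.ext (h1.trans e1.symm)
  have g2 : (e b').1.2 = b₂ := Subtype.ext (h2.trans e1'.symm)
  have g3 : (e a').1.1 = a₁ := Subtype.ext (h3.trans e2.symm)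
  have g4 : (e a').1.2 = a₂ := Subtype.ext (h4.trans e2'.symm)
  refine ⟨h, ?_, ?_, ?_⟩
  · change (e b').1.1.place = (e b).1.1.place
    rw [g1, e3]
  · change (e a').1.1.place = (e a).1.1.place
    rw [g3, e4]
  · refine Prod.ext ?_ ?_
    · change letterClass (e a).1.1 * letterClass (e b).1.1 =
        letterClass (e b').1.1 * letterClass (e a').1.1
      rw [g1, g3, e5]
    · change letterClass (e a).1.2 * letterClass (e b).1.2 =
        letterClass (e b').1.2 * letterClass (e a').1.2
      rw [g2, g4, e5']

/-- The ζ-formula gives one square for each pair of letters of different places, and squares are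
unique. So the squares of the exchange data are exactly the relations from squares in the
presentation. -/
theorem zeta_of_isSquare {a b b' a' : L} (h : (latticeExchange e hq hc).IsSquare a b b' a') :
    (e b').1.1.1 = zeta (e a).1.1.1 (e b).1.1.1 * (e b).1.1.1 ∧
    (e b').1.2.1 = zeta (e a).1.2.1 (e b).1.2.1 * (e b).1.2.1 ∧
    (e a').1.1.1 = zeta (e b).1.1.1 (e a).1.1.1 * (e a).1.1.1 ∧
    (e a').1.2.1 = zeta (e b).1.2.1 (e a).1.2.1 * (e a).1.2.1 := by
  have hab : (e a).1.1.place ≠ (e b).1.1.place := h.1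
  have hab' : (e a).1.2.place ≠ (e b).1.2.place := by
    intro h0
    exact hab (((e a).2.trans h0).trans (e b).2.symm)
  obtain ⟨b₁, a₁, e1, e2, e3, e4, -⟩ := exchange_letters hc _ _ hab
  obtain ⟨b₂, a₂, e1', e2', e3', e4', -⟩ := exchange_letters hc _ _ hab'
  let b'' : L := e.symm ⟨(b₁, b₂), e3.trans ((e b).2.trans e3'.symm)⟩
  let a'' : L := e.symm ⟨(a₁, a₂), e4.trans ((e a).2.trans e4'.symm)⟩
  have hb : (e b'').1 = (b₁, b₂) := by simp [b'']
  have ha : (e a'').1 = (a₁, a₂) := by simp [a'']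
  have h' : (latticeExchange e hq hc).IsSquare a b b'' a'' :=
    isSquare_of_zeta e hq hc hab (by rw [hb, e1]) (by rw [hb, e1']) (by rw [ha, e2]) (by rw [ha, e2'])
  obtain ⟨rfl, rfl⟩ := h.unique h'
  rw [hb, ha]
  exact ⟨e1, e1', e2, e2'⟩

/-- Under `genEquiv` the two families of relations become the stated conditions on letters. -/
theorem exists_hom {H : Type*} [Group H] (f : L → H)
    (hinv : ∀ a, f a * f ((pairSystem e).inv a) = 1)
    (hmul : ∀ a b b' a', (latticeExchange e hq hc).IsSquare a b b' a' → f a * f b = f b' * f a') :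
    ∃ φ : DoubleGroup c S₀ →* H, ∀ l, φ (PresentedGroup.of (genEquiv e l)) = f l := by
  refine ⟨PresentedGroup.toGroup (f := fun x => f ((genEquiv e).symm x)) ?_, fun l => ?_⟩
  swap
  · rw [PresentedGroup.toGroup.of, Equiv.symm_apply_apply]
  rintro r (⟨α, α', x, y, hx, hy, rfl⟩ | ⟨τ, hτ, σ, hσ, hne, α, α', β, β', h1, h2, h3, h4, x, y, y₁,
    x₁, hx, hy, hy₁, hx₁, rfl⟩)
  · obtain ⟨a, rfl⟩ := (genEquiv e).surjective x
    obtain ⟨b, rfl⟩ := (genEquiv e).surjective y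
    rw [isPair_genEquiv] at hx hy
    have hb : b = (pairSystem e).inv a := by
      apply e.injective
      apply Subtype.ext
      rw [pairSystem_inv]
      exact Prod.ext (Subtype.ext (hy.1.trans (congrArg Neg.neg hx.1.symm)))
        (Subtype.ext (hy.2.trans (congrArg Neg.neg hx.2.symm)))
    rw [map_mul, FreeGroup.lift_apply_of, FreeGroup.lift_apply_of, Equiv.symm_apply_apply,
      Equiv.symm_apply_apply, hb, hinv]
  · obtain ⟨a, rfl⟩ := (genEquiv e).surjective x
    obtain ⟨b, rfl⟩ := (genEquiv e).surjective y
    obtain ⟨b', rfl⟩ := (genEquiv e).surjective y₁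
    obtain ⟨a', rfl⟩ := (genEquiv e).surjective x₁
    rw [isPair_genEquiv] at hx hy hy₁ hx₁
    obtain ⟨rfl, rfl⟩ := hx
    obtain ⟨rfl, rfl⟩ := hy
    have hab : (e a).1.1.place ≠ (e b).1.1.place := by
      intro h0
      apply hne
      apply Units.ext
      rw [← h1, ← h3, Letter.place_eq_place.1 h0]
    rw [map_mul, map_inv, map_mul, map_mul, FreeGroup.lift_apply_of, FreeGroup.lift_apply_of,
      FreeGroup.lift_apply_of, FreeGroup.lift_apply_of]
    simp only [Equiv.symm_apply_apply]
    rw [hmul a b b' a' (isSquare_of_zeta e hq hc hab hy₁.1 hy₁.2 hx₁.1 hx₁.2), mul_inv_cancel]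

/-- The universal property of the presentation is applied twice: to the automorphisms of the trees
of words, which gives the action, and to the elements of Γ × Γ, which makes the projections
equivariant. -/
theorem exists_lift : ∃ P : (latticeExchange e hq hc).Lift (DoubleGroup c S₀),
    ∀ l, P.gen l = PresentedGroup.of (genEquiv e l) := by
  obtain ⟨φ, hφ⟩ := exists_hom e hq hc (latticeExchange e hq hc).letterIso
    (latticeExchange e hq hc).letterIso_mul_inv
    fun _ _ _ _ h => (latticeExchange e hq hc).letterIso_mul h
  obtain ⟨ψ, hψ⟩ := exists_hom e hq hc (latticeExchange e hq hc).val
    (fun a => by rw [(latticeExchange e hq hc).val_inv, mul_inv_cancel]) fun _ _ _ _ h => h.2.2.2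
  refine ⟨
    { gen := fun l => PresentedGroup.of (genEquiv e l)
      closure_range := ?_
      gen_inv := ?_
      gen_mul := ?_
      wordAct := φ
      wordAct_gen := hφ
      toM := ψ
      toM_gen := hψ }, fun l => rfl⟩
  · have h : Set.range (fun l => (PresentedGroup.of (genEquiv e l) : DoubleGroup c S₀)) =
        Set.range PresentedGroup.of := (genEquiv e).surjective.range_comp PresentedGroup.of
    rw [h]
    exact PresentedGroup.closure_range_of _
  · intro a
    refine eq_inv_of_mul_eq_one_right (PresentedGroup.one_of_mem (Or.inl ?_))
    refine ⟨_, _, genEquiv e a, genEquiv e ((pairSystem e).inv a), (isPair_genEquiv e).2 ⟨rfl, rfl⟩,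
      (isPair_genEquiv e).2 ?_, rfl⟩
    rw [pairSystem_inv]
    exact ⟨rfl, rfl⟩
  · intro a b b' a' h
    obtain ⟨h1, h2, h3, h4⟩ := zeta_of_isSquare e hq hc h
    have hn : ∀ a : Letter c S₀, (QuadraticAlgebra.norm a.1)⁻¹ = ((a.place : Fˣ) : F) := fun a =>
      inv_eq_of_mul_eq_one_right a.norm_mul_place
    refine mul_inv_eq_one.1 (PresentedGroup.one_of_mem (Or.inr ?_))
    refine ⟨_, (e a).1.1.place.2, _, (e b).1.1.place.2, fun h0 => h.1 (Subtype.ext h0), _, _, _, _,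
      hn (e a).1.1, ?_, hn (e b).1.1, ?_, genEquiv e a, genEquiv e b, genEquiv e b', genEquiv e a',
      (isPair_genEquiv e).2 ⟨rfl, rfl⟩, (isPair_genEquiv e).2 ⟨rfl, rfl⟩,
      (isPair_genEquiv e).2 ⟨h1, h2⟩, (isPair_genEquiv e).2 ⟨h3, h4⟩, rfl⟩
    · rw [show (e a).1.1.place = (e a).1.2.place from (e a).2]
      exact hn (e a).1.2
    · rw [show (e b).1.1.place = (e b).1.2.place from (e b).2]
      exact hn (e b).1.2

theorem finite_letter : Finite (Letter c S₀) := by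
  have : Finite (QuadExt c) := Finite.of_equiv _ (QuadraticAlgebra.equivProd c 0).symm
  infer_instance

end Presentation

end CubeDouble

end

/-! ### The theorem on the double -/

open CubeDouble
theorem proposition5p13 {F : Type*} [Field F] [Finite F] (hq : Odd (Nat.card F))
    (c : F) (hc : ¬ IsSquare c) (S₀ : Finset Fˣ) :
    ∃ hT : ∀ τ : S₀, (btGraph c ((τ : Fˣ) : F)).IsTree,
      -- a cube complex of dimension `#S₀` with one vertex
      (arithmeticDouble c S₀ hT).IsCubeComplex S₀.card ∧
      Nonempty (Unique ((arithmeticDouble c S₀ hT).obj 0)) ∧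
      -- the universal covering is a product of trees
      (∃ (W : S₀ → Type) (T' : ∀ τ, SimpleGraph (W τ))
        (p : (productComplex T').Hom (arithmeticDouble c S₀ hT)),
        (∀ τ, (T' τ).IsTree) ∧ p.IsUniversalCovering) ∧
      -- the presentation of the fundamental group; multiplication in Mathlib's `FundamentalGroup` is
      -- composition of arrows, concatenation of loops is the multiplication of the opposite group
      ∀ v : (arithmeticDouble c S₀ hT).obj 0,
        ∃ φ : DoubleGroup c S₀ ≃*
            (FundamentalGroup (arithmeticDouble c S₀ hT).Realization
              ((arithmeticDouble c S₀ hT).vertex v))ᵐᵒᵖ,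
          ∀ x : Gen c S₀, ∃ (e : (arithmeticDouble c S₀ hT).obj 1)
            (γ : Path ((arithmeticDouble c S₀ hT).vertex v)
              ((arithmeticDouble c S₀ hT).vertex v)),
            IsGenEdge hT x e ∧ (arithmeticDouble c S₀ hT).IsEdgePath e γ ∧
            φ (PresentedGroup.of x) =
              MulOpposite.op (FundamentalGroup.fromPath (Path.Homotopic.Quotient.mk γ)) := by
  have := finite_letter (c := c) (S₀ := S₀)
  -- The pairs of letters are numbered, so that the trees of words have vertex sets in `Type`.
  let e := (Finite.equivFin (latticeLetters c S₀).Pair).symm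
  have hT := (simpleData (S₀ := S₀) hq hc).isTree
  have D := (simpleData (S₀ := S₀) hq hc).doubleData e
  obtain ⟨P, hP⟩ := exists_lift e hq hc
  refine ⟨hT, ?_, D.nonempty_unique hT P, ?_, fun v => ?_⟩
  · rw [← Fintype.card_coe S₀]
    exact D.isCubeComplex hT P
  · exact ⟨_, _, D.covering hT, fun τ => ((pairSystem e).wordTree τ).isTree,
      D.isUniversalCovering hT P⟩
  · obtain ⟨φ, hφ⟩ := D.exists_fundamentalGroup_equiv P hT v
    refine ⟨φ, fun x => ?_⟩
    obtain ⟨a, rfl⟩ := (genEquiv e).surjective x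
    rw [← hP]
    exact hφ a
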